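/- Let $k$ be a non-archimedean local field with $2\neq 0$ in $k$. Let $\mathrm{GSp}_4(k)$ be the symplectic similitude group of $k^4$ with basis $e_1,\dots,e_4$ and symplectic form $\langle e_1,e_3\rangle=\langle e_2,e_4\rangle=1$, all other products $\langle e_i,e_j\rangle$ with $i<j$ being $0$. Let $P$ be the stabilizer of the plane $\langle e_1,e_2\rangle$ (Siegel parabolic), $Q$ the stabilizer of the line $\langle e_1\rangle$ (Klingen parabolic), $B=P\cap Q$, and let $N=\left\{\begin{pmatrix}1&n\\0&1\end{pmatrix}: n\in \mathrm{Sym}_2(k)\right\}\cong \mathrm{Sym}_2(k)$ be the unipotent radical of $P$. The group $\mathrm{GL}_2(k)$ is embedded in $P$ by $g\mapsto \begin{pmatrix} g&0\\0&\det g\cdot{}^tg^{-1}\end{pmatrix}$. The Steinberg representation $\mathrm{St}_4$ of $\mathrm{GSp}_4(k)$ is $C^\infty(B\backslash \mathrm{GSp}_4(k))/\bigl(C^\infty(P\backslash \mathrm{GSp}_4(k))+C^\infty(Q\backslash \mathrm{GSp}_4(k))\bigr)$, where $C^\infty$ denotes complex-valued locally constant functions and the group acts by right translation. Let $\psi$ be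 a nondegenerate character of $N$, i.e. $\psi(n)=\psi_{00}(\mathrm{tr}(sn))$ for a nontrivial continuous character $\psi_{00}:k\to\mathbb C^*$ and some $s\in\mathrm{Sym}_2(k)$ with $\det s\neq 0$, and put $T_s=\{g\in\mathrm{GL}_2(k): {}^tg\,s\,g=\det g\cdot s\}$. Let $K$ be a quadratic $k$-algebra embedded in $M_2(k)$ so that $K^*\subset T_s$ (so $K^*$ leaves $\psi$ invariant). For a representation $\pi$ of $\mathrm{GSp}_4(k)$ let $\pi_\psi$ be its twisted Jacquet module, i.e. the largest quotient of $\pi$ on which $N$ acts by $\psi$; it is a $K^*$-module. For a character $\chi$ of $K^*$, say that $\pi$ has a $\chi$-Bessel model if there is a nonzero linear functional $\ell$ on $\pi$ with $\ell(\pi(tn)v)=\chi(t)\psi(n)\ell(v)$ for all $t\in K^*$, $n\in N$ and all $v$ in the space of $\pi$. **Proposition.** Let $\chi$ be a (continuous) character of $K^*$ which is trivial on $k^*$. (1) If $K$ is a field, then $\mathrm{St}_4$ has a $\chi$-Bessel model if and only if $\chi$ is nontrivial. (2) If $K\cong k\oplus k$, then $\mathrm{St}_4$ has a $\chi$-Bessel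 model for every such $\chi$. (3) If $K\cong k\oplus k$, then $\mathrm{St}_{4,\psi}$ is isomorphic, as a module for $T=K^*$, to the space $\mathcal S(k^*)$ of locally constant compactly supported functions on $k^*$, where $(a,b)\in k^*\times k^*\cong K^*$ acts by $f(x)\mapsto f(x\,a/b)$. -/

import Mathlib

open scoped Matrix

namespace GSpFour

noncomputable section

section Group

variable (k : Type*) [Field k]

/-- The symplectic similitude group of the form with Gram matrix `± J`, for the basis
`e₁, e₂` (indices `inl 0`, `inl 1`), `e₃, e₄` (indices `inr 0`, `inr 1`). -/
def GSp4 : Subgroup (GL (Fin 2 ⊕ Fin 2) k) where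
  carrier := {g | ∃ c : kˣ, (g : Matrix (Fin 2 ⊕ Fin 2) (Fin 2 ⊕ Fin 2) k)ᵀ *
    Matrix.J (Fin 2) k * (g : Matrix (Fin 2 ⊕ Fin 2) (Fin 2 ⊕ Fin 2) k) =
      (c : k) • Matrix.J (Fin 2) k}
  one_mem' := ⟨1, by simp⟩
  mul_mem' := by
    rintro a b ⟨c, hc⟩ ⟨d, hd⟩
    refine ⟨c * d, ?_⟩
    calc _ = (b : Matrix _ _ k)ᵀ * ((a : Matrix _ _ k)ᵀ * Matrix.J (Fin 2) k *
          (a : Matrix _ _ k)) * (b : Matrix _ _ k) := by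
            simp only [Units.val_mul, Matrix.transpose_mul, Matrix.mul_assoc]
      _ = _ := by
            rw [hc, Matrix.mul_smul, Matrix.smul_mul, hd, smul_smul, Units.val_mul]
  inv_mem' := by
    rintro a ⟨c, hc⟩
    refine ⟨c⁻¹, ?_⟩
    have h1 : a.1 * (a⁻¹).1 = 1 := Units.mul_inv a
    have h2 : (a⁻¹).1ᵀ * a.1ᵀ = 1 := by rw [← Matrix.transpose_mul, h1, Matrix.transpose_one]
    have h3 : Matrix.J (Fin 2) k = ((c⁻¹ : kˣ) : k) • (a.1ᵀ * Matrix.J (Fin 2) k * a.1) := by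
      rw [hc, smul_smul, Units.inv_mul, one_smul]
    calc _ = (a⁻¹).1ᵀ * (((c⁻¹ : kˣ) : k) • (a.1ᵀ * Matrix.J (Fin 2) k * a.1)) * (a⁻¹).1 := by
            rw [← h3]
      _ = ((c⁻¹ : kˣ) : k) • (((a⁻¹).1ᵀ * a.1ᵀ) * Matrix.J (Fin 2) k * (a.1 * (a⁻¹).1)) := by
            simp only [Matrix.mul_smul, Matrix.smul_mul, Matrix.mul_assoc]
      _ = _ := by rw [h1, h2, Matrix.one_mul, Matrix.mul_one]

variable {k}

/-- The stabilizer in `GSp4 k` of a subspace of `k⁴`. -/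
def subspaceStabilizer (U : Submodule k (Fin 2 ⊕ Fin 2 → k)) : Subgroup (GSp4 k) where
  carrier := {g | U.map (Matrix.mulVecLin (g : GL (Fin 2 ⊕ Fin 2) k).1) = U}
  one_mem' := by simp
  mul_mem' := by
    intro a b ha hb
    simp only [Set.mem_ofPred_eq] at ha hb ⊢
    rw [Subgroup.coe_mul, Units.val_mul, Matrix.mulVecLin_mul, Submodule.map_comp, hb, ha]
  inv_mem' := by
    intro a ha
    simp only [Set.mem_ofPred_eq] at ha ⊢
    conv_lhs => rw [← ha]
    rw [← Submodule.map_comp, ← Matrix.mulVecLin_mul, Subgroup.coe_inv, ← Units.val_mul,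
      inv_mul_cancel, Units.val_one, Matrix.mulVecLin_one, Submodule.map_id]

variable (k)

/-- The Siegel parabolic: the stabilizer of the isotropic plane `⟨e₁, e₂⟩`. -/
def siegelParabolic : Subgroup (GSp4 k) :=
  subspaceStabilizer (Submodule.span k {Pi.single (Sum.inl 0) 1, Pi.single (Sum.inl 1) 1})

/-- The Klingen parabolic: the stabilizer of the line `⟨e₁⟩`. -/
def klingenParabolic : Subgroup (GSp4 k) :=
  subspaceStabilizer (Submodule.span k {Pi.single (Sum.inl 0) 1})

/-- The standard minimal parabolic: the stabilizer of the flag `⟨e₁⟩ ⊂ ⟨e₁, e₂⟩`. -/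
def borel : Subgroup (GSp4 k) := siegelParabolic k ⊓ klingenParabolic k

variable {k}

/-- The embedding `g ↦ diag (g, det g • ᵗg⁻¹)` of `GL₂(k)` into the Levi subgroup `M` of the
Siegel parabolic. -/
def leviEmb : GL (Fin 2) k →* GSp4 k where
  toFun g := ⟨⟨Matrix.fromBlocks g.1 0 0 (g.1.det • (g⁻¹).1ᵀ),
      Matrix.fromBlocks (g⁻¹).1 0 0 ((g⁻¹).1.det • g.1ᵀ),
      by
        have h : g.1 * (g⁻¹).1 = 1 := Units.mul_inv g
        have h' : (g⁻¹).1.det * g.1.det = 1 := by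
          rw [mul_comm, ← Matrix.det_mul, h, Matrix.det_one]
        simp only [Matrix.fromBlocks_multiply, Matrix.mul_zero, Matrix.zero_mul, add_zero,
          zero_add, smul_zero, Matrix.smul_mul, Matrix.mul_smul, smul_smul, h, h', ← Matrix.transpose_mul,
          Matrix.transpose_one, one_smul, Matrix.fromBlocks_one],
      by
        have h : (g⁻¹).1 * g.1 = 1 := Units.inv_mul g
        have h' : g.1.det * (g⁻¹).1.det = 1 := by
          rw [mul_comm, ← Matrix.det_mul, h, Matrix.det_one]
        simp only [Matrix.fromBlocks_multiply, Matrix.mul_zero, Matrix.zero_mul, add_zero,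
          zero_add, smul_zero, Matrix.smul_mul, Matrix.mul_smul, smul_smul, h, h', ← Matrix.transpose_mul,
          Matrix.transpose_one, one_smul, Matrix.fromBlocks_one]⟩,
    ⟨Matrix.GeneralLinearGroup.det g, by
      have h : (g⁻¹).1 * g.1 = 1 := Units.inv_mul g
      have h2 : g.1ᵀ * (g⁻¹).1ᵀ = 1 := by rw [← Matrix.transpose_mul, h, Matrix.transpose_one]
      simp only [Matrix.J, Matrix.fromBlocks_transpose, Matrix.fromBlocks_multiply,
        Matrix.transpose_zero, Matrix.transpose_smul, Matrix.transpose_transpose, Matrix.mul_zero,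
        Matrix.zero_mul, add_zero, zero_add, Matrix.mul_one, Matrix.smul_mul, Matrix.mul_smul,
        Matrix.mul_neg, Matrix.neg_mul, h, h2, Matrix.fromBlocks_smul, smul_zero, smul_neg, neg_zero,
        Matrix.GeneralLinearGroup.val_det_apply]⟩⟩
  map_one' := by
    apply Subtype.ext; apply Units.ext
    simp
  map_mul' g h := by
    apply Subtype.ext; apply Units.ext
    simp [Matrix.fromBlocks_multiply, Matrix.transpose_mul, smul_smul, mul_comm]

/-- The element `[[1, n], [0, 1]]`, for symmetric `n`, of the unipotent radical
`N ≅ Sym₂(k)` of the Siegel parabolic. -/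
def unipEmb (n : {n : Matrix (Fin 2) (Fin 2) k // n.IsSymm}) : GSp4 k :=
  ⟨⟨Matrix.fromBlocks 1 n.1 0 1, Matrix.fromBlocks 1 (-n.1) 0 1,
      by simp [Matrix.fromBlocks_multiply], by simp [Matrix.fromBlocks_multiply]⟩,
    ⟨1, by
      simp [Matrix.J, Matrix.fromBlocks_transpose, Matrix.fromBlocks_multiply, n.2.eq]⟩⟩

/-- The torus `T_s = {g ∈ GL₂(k) | ᵗg s g = det g • s}` attached to a symmetric matrix `s`. -/
def besselTorus (s : Matrix (Fin 2) (Fin 2) k) : Subgroup (GL (Fin 2) k) where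
  carrier := {g | g.1ᵀ * s * g.1 = g.1.det • s}
  one_mem' := by simp
  mul_mem' := by
    intro a b ha hb
    simp only [Set.mem_ofPred_eq] at ha hb ⊢
    calc _ = b.1ᵀ * (a.1ᵀ * s * a.1) * b.1 := by
            simp only [Units.val_mul, Matrix.transpose_mul, Matrix.mul_assoc]
      _ = _ := by
            rw [ha, Matrix.mul_smul, Matrix.smul_mul, hb, smul_smul, Units.val_mul,
              Matrix.det_mul]
  inv_mem' := by
    intro a ha
    simp only [Set.mem_ofPred_eq] at ha ⊢
    have h1 : a.1 * (a⁻¹).1 = 1 := Units.mul_inv a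
    have h2 : (a⁻¹).1ᵀ * a.1ᵀ = 1 := by rw [← Matrix.transpose_mul, h1, Matrix.transpose_one]
    have h3 : (a⁻¹).1.det * a.1.det = 1 := by
      rw [mul_comm, ← Matrix.det_mul, h1, Matrix.det_one]
    have h4 : s = (a⁻¹).1.det • (a.1ᵀ * s * a.1) := by rw [ha, smul_smul, h3, one_smul]
    calc _ = (a⁻¹).1ᵀ * ((a⁻¹).1.det • (a.1ᵀ * s * a.1)) * (a⁻¹).1 := by rw [← h4]
      _ = (a⁻¹).1.det • (((a⁻¹).1ᵀ * a.1ᵀ) * s * (a.1 * (a⁻¹).1)) := by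
            simp only [Matrix.mul_smul, Matrix.smul_mul, Matrix.mul_assoc]
      _ = _ := by rw [h1, h2, Matrix.one_mul, Matrix.mul_one]

/-- The character `ψ(n) = ψ₀₀ (tr (s n))` of `N ≅ Sym₂(k)`. -/
def unipChar (ψ₀₀ : AddChar k ℂ) (s : Matrix (Fin 2) (Fin 2) k)
    (n : {n : Matrix (Fin 2) (Fin 2) k // n.IsSymm}) : ℂ :=
  ψ₀₀ (s * n.1).trace

end Group

section TwistedJacquet

variable {k : Type*} [Field k] {V : Type*} [AddCommGroup V] [Module ℂ V]

/-- The span of the vectors `π(n) v - ψ(n) v`. -/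
def twistedJacquetKer (π : Representation ℂ (GSp4 k) V) (ψ₀₀ : AddChar k ℂ)
    (s : Matrix (Fin 2) (Fin 2) k) : Submodule ℂ V :=
  Submodule.span ℂ {w | ∃ n v, w = π (unipEmb n) v - unipChar ψ₀₀ s n • v}

/-- `T_s` fixes the character `ψ` of `N`, so it preserves the kernel of `π → π_ψ`. -/
theorem twistedJacquetKer_le_comap (π : Representation ℂ (GSp4 k) V) (ψ₀₀ : AddChar k ℂ)
    (s : Matrix (Fin 2) (Fin 2) k) (t : besselTorus s) :
    twistedJacquetKer π ψ₀₀ s ≤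
      (twistedJacquetKer π ψ₀₀ s).comap (π (leviEmb (t : GL (Fin 2) k))) := by
  refine Submodule.span_le.2 ?_
  rintro w ⟨n, v, rfl⟩
  obtain ⟨g, hg⟩ := t
  have hg' : g.1ᵀ * s * g.1 = g.1.det • s := hg
  have h1 : g.1 * (g⁻¹).1 = 1 := Units.mul_inv g
  have h2 : (g⁻¹).1 * g.1 = 1 := Units.inv_mul g
  have h3 : (g⁻¹).1.det * g.1.det = 1 := by rw [← Matrix.det_mul, h2, Matrix.det_one]
  have h4 : g.1ᵀ * (g⁻¹).1ᵀ = 1 := by rw [← Matrix.transpose_mul, h2, Matrix.transpose_one]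
  let m : {n : Matrix (Fin 2) (Fin 2) k // n.IsSymm} :=
    ⟨(g⁻¹).1.det • (g.1 * n.1 * g.1ᵀ), by
      simp only [Matrix.IsSymm, Matrix.transpose_smul, Matrix.transpose_mul,
        Matrix.transpose_transpose, n.2.eq, Matrix.mul_assoc]⟩
  have key : leviEmb g * unipEmb n = unipEmb m * leviEmb g := by
    apply Subtype.ext; apply Units.ext
    have : g.1.det • (g⁻¹).1.det • (g.1 * n.1 * g.1ᵀ * (g⁻¹).1ᵀ) = g.1 * n.1 := by
      rw [smul_smul, mul_comm, h3, one_smul, Matrix.mul_assoc, h4, Matrix.mul_one]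
    simp only [Subgroup.coe_mul, Units.val_mul, leviEmb, unipEmb, MonoidHom.coe_mk,
      OneHom.coe_mk, Matrix.fromBlocks_multiply, m, Matrix.smul_mul, Matrix.mul_smul, this,
      Matrix.mul_zero, Matrix.zero_mul, add_zero, zero_add, Matrix.mul_one, Matrix.one_mul]
  have hch : unipChar ψ₀₀ s m = unipChar ψ₀₀ s n := by
    unfold unipChar
    congr 1
    calc (s * ((g⁻¹).1.det • (g.1 * n.1 * g.1ᵀ))).trace
        = (g⁻¹).1.det • ((s * g.1 * n.1) * g.1ᵀ).trace := by
          rw [Matrix.mul_smul, Matrix.trace_smul]; simp only [Matrix.mul_assoc]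
      _ = (g⁻¹).1.det • ((g.1ᵀ * s * g.1) * n.1).trace := by
          rw [Matrix.trace_mul_comm]; simp only [Matrix.mul_assoc]
      _ = (s * n.1).trace := by
          rw [hg', Matrix.smul_mul, Matrix.trace_smul, smul_smul, h3, one_smul]
  refine Submodule.subset_span ⟨m, π (leviEmb g) v, ?_⟩
  rw [map_sub, map_smul, hch, ← Module.End.mul_apply, ← map_mul, key, map_mul,
    Module.End.mul_apply]

/-- The twisted Jacquet module `π_ψ`, the largest quotient of `π` on which `N` acts by `ψ`, as a
representation of `T_s`. -/
def twistedJacquet (π : Representation ℂ (GSp4 k) V) (ψ₀₀ : AddChar k ℂ)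
    (s : Matrix (Fin 2) (Fin 2) k) :
    Representation ℂ (besselTorus s) (V ⧸ twistedJacquetKer π ψ₀₀ s) :=
  Representation.quotient
    ((π.comp leviEmb).comp (besselTorus s).subtype : Representation ℂ (besselTorus s) V)
    (twistedJacquetKer π ψ₀₀ s) (twistedJacquetKer_le_comap π ψ₀₀ s)

variable {K : Type*} [CommRing K] [Algebra k K]

/-- The inclusion `K^* → GL₂(k)` induced by an algebra map `K → M₂(k)`. -/
def unitsEmb (ι : K →ₐ[k] Matrix (Fin 2) (Fin 2) k) : Kˣ →* GL (Fin 2) k :=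
  Units.map (ι : K →* Matrix (Fin 2) (Fin 2) k)

/-- The space `Hom_R(π, χ)` of Bessel functionals, for `R = K^* N` and the character of `R` which
is `χ` on `K^*` and `ψ` on `N`. -/
def besselFunctionals (π : Representation ℂ (GSp4 k) V) (ψ₀₀ : AddChar k ℂ)
    (s : Matrix (Fin 2) (Fin 2) k) (ι : K →ₐ[k] Matrix (Fin 2) (Fin 2) k) (χ : Kˣ →* ℂˣ) :
    Submodule ℂ (V →ₗ[ℂ] ℂ) where
  carrier := {l | ∀ (x : Kˣ) (n : {n : Matrix (Fin 2) (Fin 2) k // n.IsSymm}) (v : V),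
    l (π (leviEmb (unitsEmb ι x) * unipEmb n) v) = (χ x : ℂ) * unipChar ψ₀₀ s n * l v}
  zero_mem' := by simp
  add_mem' := by
    intro a b ha hb x n v
    rw [LinearMap.add_apply, LinearMap.add_apply, ha x n v, hb x n v, mul_add]
  smul_mem' := by
    intro c a ha x n v
    rw [LinearMap.smul_apply, LinearMap.smul_apply, ha x n v, smul_eq_mul, smul_eq_mul]
    ring

/-- `π` has a Bessel model for the character `χ` of `K^*`: `Hom_R(π, χ) ≠ 0`. -/
def HasBesselModel (π : Representation ℂ (GSp4 k) V) (ψ₀₀ : AddChar k ℂ)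
    (s : Matrix (Fin 2) (Fin 2) k) (ι : K →ₐ[k] Matrix (Fin 2) (Fin 2) k) (χ : Kˣ →* ℂˣ) : Prop :=
  besselFunctionals π ψ₀₀ s ι χ ≠ ⊥

end TwistedJacquet

section Functions

variable {G : Type*} [Group G]

variable (G) in
/-- Right translation, `(g • f) x = f (x g)`, on all complex functions on a group. -/
def rightTranslation : Representation ℂ G (G → ℂ) where
  toFun g := LinearMap.funLeft ℂ ℂ (fun x => x * g)
  map_one' := by ext f x; simp [LinearMap.funLeft_apply]
  map_mul' g h := by ext f x; simp [LinearMap.funLeft_apply, mul_assoc]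

variable [TopologicalSpace G]

/-- The locally constant functions on `H \ G`, as functions on `G` invariant under left
translation by `H`. -/
def smoothFunctions (H : Subgroup G) : Submodule ℂ (G → ℂ) where
  carrier := {f | IsLocallyConstant f ∧ ∀ h ∈ H, ∀ g, f (h * g) = f g}
  zero_mem' := ⟨IsLocallyConstant.const 0, fun _ _ _ => rfl⟩
  add_mem' := fun ha hb => ⟨ha.1.add hb.1, fun h hh g => by
    rw [Pi.add_apply, Pi.add_apply, ha.2 h hh g, hb.2 h hh g]⟩
  smul_mem' := fun c _ ha => ⟨ha.1.comp (fun z => c • z), fun h hh g => by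
    rw [Pi.smul_apply, Pi.smul_apply, ha.2 h hh g]⟩

theorem smoothFunctions_le_comap [ContinuousMul G] (H : Subgroup G) (g : G) :
    smoothFunctions H ≤ (smoothFunctions H).comap (rightTranslation G g) := by
  rintro f ⟨hf, hf'⟩
  refine ⟨hf.comp_continuous (continuous_mul_const g), fun h hh x => ?_⟩
  change f (h * x * g) = f (x * g)
  rw [mul_assoc, hf' h hh]

end Functions

section Steinberg

variable (k : Type*) [Field k] [TopologicalSpace k]

/-- Inside the locally constant functions on `B \ GSp₄(k)`, the sum of the subspaces of functions
coming from `P \ GSp₄(k)` and from `Q \ GSp₄(k)`, where `P` and `Q` are the two maximal parabolics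
containing `B`. -/
def steinbergKer : Submodule ℂ (smoothFunctions (borel k)) :=
  (smoothFunctions (siegelParabolic k) ⊔ smoothFunctions (klingenParabolic k)).comap
    (smoothFunctions (borel k)).subtype

/-- The space of the Steinberg representation, `C^∞(B\G) / (C^∞(P\G) + C^∞(Q\G))`. -/
abbrev SteinbergSpace : Type _ := smoothFunctions (borel k) ⧸ steinbergKer k

/-- The Steinberg representation of `GSp₄(k)`, acting by right translation. -/
def steinberg [IsTopologicalRing k] : Representation ℂ (GSp4 k) (SteinbergSpace k) :=
  Representation.quotient
    (Representation.subrepresentation (rightTranslation (GSp4 k)) (smoothFunctions (borel k))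
      (smoothFunctions_le_comap _))
    (steinbergKer k) (by
      rintro g f hf
      have h := sup_le_sup (smoothFunctions_le_comap (siegelParabolic k) g)
        (smoothFunctions_le_comap (klingenParabolic k) g) hf
      obtain ⟨a, ha, b, hb, hab⟩ := Submodule.mem_sup.1 h
      refine Submodule.mem_sup.2 ⟨_, ha, _, hb, ?_⟩
      rw [← map_add, hab]
      rfl)

/-- `𝒮(k^*)`: locally constant, compactly supported functions on `k^*`. -/
def schwartz : Submodule ℂ (kˣ → ℂ) where
  carrier := {f | IsLocallyConstant f ∧ HasCompactSupport f}
  zero_mem' := ⟨IsLocallyConstant.const 0, HasCompactSupport.zero⟩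
  add_mem' := fun ha hb => ⟨ha.1.add hb.1, ha.2.add hb.2⟩
  smul_mem' := fun c _ ha => ⟨ha.1.comp (fun z => c • z), ha.2.comp_left (smul_zero c)⟩

/-- `𝒮(k^*)` as a representation of `k^*` by translation. -/
def schwartzRep [IsTopologicalRing k] : Representation ℂ kˣ (schwartz k) :=
  Representation.subrepresentation (rightTranslation kˣ) (schwartz k) (by
    rintro a f ⟨hf, hf'⟩
    exact ⟨hf.comp_continuous (continuous_mul_const a),
      hf'.comp_homeomorph (Homeomorph.mulRight a)⟩)

end Steinberg

/-- For `K ≅ k ⊕ k`, the homomorphism `(a, b) ↦ a / b` from `K^*` onto `K^* / k^* ≅ k^*`. -/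
def splitRatio {k K : Type*} [Field k] [CommRing K] [Algebra k K] (e : K ≃ₐ[k] k × k) :
    Kˣ →* kˣ :=
  Units.map ((MonoidHom.fst k k).comp (e : K →* k × k)) /
    Units.map ((MonoidHom.snd k k).comp (e : K →* k × k))

end

end GSpFour

set_option linter.unusedSectionVars false

/-! A coset `B g` is a flag in the space of rows: the line spanned by the third row of `g`, inside
the plane spanned by the last two rows `(L | R)`, where `L = lowL g` and `R = lowR g`. Cosets of `P`
remember only the plane, cosets of `Q` only the line. Right multiplication by `N` is `(L | R) ↦ (L |
L n + R)`; it fixes pointwise the plane `W = {L = 0}`. The statement that carries everything is that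
the twisted Jacquet module of the Steinberg representation is the space of locally constant
functions on `ℙ¹(k)` modulo constants, with `T_s` acting by right translation
(`exists_twistedJacquet_equiv`).

Integrating against `ψ⁻¹` over large lattices of `N` does not change a class in the twisted Jacquet
module, and it kills a function along any `N`-orbit of flags fixed by some `n` with `ψ n ≠ 1`
(`exists_average`, `twist_eq_zero`). Flags whose line lies in `W` are of this kind. Any other flag
outside the open cell has a plane meeting `W` and is determined by its line, so functions there come
from `Q \ G` (`exists_klingen_extension`). What remains is the open cell `det L ≠ 0`, which is `ℙ¹ ×
N`; there, passing to the twisted quotient is integration along `N` against `ψ⁻¹`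
(`mem_twistSpan_of_cellIntegral_eq_zero`). Functions from `P \ G` contribute constants on `ℙ¹`;
those from `Q \ G` contribute nothing at lines not isotropic for `s`, and such lines are dense
(`mem_sup_twistSpan_iff`). No modulus factor occurs, because the embedded `GL₂` preserves Haar
measure on `N`.

If `K` is a field, `ℙ¹` is the compact group `K^* / k^*`, and the equivariant functional is
integration against `χ⁻¹`, which kills constants exactly when `χ ≠ 1` (`eq_zero_of_invariant`,
`exists_equivariant_functional`). If `K` is split, `ℙ¹` is `k^*` with two fixed points added. A
function on it is the sum of a part with mean zero on each coset of the units, already compactly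
supported in `k^*`, and a sequence on `ℤ` constant near both ends. Modulo constants, taking
differences makes the latter finitely supported, which yields `𝒮(k^*)`
(`exists_rowFunctions_to_schwartz`). Integrating against `χ⁻¹` on `k^*` then gives a functional for
every `χ`. -/

namespace GSpFour
noncomputable section
-- Cosets of the parabolic subgroups in terms of rows
section Rows
variable {k : Type*} [Field k]

/-- The underlying matrix of an element of `GSp4 k`. -/
def mat (g : GSp4 k) : Matrix (Fin 2 ⊕ Fin 2) (Fin 2 ⊕ Fin 2) k := (g : GL (Fin 2 ⊕ Fin 2) k).1

theorem mat_mul (g h : GSp4 k) : mat (g * h) = mat g * mat h := rfl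

@[simp] theorem mat_one : mat (1 : GSp4 k) = 1 := rfl

theorem mat_mul_inv (g : GSp4 k) : mat g * mat g⁻¹ = 1 := by rw [← mat_mul, mul_inv_cancel, mat_one]

theorem mat_inv_mul (g : GSp4 k) : mat g⁻¹ * mat g = 1 := by rw [← mat_mul, inv_mul_cancel, mat_one]

theorem mat_injective : Function.Injective (mat : GSp4 k → _) := fun _ _ h =>
  Subtype.ext (Units.ext h)

theorem exists_transpose_mul_J_mul (g : GSp4 k) : ∃ c : k, c ≠ 0 ∧
    (mat g)ᵀ * Matrix.J (Fin 2) k * mat g = c • Matrix.J (Fin 2) k := by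
  obtain ⟨c, hc⟩ := g.2
  exact ⟨c, c.ne_zero, hc⟩

/-- This is the symplectic relation for rows instead of columns. It is needed because cosets `H g`
of a parabolic subgroup are read off the rows of `g`. -/
theorem exists_mul_J_mul_transpose (g : GSp4 k) : ∃ c : k, c ≠ 0 ∧
    mat g * Matrix.J (Fin 2) k * (mat g)ᵀ = c • Matrix.J (Fin 2) k := by
  obtain ⟨c, hc, h⟩ := exists_transpose_mul_J_mul g⁻¹
  refine ⟨c⁻¹, inv_ne_zero hc, ?_⟩
  have h1 : (mat g)ᵀ * (mat g⁻¹)ᵀ = 1 := by rw [← Matrix.transpose_mul, mat_inv_mul, Matrix.transpose_one]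
  -- invert `g⁻ᵀ J g⁻¹ = c J`
  have hJ : Matrix.J (Fin 2) k * Matrix.J (Fin 2) k = -1 := Matrix.J_squared _ _
  have h2 : ((mat g⁻¹)ᵀ * Matrix.J (Fin 2) k * mat g⁻¹) *
      (mat g * Matrix.J (Fin 2) k * (mat g)ᵀ) = -1 := by
    calc _ = (mat g⁻¹)ᵀ * (Matrix.J (Fin 2) k * (mat g⁻¹ * mat g) * Matrix.J (Fin 2) k) *
          (mat g)ᵀ := by simp only [Matrix.mul_assoc]
      _ = -((mat g⁻¹)ᵀ * (mat g)ᵀ) := by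
        rw [mat_inv_mul, Matrix.mul_one, hJ]; simp
      _ = -1 := by rw [← Matrix.transpose_mul, mat_mul_inv, Matrix.transpose_one]
  rw [h, Matrix.smul_mul] at h2
  have h3 := congrArg (fun M => (-c⁻¹) • (Matrix.J (Fin 2) k * M)) h2
  simp only [Matrix.mul_smul, ← Matrix.mul_assoc, hJ, smul_smul] at h3
  simpa [hc, Matrix.mul_assoc] using h3

theorem mem_subspaceStabilizer_of_forall {U : Submodule k (Fin 2 ⊕ Fin 2 → k)} {y : GSp4 k}
    (h : ∀ u ∈ U, (mat y).mulVec u ∈ U) : y ∈ subspaceStabilizer U := by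
  change U.map (Matrix.mulVecLin (mat y)) = U
  refine Submodule.eq_of_le_of_finrank_le (Submodule.map_le_iff_le_comap.2 fun u hu => h u hu) ?_
  have hinj : Function.Injective (Matrix.mulVecLin (mat y)) := by
    intro u v huv
    have := congrArg (fun w => (mat y⁻¹).mulVec w) huv
    simpa [Matrix.mulVec_mulVec, mat_inv_mul] using this
  exact (LinearEquiv.finrank_eq (Submodule.equivMapOfInjective _ hinj U)).le
 
theorem mulVec_mem_of_mem_subspaceStabilizer {U : Submodule k (Fin 2 ⊕ Fin 2 → k)} {y : GSp4 k}
    (hy : y ∈ subspaceStabilizer U) {u} (hu : u ∈ U) : (mat y).mulVec u ∈ U := by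
  have h : U.map (Matrix.mulVecLin (mat y)) = U := hy
  rw [← h]
  exact ⟨u, hu, rfl⟩

theorem mem_klingenParabolic_iff_col {y : GSp4 k} : y ∈ klingenParabolic k ↔
    mat y (Sum.inl 1) (Sum.inl 0) = 0 ∧ mat y (Sum.inr 0) (Sum.inl 0) = 0 ∧
      mat y (Sum.inr 1) (Sum.inl 0) = 0 := by
  constructor
  · intro h
    have := mulVec_mem_of_mem_subspaceStabilizer h (Submodule.mem_span_singleton_self _)
    obtain ⟨a, ha⟩ := Submodule.mem_span_singleton.1 this
    simp only [Matrix.mulVec_single_one] at ha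
    refine ⟨?_, ?_, ?_⟩
    · simpa using (congrFun ha (Sum.inl 1)).symm
    · simpa using (congrFun ha (Sum.inr 0)).symm
    · simpa using (congrFun ha (Sum.inr 1)).symm
  · rintro ⟨h1, h2, h3⟩
    refine mem_subspaceStabilizer_of_forall fun u hu => ?_
    obtain ⟨a, rfl⟩ := Submodule.mem_span_singleton.1 hu
    refine Submodule.mem_span_singleton.2 ⟨a * mat y (Sum.inl 0) (Sum.inl 0), ?_⟩
    rw [Matrix.mulVec_smul, Matrix.mulVec_single_one]
    ext (i | i) <;> fin_cases i <;> simp [h1, h2, h3]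

theorem mem_siegelParabolic_iff {y : GSp4 k} : y ∈ siegelParabolic k ↔
    ∀ i j, mat y (Sum.inr i) (Sum.inl j) = 0 := by
  have key : ∀ u : Fin 2 ⊕ Fin 2 → k, u ∈ Submodule.span k
      {(Pi.single (Sum.inl 0) 1 : Fin 2 ⊕ Fin 2 → k), Pi.single (Sum.inl 1) 1} ↔
      ∀ i, u (Sum.inr i) = 0 := by
    intro u
    rw [Submodule.mem_span_pair]
    constructor
    · rintro ⟨a, b, rfl⟩ i
      simp
    · intro h
      refine ⟨u (Sum.inl 0), u (Sum.inl 1), ?_⟩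
      ext (i | i) <;> fin_cases i <;> simp [h]
  constructor
  · intro h i j
    have h1 := (key _).1 (mulVec_mem_of_mem_subspaceStabilizer h
      ((key (Pi.single (Sum.inl j) 1)).2 (by simp))) i
    simpa using h1
  · intro h
    refine mem_subspaceStabilizer_of_forall fun u hu => (key _).2 fun i => ?_
    have := (key u).1 hu
    simp [Matrix.mulVec, dotProduct, Fintype.sum_sum_type, h, this]

/-- Fixing the line `⟨e₁⟩` amounts to fixing its orthogonal hyperplane, whose equation is the third
coordinate. -/
theorem mem_klingenParabolic_iff {y : GSp4 k} : y ∈ klingenParabolic k ↔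
    mat y (Sum.inr 0) (Sum.inl 0) = 0 ∧ mat y (Sum.inr 0) (Sum.inl 1) = 0 ∧
      mat y (Sum.inr 0) (Sum.inr 1) = 0 := by
  rw [mem_klingenParabolic_iff_col]
  constructor
  · rintro ⟨h1, h2, h3⟩
    obtain ⟨c, hc, h⟩ := exists_transpose_mul_J_mul y
    have e := fun j => congrFun (congrFun h (Sum.inl 0)) j
    simp only [Matrix.mul_apply, Fintype.sum_sum_type, Fin.sum_univ_two, Matrix.J,
      Matrix.transpose_apply, Matrix.smul_apply, Matrix.fromBlocks_apply₁₁,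
      Matrix.fromBlocks_apply₁₂, Matrix.fromBlocks_apply₂₁, Matrix.fromBlocks_apply₂₂, h1, h2, h3]
      at e
    have e0 := e (Sum.inl 0)
    have e1 := e (Sum.inl 1)
    have e2 := e (Sum.inr 0)
    have e3 := e (Sum.inr 1)
    simp at e0 e1 e2 e3
    have ha : mat y (Sum.inl 0) (Sum.inl 0) ≠ 0 := by
      rintro ha
      rw [ha] at e2
      exact hc (by simpa using e2.symm)
    exact ⟨h2, e1.resolve_left ha, e3.resolve_left ha⟩
  · rintro ⟨h1, h2, h3⟩
    obtain ⟨c, hc, h⟩ := exists_mul_J_mul_transpose y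
    have e := fun j => congrFun (congrFun h (Sum.inr 0)) j
    simp only [Matrix.mul_apply, Fintype.sum_sum_type, Fin.sum_univ_two, Matrix.J,
      Matrix.transpose_apply, Matrix.smul_apply, Matrix.fromBlocks_apply₁₁,
      Matrix.fromBlocks_apply₁₂, Matrix.fromBlocks_apply₂₁, Matrix.fromBlocks_apply₂₂, h1, h2, h3]
      at e
    have e0 := e (Sum.inl 0)
    have e1 := e (Sum.inl 1)
    have e2 := e (Sum.inr 0)
    have e3 := e (Sum.inr 1)
    simp at e0 e1 e2 e3
    have ha : mat y (Sum.inr 0) (Sum.inr 0) ≠ 0 := by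
      rintro ha
      rw [ha] at e0
      exact hc (by simpa using e0.symm)
    exact ⟨e1.resolve_left ha, h1, e3.resolve_left ha⟩

theorem mat_mul_inv_row {g g' : GSp4 k} {i : Fin 2 ⊕ Fin 2} {u : Fin 2 ⊕ Fin 2 → k}
    (h : mat g' i = Matrix.vecMul u (mat g)) : mat (g' * g⁻¹) i = u := by
  rw [mat_mul, Matrix.mul_apply_eq_vecMul, h, Matrix.vecMul_vecMul, mat_mul_inv, Matrix.vecMul_one]

/-- Two elements whose third rows are proportional lie in the same coset of the Klingen parabolic. -/
theorem mul_inv_mem_klingenParabolic {g g' : GSp4 k} {a : k}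
    (h : mat g' (Sum.inr 0) = a • mat g (Sum.inr 0)) : g' * g⁻¹ ∈ klingenParabolic k := by
  have := mat_mul_inv_row (g := g) (g' := g') (i := Sum.inr 0) (u := Pi.single (Sum.inr 0) a) (by
    rw [Matrix.single_vecMul, h]; rfl)
  rw [mem_klingenParabolic_iff, this]
  simp

/-- Two elements whose last two rows span the same plane lie in the same coset of the Siegel
parabolic. -/
theorem mul_inv_mem_siegelParabolic {g g' : GSp4 k} {X : Matrix (Fin 2) (Fin 2) k}
    (h : ∀ i, mat g' (Sum.inr i) = X i 0 • mat g (Sum.inr 0) + X i 1 • mat g (Sum.inr 1)) :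
    g' * g⁻¹ ∈ siegelParabolic k := by
  rw [mem_siegelParabolic_iff]
  intro i j
  have := mat_mul_inv_row (g := g) (g' := g') (i := Sum.inr i)
    (u := Pi.single (Sum.inr 0) (X i 0) + Pi.single (Sum.inr 1) (X i 1)) (by
    rw [Matrix.add_vecMul, Matrix.single_vecMul, Matrix.single_vecMul, h]; rfl)
  rw [this]
  simp

theorem row_mul_of_mem_klingenParabolic {y : GSp4 k} (hy : y ∈ klingenParabolic k) (g : GSp4 k) :
    mat (y * g) (Sum.inr 0) = mat y (Sum.inr 0) (Sum.inr 0) • mat g (Sum.inr 0) := by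
  obtain ⟨h1, h2, h3⟩ := mem_klingenParabolic_iff.1 hy
  ext j
  simp [mat_mul, Matrix.mul_apply, Fintype.sum_sum_type, h1, h2, h3]

end Rows

/-! ### The lower blocks of a matrix and the open cell -/

section Cell
variable {k : Type*} [Field k]

/-- The space of symmetric `2 × 2` matrices. -/
def symmMat (k : Type*) [Field k] : Submodule k (Matrix (Fin 2) (Fin 2) k) where
  carrier := {n | n.IsSymm}
  zero_mem' := Matrix.isSymm_zero
  add_mem' := fun ha hb => ha.add hb
  smul_mem' := fun c _ ha => ha.smul c

theorem symmMat_transpose (n : symmMat k) : n.1ᵀ = n.1 := n.2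

/-- `unipEmb`, on the additive group of symmetric matrices. -/
def unip (n : symmMat k) : GSp4 k := unipEmb ⟨n.1, n.2⟩

theorem mat_unip (n : symmMat k) : mat (unip n) = Matrix.fromBlocks 1 n.1 0 1 := rfl

theorem unip_add (m n : symmMat k) : unip (m + n) = unip m * unip n := by
  apply mat_injective
  simp [mat_mul, mat_unip, Matrix.fromBlocks_multiply, add_comm]

@[simp] theorem unip_zero : unip (0 : symmMat k) = 1 := by
  apply mat_injective
  simp [mat_unip]

theorem mat_leviEmb (t : GL (Fin 2) k) : mat (leviEmb t) =
    Matrix.fromBlocks t.1 0 0 (t.1.det • (t⁻¹).1ᵀ) := rfl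

variable (k) in
/-- The long Weyl element, exchanging the two standard isotropic planes. -/
def weyl : GSp4 k :=
  ⟨⟨Matrix.fromBlocks 0 (-1) 1 0, Matrix.fromBlocks 0 1 (-1) 0,
      by simp [Matrix.fromBlocks_multiply], by simp [Matrix.fromBlocks_multiply]⟩,
    ⟨1, by simp [Matrix.J, Matrix.fromBlocks_transpose, Matrix.fromBlocks_multiply]⟩⟩

theorem mat_weyl : mat (weyl k) = Matrix.fromBlocks 0 (-1) 1 0 := rfl

/-- The elements `w m(h) n` representing the open cell `P w N`. -/
def cell (h : GL (Fin 2) k) (n : symmMat k) : GSp4 k := weyl k * leviEmb h * unip n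

/-- The lower left block. -/
def lowL (g : GSp4 k) : Matrix (Fin 2) (Fin 2) k := (mat g).toBlocks₂₁

/-- The lower right block. -/
def lowR (g : GSp4 k) : Matrix (Fin 2) (Fin 2) k := (mat g).toBlocks₂₂

theorem mat_apply_inr_inl (g : GSp4 k) (i j) : mat g (Sum.inr i) (Sum.inl j) = lowL g i j := rfl

theorem mat_apply_inr_inr (g : GSp4 k) (i j) : mat g (Sum.inr i) (Sum.inr j) = lowR g i j := rfl

theorem lowL_mul_unip (g : GSp4 k) (n : symmMat k) : lowL (g * unip n) = lowL g := by
  unfold lowL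
  rw [mat_mul, ← Matrix.fromBlocks_toBlocks (mat g), mat_unip, Matrix.fromBlocks_multiply]
  simp

theorem lowR_mul_unip (g : GSp4 k) (n : symmMat k) :
    lowR (g * unip n) = lowL g * n.1 + lowR g := by
  unfold lowL lowR
  rw [mat_mul, ← Matrix.fromBlocks_toBlocks (mat g), mat_unip, Matrix.fromBlocks_multiply]
  simp

theorem lowL_mul_leviEmb (g : GSp4 k) (t : GL (Fin 2) k) :
    lowL (g * leviEmb t) = lowL g * t.1 := by
  unfold lowL
  rw [mat_mul, ← Matrix.fromBlocks_toBlocks (mat g), mat_leviEmb, Matrix.fromBlocks_multiply]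
  simp

theorem lowR_mul_leviEmb (g : GSp4 k) (t : GL (Fin 2) k) :
    lowR (g * leviEmb t) = lowR g * (t.1.det • (t⁻¹).1ᵀ) := by
  unfold lowR
  rw [mat_mul, ← Matrix.fromBlocks_toBlocks (mat g), mat_leviEmb, Matrix.fromBlocks_multiply]
  simp

theorem lowL_weyl : lowL (weyl k) = 1 := by simp [lowL, mat_weyl]

theorem lowR_weyl : lowR (weyl k) = 0 := by simp [lowR, mat_weyl]

@[simp] theorem lowL_cell (h : GL (Fin 2) k) (n : symmMat k) : lowL (cell h n) = h.1 := by
  rw [cell, lowL_mul_unip, lowL_mul_leviEmb, lowL_weyl, Matrix.one_mul]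

@[simp] theorem lowR_cell (h : GL (Fin 2) k) (n : symmMat k) : lowR (cell h n) = h.1 * n.1 := by
  rw [cell, lowR_mul_unip, lowL_mul_leviEmb, lowR_mul_leviEmb, lowL_weyl, lowR_weyl]
  simp

theorem cell_mul_unip (h : GL (Fin 2) k) (m n : symmMat k) :
    cell h m * unip n = cell h (m + n) := by
  rw [cell, cell, unip_add, mul_assoc]

/-- The plane spanned by the last two rows is isotropic: this is the lower right block of `g J ᵗg =
c J`. -/
theorem lowL_mul_lowR_transpose (g : GSp4 k) : lowL g * (lowR g)ᵀ = lowR g * (lowL g)ᵀ := by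
  obtain ⟨c, hc, h⟩ := exists_mul_J_mul_transpose g
  have h1 := congrArg Matrix.toBlocks₂₂ h
  rw [← Matrix.fromBlocks_toBlocks (mat g)] at h1
  simp only [Matrix.J, Matrix.fromBlocks_transpose, Matrix.fromBlocks_multiply,
    Matrix.fromBlocks_smul, Matrix.toBlocks_fromBlocks₂₂] at h1
  simp only [Matrix.mul_zero, Matrix.mul_one, Matrix.mul_neg, zero_add, add_zero, smul_zero,
    Matrix.neg_mul] at h1
  exact (sub_eq_zero.1 ((sub_eq_neg_add _ _).trans ((add_comm _ _).trans h1))).symm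

/-- Independence of the last two rows of the invertible matrix `g`. -/
theorem vecMul_lowL_ne_zero (g : GSp4 k) {u : Fin 2 → k} (hL : Matrix.vecMul u (lowL g) = 0)
    (hR : Matrix.vecMul u (lowR g) = 0) : u = 0 := by
  have h : Matrix.vecMul (Sum.elim 0 u) (mat g) = 0 := by
    ext (j | j)
    · simpa [Matrix.vecMul, dotProduct, Fintype.sum_sum_type, mat_apply_inr_inl] using congrFun hL j
    · simpa [Matrix.vecMul, dotProduct, Fintype.sum_sum_type, mat_apply_inr_inr] using congrFun hR j
  have h2 := congrArg (fun v => Matrix.vecMul v (mat g⁻¹)) h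
  simp only [Matrix.vecMul_vecMul, mat_mul_inv, Matrix.vecMul_one, Matrix.zero_vecMul] at h2
  ext i
  simpa using congrFun h2 (Sum.inr i)

/-- The symmetric matrix `n` with `g ∈ P w N`-component `n`. -/
theorem exists_lowR_eq {g : GSp4 k} (hg : (lowL g).det ≠ 0) :
    ∃ n : symmMat k, n.1 = (lowL g)⁻¹ * lowR g ∧ lowR g = lowL g * n.1 := by
  have hu : IsUnit (lowL g).det := isUnit_iff_ne_zero.2 hg
  refine ⟨⟨(lowL g)⁻¹ * lowR g, ?_⟩, rfl, ?_⟩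
  · change ((lowL g)⁻¹ * lowR g)ᵀ = _
    have hu' : IsUnit (lowL g)ᵀ.det := by rwa [Matrix.det_transpose]
    rw [Matrix.transpose_mul, Matrix.transpose_nonsing_inv]
    calc _ = (lowL g)⁻¹ * (lowL g * (lowR g)ᵀ) * (lowL g)ᵀ⁻¹ := by
          rw [Matrix.nonsing_inv_mul_cancel_left _ _ hu]
      _ = _ := by
          rw [lowL_mul_lowR_transpose, ← Matrix.mul_assoc, Matrix.mul_nonsing_inv_cancel_right _ _ hu']
  · rw [Matrix.mul_nonsing_inv_cancel_left _ _ hu]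

theorem mul_inv_mem_siegel_of_low {g g' : GSp4 k} {X : Matrix (Fin 2) (Fin 2) k}
    (hL : lowL g' = X * lowL g) (hR : lowR g' = X * lowR g) : g' * g⁻¹ ∈ siegelParabolic k := by
  refine mul_inv_mem_siegelParabolic (X := X) fun i => ?_
  ext (j | j)
  · simpa [Matrix.mul_apply, mat_apply_inr_inl] using congrFun (congrFun hL i) j
  · simpa [Matrix.mul_apply, mat_apply_inr_inr] using congrFun (congrFun hR i) j

theorem mul_inv_mem_klingen_of_low {g g' : GSp4 k} {a : k}
    (hL : lowL g' 0 = a • lowL g 0) (hR : lowR g' 0 = a • lowR g 0) :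
    g' * g⁻¹ ∈ klingenParabolic k := by
  refine mul_inv_mem_klingenParabolic (a := a) ?_
  ext (j | j)
  · exact congrFun hL j
  · exact congrFun hR j

/-- A lower triangular change of basis keeps the line of the third row as well as the plane. -/
theorem mul_inv_mem_borel_of_low {g g' : GSp4 k} {X : Matrix (Fin 2) (Fin 2) k} (hX : X 0 1 = 0)
    (hL : lowL g' = X * lowL g) (hR : lowR g' = X * lowR g) : g' * g⁻¹ ∈ borel k := by
  refine ⟨mul_inv_mem_siegel_of_low hL hR, mul_inv_mem_klingen_of_low (a := X 0 0) ?_ ?_⟩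
  · ext j
    simp [hL, Matrix.mul_apply, hX]
  · ext j
    simp [hR, Matrix.mul_apply, hX]

theorem low_mul_of_mem_siegel {y : GSp4 k} (hy : y ∈ siegelParabolic k) (g : GSp4 k) :
    lowL (y * g) = lowR y * lowL g ∧ lowR (y * g) = lowR y * lowR g := by
  have h0 : lowL y = 0 := by
    ext i j
    exact mem_siegelParabolic_iff.1 hy i j
  have h1 : (mat y).toBlocks₂₁ = 0 := h0
  unfold lowL lowR
  rw [mat_mul, ← Matrix.fromBlocks_toBlocks (mat y), ← Matrix.fromBlocks_toBlocks (mat g), h1,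
    Matrix.fromBlocks_multiply]
  simp

theorem lowR_apply_of_mem_klingen {y : GSp4 k} (hy : y ∈ klingenParabolic k) : lowR y 0 1 = 0 :=
  (mem_klingenParabolic_iff.1 hy).2.2

theorem det_lowR_ne_zero {y : GSp4 k} (hy : y ∈ siegelParabolic k) : (lowR y).det ≠ 0 := by
  intro h
  have h1 := (low_mul_of_mem_siegel hy y⁻¹).2
  rw [mul_inv_cancel] at h1
  have h2 := congrArg Matrix.det h1
  have h3 : lowR (1 : GSp4 k) = 1 := by
    ext i j
    simp [lowR, Matrix.toBlocks₂₂, Matrix.one_apply]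
  rw [h3, Matrix.det_mul, h, zero_mul, Matrix.det_one] at h2
  exact one_ne_zero h2

variable [TopologicalSpace k]

theorem smoothFunctions_apply_eq {G : Type*} [Group G] [TopologicalSpace G] {H : Subgroup G}
    {f : G → ℂ} (hf : f ∈ smoothFunctions H) {g g' : G} (h : g' * g⁻¹ ∈ H) : f g' = f g := by
  have := hf.2 _ h g
  rwa [inv_mul_cancel_right] at this

@[fun_prop] theorem continuous_mat : Continuous (mat : GSp4 k → _) :=
  Units.continuous_val.comp continuous_subtype_val

@[fun_prop] theorem continuous_lowL : Continuous (lowL : GSp4 k → _) := by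
  refine continuous_matrix fun i j => ?_
  exact continuous_mat.matrix_elem _ _

@[fun_prop] theorem continuous_lowR : Continuous (lowR : GSp4 k → _) := by
  refine continuous_matrix fun i j => ?_
  exact continuous_mat.matrix_elem _ _

theorem continuous_GSp4_of {X : Type*} [TopologicalSpace X] {f : X → GSp4 k}
    (h : Continuous fun x => mat (f x)) (h' : Continuous fun x => mat (f x)⁻¹) : Continuous f :=
  (Units.continuous_iff.2 ⟨h, h'⟩).subtype_mk _

variable [IsTopologicalRing k]

@[fun_prop] theorem continuous_unip : Continuous (unip : symmMat k → GSp4 k) := by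
  refine continuous_GSp4_of ?_ ?_
  · exact Continuous.matrix_fromBlocks continuous_const continuous_subtype_val continuous_const
      continuous_const
  · exact Continuous.matrix_fromBlocks continuous_const continuous_subtype_val.neg continuous_const
      continuous_const

@[fun_prop] theorem continuous_leviEmb : Continuous (leviEmb : GL (Fin 2) k → GSp4 k) := by
  have h : Continuous fun t : GL (Fin 2) k => mat (leviEmb t) := by
    refine Continuous.matrix_fromBlocks Units.continuous_val continuous_const continuous_const ?_
    exact (Continuous.matrix_det Units.continuous_val).smul
      (Units.continuous_val.comp continuous_inv).matrix_transpose
  refine continuous_GSp4_of h ?_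
  simp_rw [← map_inv]
  exact h.comp continuous_inv

theorem continuous_cell : Continuous fun p : GL (Fin 2) k × symmMat k => cell p.1 p.2 := by
  unfold cell
  fun_prop

end Cell

/-! ### Balls, lattices and additive characters over the local field -/

section LocalField

/-- There are no small subgroups in `ℂ^*`: for a power `w` within `1 / 2` of `1`, squaring
multiplies the distance to `1` by `‖w + 1‖ ≥ 3 / 2`, so the powers `z ^ 2 ^ n` would escape if `z ≠
1`. -/
theorem eq_one_of_forall_norm_pow_sub_one_le {z : ℂ} (h : ∀ n : ℕ, ‖z ^ n - 1‖ ≤ 1 / 2) :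
    z = 1 := by
  by_contra hz
  have hpos : 0 < ‖z - 1‖ := norm_pos_iff.2 (sub_ne_zero.2 hz)
  have key : ∀ n : ℕ, (3 / 2 : ℝ) ^ n * ‖z - 1‖ ≤ ‖z ^ (2 ^ n) - 1‖ := by
    intro n
    induction n with
    | zero => simp
    | succ n ih =>
      set w := z ^ (2 ^ n) with hw
      have h1 : z ^ (2 ^ (n + 1)) - 1 = (w + 1) * (w - 1) := by rw [pow_succ, pow_mul]; ring
      have h2 : (3 / 2 : ℝ) ≤ ‖w + 1‖ := by
        have h3 : ‖(2 : ℂ)‖ ≤ ‖w + 1‖ + ‖w - 1‖ := by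
          calc ‖(2 : ℂ)‖ = ‖(w + 1) - (w - 1)‖ := by ring_nf
            _ ≤ _ := norm_sub_le _ _
        have h4 := h (2 ^ n)
        simp at h3
        linarith
      rw [h1, norm_mul, pow_succ]
      calc (3 / 2 : ℝ) ^ n * (3 / 2) * ‖z - 1‖ = 3 / 2 * ((3 / 2) ^ n * ‖z - 1‖) := by ring
        _ ≤ _ := mul_le_mul h2 ih (by positivity) (by positivity)
  obtain ⟨n, hn⟩ := pow_unbounded_of_one_lt (1 / ‖z - 1‖) (by norm_num : (1 : ℝ) < 3 / 2)
  have h1 := key n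
  have h2 := h (2 ^ n)
  rw [div_lt_iff₀ hpos] at hn
  linarith

open ValuativeRel

variable {k : Type*} [Field k] [ValuativeRel k] [TopologicalSpace k] [IsNonarchimedeanLocalField k]

instance t2Space_localField : T2Space k := by
  have : IsClosed ({0} : Set k) := by
    rw [← isOpen_compl_iff, isOpen_iff_mem_nhds]
    intro x hx
    filter_upwards [Valuation.locally_const (v := valuation k) (x := x)
      ((Valuation.ne_zero_iff _).2 hx)] with y hy
    rintro rfl
    rw [map_zero] at hy
    exact hx ((Valuation.zero_iff _).1 hy.symm)
  have : T1Space k := IsTopologicalAddGroup.t1Space k this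
  infer_instance

variable (k) in
/-- The ball of radius `γ` around `0`. -/
def ball (γ : (ValueGroupWithZero k)ˣ) : AddSubgroup k where
  carrier := {x | valuation k x ≤ γ}
  zero_mem' := by simp
  add_mem' := fun {a b} ha hb => by
    change valuation k (a + b) ≤ γ
    exact (Valuation.map_add _ _ _).trans (max_le ha hb)
  neg_mem' := fun ha => by simpa using ha

theorem mem_ball {γ : (ValueGroupWithZero k)ˣ} {x : k} : x ∈ ball k γ ↔ valuation k x ≤ γ := Iff.rfl

theorem isOpen_ball (γ : (ValueGroupWithZero k)ˣ) : IsOpen (ball k γ : Set k) := by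
  refine AddSubgroup.isOpen_of_mem_nhds _ (g := 0) ?_
  rw [IsValuativeTopology.mem_nhds_zero_iff]
  exact ⟨γ, fun x hx => mem_ball.2 (le_of_lt hx)⟩

theorem isCompact_ball (γ : (ValueGroupWithZero k)ˣ) : IsCompact (ball k γ : Set k) :=
  IsNonarchimedeanLocalField.isCompact_closedBall k γ

theorem ball_mono {γ δ : (ValueGroupWithZero k)ˣ} (h : γ ≤ δ) : ball k γ ≤ ball k δ :=
  fun _ hx => le_trans (mem_ball.1 hx) h

theorem exists_valuation_lt_one : ∃ ϖ : k, ϖ ≠ 0 ∧ valuation k ϖ < 1 := by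
  obtain ⟨r, hr, hr1⟩ := Valuation.IsNontrivial.exists_lt_one (v := valuation k)
  exact ⟨r, by simpa using hr, hr1⟩

theorem exists_ball_subset {U : Set k} (hU : U ∈ nhds 0) : ∃ γ, (ball k γ : Set k) ⊆ U := by
  obtain ⟨γ, hγ⟩ := (IsValuativeTopology.mem_nhds_zero_iff U).1 hU
  obtain ⟨ϖ, hϖ, hϖ1⟩ := exists_valuation_lt_one (k := k)
  -- The basic neighbourhoods of `0` are given by strict inequalities; the factor `valuation k ϖ <
  -- 1` turns `≤` into `<`.
  refine ⟨γ * Units.mk0 _ ((Valuation.ne_zero_iff (valuation k)).2 hϖ), fun x hx => hγ ?_⟩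
  have h := mem_ball.1 hx
  refine lt_of_le_of_lt h ?_
  rw [Units.val_mul, Units.val_mk0]
  exact mul_lt_of_lt_one_right (zero_lt_iff.2 γ.ne_zero) hϖ1

theorem mem_ball_of_valuation {x : k} (hx : x ≠ 0) :
    x ∈ ball k (Units.mk0 _ ((Valuation.ne_zero_iff (valuation k)).2 hx)) := mem_ball.2 le_rfl

theorem exists_forall_mem_ball {C : Set k} (hC : IsCompact C) : ∃ γ, C ⊆ ball k γ := by
  obtain ⟨γ, hγ⟩ := hC.elim_directed_cover (fun γ => (ball k γ : Set k)) (fun γ => isOpen_ball γ)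
    (fun x _ => Set.mem_iUnion.2 (by
      by_cases hx : x = 0
      · exact ⟨1, by simp [hx]⟩
      · exact ⟨_, mem_ball_of_valuation hx⟩))
    (fun γ δ => ⟨max γ δ, ball_mono (le_max_left _ _), ball_mono (le_max_right _ _)⟩)
  exact ⟨γ, hγ⟩

instance nonarchimedeanAddGroup_localField : NonarchimedeanAddGroup k where
  is_nonarchimedean U hU := by
    obtain ⟨γ, hγ⟩ := exists_ball_subset hU
    exact ⟨⟨ball k γ, isOpen_ball γ⟩, hγ⟩

/-- Balls are additive subgroups, so a small one is mapped to a subgroup of `ℂ^*` close to `1`,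
which is trivial. -/
theorem exists_ball_forall_eq_one (ψ : AddChar k ℂ) (hψ : Continuous ψ) :
    ∃ γ, ∀ x ∈ ball k γ, ψ x = 1 := by
  have hU : {x : k | ‖ψ x - 1‖ < 1 / 2} ∈ nhds (0 : k) := by
    refine IsOpen.mem_nhds (isOpen_lt ?_ continuous_const) (by simp)
    exact (hψ.sub continuous_const).norm
  obtain ⟨γ, hγ⟩ := exists_ball_subset hU
  refine ⟨γ, fun x hx => eq_one_of_forall_norm_pow_sub_one_le fun n => ?_⟩
  rw [← AddChar.map_nsmul_eq_pow]
  exact (hγ ((ball k γ).nsmul_mem hx n)).le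

instance nhdsNE_neBot_localField : (nhdsWithin (0 : k) {0}ᶜ).NeBot := by
  refine mem_closure_iff_nhdsWithin_neBot.1 (mem_closure_iff_nhds.2 fun U hU => ?_)
  obtain ⟨γ, hγ⟩ := exists_ball_subset hU
  obtain ⟨x, hx⟩ := ValuativeRel.valuation_surjective (γ : ValueGroupWithZero k)
  refine ⟨x, hγ hx.le, ?_⟩
  rintro rfl
  rw [map_zero] at hx
  exact γ.ne_zero hx.symm

/-! ### Lattices of symmetric matrices -/

theorem isClosed_symmMat : IsClosed (symmMat k : Set (Matrix (Fin 2) (Fin 2) k)) :=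
  isClosed_eq continuous_id.matrix_transpose continuous_id

theorem isClosedEmbedding_symmMat :
    Topology.IsClosedEmbedding (Subtype.val : symmMat k → Matrix (Fin 2) (Fin 2) k) :=
  isClosed_symmMat.isClosedEmbedding_subtypeVal

instance locallyCompactSpace_symmMat : LocallyCompactSpace (symmMat k) := by
  have : LocallyCompactSpace (Matrix (Fin 2) (Fin 2) k) :=
    inferInstanceAs (LocallyCompactSpace (Fin 2 → Fin 2 → k))
  exact isClosedEmbedding_symmMat.locallyCompactSpace

variable (k) in
/-- Symmetric matrices with entries in the ball of radius `γ`. -/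
def lattice (γ : (ValueGroupWithZero k)ˣ) : AddSubgroup (symmMat k) where
  carrier := {n | ∀ i j, n.1 i j ∈ ball k γ}
  zero_mem' := fun _ _ => (ball k γ).zero_mem
  add_mem' := fun ha hb i j => (ball k γ).add_mem (ha i j) (hb i j)
  neg_mem' := fun ha i j => (ball k γ).neg_mem (ha i j)

theorem mem_lattice {γ : (ValueGroupWithZero k)ˣ} {n : symmMat k} :
    n ∈ lattice k γ ↔ ∀ i j, n.1 i j ∈ ball k γ := Iff.rfl

theorem lattice_mono {γ δ : (ValueGroupWithZero k)ˣ} (h : γ ≤ δ) : lattice k γ ≤ lattice k δ :=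
  fun _ hn i j => ball_mono h (hn i j)

theorem continuous_symmMat_apply (i j : Fin 2) : Continuous fun n : symmMat k => n.1 i j :=
  continuous_subtype_val.matrix_elem i j

theorem isOpen_lattice (γ : (ValueGroupWithZero k)ˣ) : IsOpen (lattice k γ : Set (symmMat k)) := by
  have : (lattice k γ : Set (symmMat k)) = ⋂ i, ⋂ j, (fun n : symmMat k => n.1 i j) ⁻¹' (ball k γ) := by
    ext n; simp [mem_lattice]
  rw [this]
  exact isOpen_iInter_of_finite fun i => isOpen_iInter_of_finite fun j =>
    (isOpen_ball γ).preimage (continuous_symmMat_apply i j)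

theorem isCompact_lattice (γ : (ValueGroupWithZero k)ˣ) :
    IsCompact (lattice k γ : Set (symmMat k)) := by
  have h : IsCompact (Set.univ.pi fun _ : Fin 2 => Set.univ.pi fun _ : Fin 2 => (ball k γ : Set k)) :=
    isCompact_univ_pi fun _ => isCompact_univ_pi fun _ => isCompact_ball γ
  have h2 := isClosedEmbedding_symmMat.isCompact_preimage (K := Set.univ.pi fun _ : Fin 2 => Set.univ.pi fun _ : Fin 2 => (ball k γ : Set k)) h
  convert h2 using 1
  ext n
  exact ⟨fun h i _ j _ => h i j, fun h i j => h i trivial j trivial⟩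

theorem exists_subset_lattice {C : Set (symmMat k)} (hC : IsCompact C) :
    ∃ γ, C ⊆ lattice k γ := by
  have h := fun i j => exists_forall_mem_ball (hC.image (continuous_symmMat_apply i j))
  choose γ hγ using h
  refine ⟨Finset.univ.sup' ⟨(0, 0), by simp⟩ fun p : Fin 2 × Fin 2 => γ p.1 p.2, fun n hn i j =>
    ball_mono (Finset.le_sup' (fun p : Fin 2 × Fin 2 => γ p.1 p.2) (Finset.mem_univ (i, j))) (hγ i j ⟨n, hn, rfl⟩)⟩

theorem exists_mem_lattice (n : symmMat k) : ∃ γ, n ∈ lattice k γ := by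
  obtain ⟨γ, hγ⟩ := exists_subset_lattice (isCompact_singleton (x := n))
  exact ⟨γ, hγ rfl⟩

theorem exists_lattice_subset {U : Set (symmMat k)} (hU : U ∈ nhds 0) :
    ∃ γ, (lattice k γ : Set (symmMat k)) ⊆ U := by
  obtain ⟨V, hV, hVU⟩ := (isClosedEmbedding_symmMat.isInducing.nhds_eq_comap (0 : symmMat k) ▸ hU :
    U ∈ Filter.comap _ _)
  obtain ⟨V, rfl⟩ : ∃ V' : Set (Fin 2 → Fin 2 → k), V' = V := ⟨V, rfl⟩
  have hV' : V ∈ nhds (0 : Fin 2 → Fin 2 → k) := hV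
  rw [nhds_pi, Filter.mem_pi'] at hV'
  obtain ⟨I, t, ht, htV⟩ := hV'
  have h : ∀ i, ∃ γ, ∀ r : Fin 2 → k, (∀ j, r j ∈ ball k γ) → r ∈ t i := by
    intro i
    have := ht i
    rw [nhds_pi, Filter.mem_pi'] at this
    obtain ⟨I', t', ht', htV'⟩ := this
    choose γ hγ using fun j => exists_ball_subset (ht' j)
    exact ⟨min (γ 0) (γ 1), fun r hr => htV' fun j _ => hγ j (ball_mono (by
      fin_cases j
      · exact min_le_left _ _
      · exact min_le_right _ _) (hr j))⟩
  choose γ hγ using h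
  refine ⟨min (γ 0) (γ 1), fun n hn => hVU (htV fun i _ => hγ i _ fun j => ?_)⟩
  refine ball_mono ?_ (hn i j)
  fin_cases i
  · exact min_le_left _ _
  · exact min_le_right _ _

end LocalField

/-! ### Integrals over compact open subgroups as finite sums -/

section Average

open MeasureTheory

variable {A : Type*} [AddCommGroup A] [TopologicalSpace A] [IsTopologicalAddGroup A]
  [MeasurableSpace A] [BorelSpace A]

/-- The average over a compact open subgroup `H` of functions invariant under an open subgroup is
a finite average. -/
theorem exists_finset_setIntegral_eq (μ : Measure A) [μ.IsAddLeftInvariant]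
    [IsFiniteMeasureOnCompacts μ] {H H' : AddSubgroup A}
    (hHc : IsCompact (H : Set A)) (hH' : IsOpen (H' : Set A))
    (hle : H' ≤ H) :
    ∃ S : Finset A, S.Nonempty ∧ (∀ a ∈ S, a ∈ H) ∧ ∀ F : A → ℂ,
      (∀ a, ∀ h ∈ H', F (a + h) = F a) →
        S.card * ∫ x in (H : Set A), F x ∂μ = μ.real (H : Set A) * ∑ a ∈ S, F a := by
  classical
  have : CompactSpace H := isCompact_iff_compactSpace.1 hHc
  let H₁ : AddSubgroup H := H'.addSubgroupOf H
  have hH₁ : IsOpen (H₁ : Set H) := hH'.preimage continuous_subtype_val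
  have hfin : Finite (H ⧸ H₁) := AddSubgroup.quotient_finite_of_isOpen H₁ hH₁
  have : Fintype (H ⧸ H₁) := Fintype.ofFinite _
  let r : H ⧸ H₁ → A := fun q => (q.out : A)
  have hr : Function.Injective r := fun q q' h => by
    have : q.out = q'.out := Subtype.ext h
    rw [← Quotient.out_eq q, ← Quotient.out_eq q', this]
  have hcov : (H : Set A) = ⋃ q, (fun x => -r q + x) ⁻¹' (H' : Set A) := by
    ext a
    simp only [Set.mem_iUnion, Set.mem_preimage, SetLike.mem_coe]
    constructor
    · intro ha
      refine ⟨QuotientAddGroup.mk (⟨a, ha⟩ : H), ?_⟩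
      have h := QuotientAddGroup.eq.1 (QuotientAddGroup.out_eq' (QuotientAddGroup.mk (⟨a, ha⟩ : H) : H ⧸ H₁))
      exact h
    · rintro ⟨q, hq⟩
      have := H.add_mem (q.out).2 (hle hq)
      simpa [r] using this
  have hdisj : Pairwise (Function.onFun Disjoint fun q => (fun x => -r q + x) ⁻¹' (H' : Set A)) := by
    intro q q' hqq'
    refine Set.disjoint_left.2 fun a ha ha' => hqq' ?_
    have h1 : -r q + r q' ∈ H' := by
      have := H'.sub_mem ha ha'
      simpa using this
    rw [← QuotientAddGroup.out_eq' q, ← QuotientAddGroup.out_eq' q']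
    exact QuotientAddGroup.eq.2 h1
  have hmeas : ∀ q, MeasurableSet ((fun x => -r q + x) ⁻¹' (H' : Set A)) := fun q =>
    (hH'.preimage (by fun_prop)).measurableSet
  have hH'fin : μ (H' : Set A) < ⊤ := (measure_mono hle).trans_lt hHc.measure_lt_top
  have key : ∀ F : A → ℂ, (∀ a, ∀ h ∈ H', F (a + h) = F a) →
      ∫ x in (H : Set A), F x ∂μ = μ.real (H' : Set A) * ∑ q, F (r q) := by
    intro F hF
    have hc : ∀ q, Set.EqOn F (fun _ => F (r q)) ((fun x => -r q + x) ⁻¹' (H' : Set A)) := by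
      intro q x hx
      have := hF (r q) _ hx
      simpa using this
    have hmu : ∀ q, μ ((fun x => -r q + x) ⁻¹' (H' : Set A)) = μ (H' : Set A) := fun q =>
      measure_preimage_add μ _ _
    rw [hcov, integral_iUnion_fintype hmeas hdisj]
    · rw [Finset.mul_sum]
      refine Finset.sum_congr rfl fun q _ => ?_
      rw [setIntegral_congr_fun (hmeas q) (hc q), setIntegral_const, Measure.real, hmu,
        Complex.real_smul, Measure.real]
    · intro q
      refine (integrableOn_congr_fun (hc q) (hmeas q)).2 ?_
      exact integrableOn_const (by rw [hmu]; exact hH'fin.ne)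
  refine ⟨Finset.univ.image r, ⟨r (QuotientAddGroup.mk 0), by simp⟩, ?_, fun F hF => ?_⟩
  · intro a ha
    obtain ⟨q, -, rfl⟩ := Finset.mem_image.1 ha
    exact (q.out).2
  · rw [Finset.card_image_of_injective _ hr, Finset.sum_image (fun _ _ _ _ h => hr h), key F hF]
    -- The constant function compares the volumes of `H` and `H'`.
    have h1 := key (fun _ => 1) (fun _ _ _ => rfl)
    simp only [Finset.sum_const, Finset.card_univ, nsmul_eq_mul, mul_one, setIntegral_const,
      Complex.real_smul] at h1
    rw [h1, Finset.card_univ]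
    ring

end Average

/-! ### Compactness of the flag variety and uniform smoothness -/

section Iwasawa
open ValuativeRel
open scoped Pointwise

/-- Local constancy becomes uniform: coset representatives may be taken in the compact set `C`,
where the tube lemma supplies one neighbourhood of `1` for all of them. -/
theorem eventually_forall_apply_mul_eq {G : Type*} [Group G] [TopologicalSpace G]
    [IsTopologicalGroup G] {H : Subgroup G} {C : Set G} (hC : IsCompact C)
    (hHC : ∀ g : G, ∃ h ∈ H, ∃ c ∈ C, g = h * c) {f : G → ℂ} (hf : f ∈ smoothFunctions H) :
    ∀ᶠ x in nhds (1 : G), ∀ g, f (g * x) = f g := by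
  have hopen : IsOpen {p : G × G | f (p.1 * p.2) = f p.1} := by
    have h1 : IsLocallyConstant fun p : G × G => f (p.1 * p.2) - f p.1 :=
      (hf.1.comp_continuous continuous_mul).sub (hf.1.comp_continuous continuous_fst)
    convert h1.isOpen_fiber 0 using 1
    ext p
    simp [sub_eq_zero]
  have hsub : C ×ˢ ({1} : Set G) ⊆ {p : G × G | f (p.1 * p.2) = f p.1} := by
    rintro ⟨c, x⟩ ⟨_, rfl⟩
    simp
  obtain ⟨U, V, hU, hV, hCU, h1V, hUV⟩ := generalized_tube_lemma hC isCompact_singleton hopen hsub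
  filter_upwards [hV.mem_nhds (h1V rfl)] with x hx g
  obtain ⟨h, hh, c, hc, rfl⟩ := hHC g
  rw [mul_assoc, hf.2 h hh, hf.2 h hh]
  exact hUV (Set.mk_mem_prod (hCU hc) hx)

variable {k : Type*} [Field k]

/-- The transposition matrix in `GL₂`. -/
def swapGL (k : Type*) [Field k] : GL (Fin 2) k :=
  ⟨!![0, 1; 1, 0], !![0, 1; 1, 0], by simp [Matrix.one_fin_two], by simp [Matrix.one_fin_two]⟩

/-- Lower unipotent matrices in `GL₂`. -/
def lowerGL (x : k) : GL (Fin 2) k :=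
  ⟨!![1, 0; x, 1], !![1, 0; -x, 1], by simp [Matrix.one_fin_two], by simp [Matrix.one_fin_two]⟩

/-- The matrix of `middleEmb`. -/
def middleMat (g : Matrix (Fin 2) (Fin 2) k) : Matrix (Fin 2 ⊕ Fin 2) (Fin 2 ⊕ Fin 2) k :=
  Matrix.fromBlocks !![1, 0; 0, g 0 0] !![0, 0; 0, g 0 1] !![0, 0; 0, g 1 0]
    !![g.det, 0; 0, g 1 1]

theorem middleMat_mul (g h : Matrix (Fin 2) (Fin 2) k) :
    middleMat (g * h) = middleMat g * middleMat h := by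
  simp only [middleMat, Matrix.fromBlocks_multiply, Matrix.det_mul]
  congr 1 <;> ext i j <;> fin_cases i <;> fin_cases j <;> simp [Matrix.mul_apply]

theorem middleMat_one : middleMat (1 : Matrix (Fin 2) (Fin 2) k) = 1 := by
  have h0 : (!![0, 0; 0, 0] : Matrix (Fin 2) (Fin 2) k) = 0 := by
    ext i j; fin_cases i <;> fin_cases j <;> rfl
  simp [middleMat, ← Matrix.one_fin_two, h0]

/-- The embedding of `GL₂` acting on the span of `e₂` and `e₄`. -/
def middleEmb : GL (Fin 2) k →* GSp4 k where
  toFun g := ⟨⟨middleMat g.1, middleMat (g⁻¹).1,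
      by rw [← middleMat_mul, ← Units.val_mul, mul_inv_cancel, Units.val_one, middleMat_one],
      by rw [← middleMat_mul, ← Units.val_mul, inv_mul_cancel, Units.val_one, middleMat_one]⟩,
    ⟨Matrix.GeneralLinearGroup.det g, by
      simp only [middleMat, Matrix.J, Matrix.fromBlocks_transpose, Matrix.fromBlocks_multiply,
        Matrix.fromBlocks_smul, Matrix.GeneralLinearGroup.val_det_apply, Matrix.det_fin_two]
      congr 1 <;> ext i j <;> fin_cases i <;> fin_cases j <;> simp [Matrix.mul_apply] <;> ring⟩⟩
  map_one' := mat_injective middleMat_one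
  map_mul' g h := mat_injective (middleMat_mul g.1 h.1)

theorem mat_middleEmb (g : GL (Fin 2) k) : mat (middleEmb g) = middleMat g.1 := rfl

theorem low_mul_middleEmb (g : GSp4 k) (t : GL (Fin 2) k) (i : Fin 2) :
    lowL (g * middleEmb t) i 0 = lowL g i 0 ∧
    lowL (g * middleEmb t) i 1 = lowL g i 1 * t.1 0 0 + lowR g i 1 * t.1 1 0 ∧
    lowR (g * middleEmb t) i 0 = lowR g i 0 * t.1.det ∧
    lowR (g * middleEmb t) i 1 = lowL g i 1 * t.1 0 1 + lowR g i 1 * t.1 1 1 := by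
  unfold lowL lowR
  rw [mat_mul, ← Matrix.fromBlocks_toBlocks (mat g), mat_middleEmb, middleMat,
    Matrix.fromBlocks_multiply]
  refine ⟨?_, ?_, ?_, ?_⟩ <;> simp [Matrix.mul_apply]

theorem low_middleEmb_mul (g : GSp4 k) (t : GL (Fin 2) k) :
    lowL (middleEmb t * g) 0 = t.1.det • lowL g 0 ∧
    lowR (middleEmb t * g) 0 = t.1.det • lowR g 0 ∧
    lowL (middleEmb t * g) 1 = t.1 1 0 • (mat g).toBlocks₁₁ 1 + t.1 1 1 • lowL g 1 := by
  unfold lowL lowR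
  rw [mat_mul, ← Matrix.fromBlocks_toBlocks (mat g), mat_middleEmb, middleMat,
    Matrix.fromBlocks_multiply]
  refine ⟨?_, ?_, ?_⟩ <;> ext j <;> simp [Matrix.vecMul, dotProduct]

theorem middleEmb_mem_klingenParabolic (t : GL (Fin 2) k) : middleEmb t ∈ klingenParabolic k := by
  rw [mem_klingenParabolic_iff, mat_middleEmb]
  simp [middleMat]

theorem mem_borel_iff {y : GSp4 k} : y ∈ borel k ↔ lowL y = 0 ∧ lowR y 0 1 = 0 := by
  constructor
  · rintro ⟨h1, h2⟩
    refine ⟨?_, lowR_apply_of_mem_klingen h2⟩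
    ext i j
    exact mem_siegelParabolic_iff.1 h1 i j
  · rintro ⟨h1, h2⟩
    refine ⟨mem_siegelParabolic_iff.2 fun i j => congrFun (congrFun h1 i) j,
      mem_klingenParabolic_iff.2 ⟨congrFun (congrFun h1 0) 0, congrFun (congrFun h1 0) 1, h2⟩⟩

variable [ValuativeRel k] [TopologicalSpace k] [IsNonarchimedeanLocalField k]

theorem continuous_lowerGL : Continuous (lowerGL : k → GL (Fin 2) k) := by
  refine Units.continuous_iff.2 ⟨?_, ?_⟩
  · refine continuous_matrix fun i j => ?_
    fin_cases i <;> fin_cases j <;> simp [lowerGL] <;> fun_prop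
  · refine continuous_matrix fun i j => ?_
    fin_cases i <;> fin_cases j <;> simp [lowerGL] <;> fun_prop

theorem continuous_middleEmb : Continuous (middleEmb : GL (Fin 2) k → GSp4 k) := by
  have h : Continuous fun t : GL (Fin 2) k => mat (middleEmb t) := by
    simp only [mat_middleEmb, middleMat]
    have h1 : Continuous fun t : GL (Fin 2) k => t.1 := Units.continuous_val
    have h2 := fun i j => h1.matrix_elem i j
    refine Continuous.matrix_fromBlocks ?_ ?_ ?_ ?_ <;> refine continuous_matrix fun i j => ?_ <;>
      fin_cases i <;> fin_cases j <;>
      first | exact continuous_const | exact h2 _ _ | exact h1.matrix_det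
  refine continuous_GSp4_of h ?_
  simp_rw [← map_inv]
  exact h.comp continuous_inv

variable (k) in
/-- A compact set of matrices in `GL₂` transitive on lines. -/
def compactGL : Set (GL (Fin 2) k) :=
  lowerGL '' (ball k 1 : Set k) ∪ (fun x => swapGL k * lowerGL x) '' (ball k 1 : Set k)

theorem isCompact_compactGL : IsCompact (compactGL k) :=
  ((isCompact_ball 1).image continuous_lowerGL).union
    ((isCompact_ball 1).image (continuous_const.mul continuous_lowerGL))

/-- Dividing by the larger of the two entries keeps the parameter in the unit ball. -/
theorem exists_compactGL_row (a b : k) : ∃ t ∈ compactGL k, a * t.1 0 0 + b * t.1 1 0 = 0 := by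
  rcases le_or_gt (valuation k a) (valuation k b) with h | h
  · by_cases hb : b = 0
    · subst hb
      have ha : a = 0 := by simpa using h
      exact ⟨lowerGL 0, Or.inl ⟨0, (ball k 1).zero_mem, rfl⟩, by simp [ha]⟩
    · refine ⟨lowerGL (-(a / b)), Or.inl ⟨_, (ball k 1).neg_mem (mem_ball.2 ?_), rfl⟩, ?_⟩
      · rw [map_div₀]
        exact div_le_one_of_le₀ h zero_le
      · simp [lowerGL]
        field_simp
        ring
  · have ha : a ≠ 0 := by
      rintro rfl
      simp at h
    refine ⟨swapGL k * lowerGL (-(b / a)), Or.inr ⟨_, (ball k 1).neg_mem (mem_ball.2 ?_), rfl⟩, ?_⟩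
    · rw [map_div₀]
      exact div_le_one_of_le₀ h.le zero_le
    · simp [lowerGL, swapGL, Matrix.mul_apply]
      field_simp
      ring

variable (k) in
/-- A compact subset of `GSp₄(k)` mapping onto the flag variety. -/
def compactGSp : Set (GSp4 k) :=
  (middleEmb '' compactGL k) * {leviEmb (swapGL k)} * (middleEmb '' compactGL k) *
    (leviEmb '' compactGL k) * (middleEmb '' compactGL k)

theorem isCompact_compactGSp : IsCompact (compactGSp k) := by
  have h1 : IsCompact ((middleEmb : GL (Fin 2) k → GSp4 k) '' compactGL k) :=
    isCompact_compactGL.image continuous_middleEmb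
  have h2 : IsCompact ((leviEmb : GL (Fin 2) k → GSp4 k) '' compactGL k) :=
    isCompact_compactGL.image continuous_leviEmb
  exact (((h1.mul isCompact_singleton).mul h1).mul h2).mul h1

/-- Column reduction. On the third row, the factors in turn kill entry `1` of `L`, move this zero to
entry `0`, kill entry `1` again, and kill entry `1` of `R`. Isotropy then gives a zero in the fourth
row, and the last factor kills the other entry of `L` there. -/
theorem exists_mul_mem_borel (g : GSp4 k) : ∃ c ∈ compactGSp k, g * c ∈ borel k := by
  obtain ⟨t₁, ht₁, h₁⟩ := exists_compactGL_row (lowL g 0 1) (lowR g 0 1)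
  obtain ⟨g₁, hg₁⟩ : ∃ g₁, g₁ = g * middleEmb t₁ * leviEmb (swapGL k) := ⟨_, rfl⟩
  have e₁ : lowL g₁ 0 0 = 0 := by
    rw [hg₁, lowL_mul_leviEmb]
    simp [Matrix.mul_apply, swapGL, (low_mul_middleEmb g t₁ 0).2.1, h₁]
  obtain ⟨t₂, ht₂, h₂⟩ := exists_compactGL_row (lowL g₁ 0 1) (lowR g₁ 0 1)
  obtain ⟨g₂, hg₂⟩ : ∃ g₂, g₂ = g₁ * middleEmb t₂ := ⟨_, rfl⟩
  have e₂ : lowL g₂ 0 0 = 0 := by rw [hg₂, (low_mul_middleEmb g₁ t₂ 0).1, e₁]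
  have e₂' : lowL g₂ 0 1 = 0 := by rw [hg₂, (low_mul_middleEmb g₁ t₂ 0).2.1, h₂]
  obtain ⟨t₃, ht₃, h₃⟩ := exists_compactGL_row (lowR g₂ 0 1) (-lowR g₂ 0 0)
  obtain ⟨g₃, hg₃⟩ : ∃ g₃, g₃ = g₂ * leviEmb t₃ := ⟨_, rfl⟩
  have e₃ : lowL g₃ 0 0 = 0 := by rw [hg₃, lowL_mul_leviEmb]; simp [Matrix.mul_apply, e₂, e₂']
  have e₃' : lowL g₃ 0 1 = 0 := by rw [hg₃, lowL_mul_leviEmb]; simp [Matrix.mul_apply, e₂, e₂']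
  -- This is the cofactor matrix; it explains the swapped, signed arguments with which `t₃` was
  -- chosen.
  have hadj : t₃.1.det • (t₃⁻¹).1ᵀ = !![t₃.1 1 1, -t₃.1 1 0; -t₃.1 0 1, t₃.1 0 0] := by
    have hd : t₃.1.det ≠ 0 := ((Matrix.isUnit_iff_isUnit_det _).1 t₃.isUnit).ne_zero
    rw [Matrix.coe_units_inv, Matrix.inv_def, Matrix.adjugate_fin_two, Matrix.transpose_smul,
      smul_smul, Ring.inverse_eq_inv', mul_inv_cancel₀ hd, one_smul]
    ext i j
    fin_cases i <;> fin_cases j <;> simp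
  have e₃'' : lowR g₃ 0 1 = 0 := by
    rw [hg₃, lowR_mul_leviEmb, hadj]
    simp [Matrix.mul_apply]
    linear_combination h₃
  have hy : lowR g₃ 0 0 ≠ 0 := by
    intro h0
    have := vecMul_lowL_ne_zero g₃ (u := Pi.single 0 1)
      (by rw [Matrix.single_one_vecMul]; ext j; fin_cases j <;> simp [e₃, e₃'])
      (by rw [Matrix.single_one_vecMul]; ext j; fin_cases j <;> simp [h0, e₃''])
    simpa using congrFun this 0
  have e₃''' : lowL g₃ 1 0 = 0 := by
    have := congrFun (congrFun (lowL_mul_lowR_transpose g₃) 0) 1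
    simp only [Matrix.mul_apply, Fin.sum_univ_two, Matrix.transpose_apply, e₃, e₃', e₃'', zero_mul,
      add_zero] at this
    exact (mul_eq_zero.1 this.symm).resolve_left hy
  obtain ⟨t₄, ht₄, h₄⟩ := exists_compactGL_row (lowL g₃ 1 1) (lowR g₃ 1 1)
  refine ⟨middleEmb t₁ * leviEmb (swapGL k) * middleEmb t₂ * leviEmb t₃ * middleEmb t₄,
    Set.mul_mem_mul (Set.mul_mem_mul (Set.mul_mem_mul (Set.mul_mem_mul ⟨t₁, ht₁, rfl⟩ rfl)
      ⟨t₂, ht₂, rfl⟩) ⟨t₃, ht₃, rfl⟩) ⟨t₄, ht₄, rfl⟩, ?_⟩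
  have hfin : g * (middleEmb t₁ * leviEmb (swapGL k) * middleEmb t₂ * leviEmb t₃ * middleEmb t₄) =
      g₃ * middleEmb t₄ := by
    rw [hg₃, hg₂, hg₁]; simp only [mul_assoc]
  rw [hfin, mem_borel_iff]
  constructor
  · ext i j
    fin_cases i <;> fin_cases j
    · simp [(low_mul_middleEmb g₃ t₄ 0).1, e₃]
    · simp [(low_mul_middleEmb g₃ t₄ 0).2.1, e₃', e₃'']
    · simp [(low_mul_middleEmb g₃ t₄ 1).1, e₃''']
    · simp [(low_mul_middleEmb g₃ t₄ 1).2.1, h₄]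
  · simp [(low_mul_middleEmb g₃ t₄ 0).2.2.2, e₃', e₃'']

variable (k) in
/-- The compactness of the flag variety, in the form of an Iwasawa decomposition. -/
theorem exists_isCompact_borel_mul : ∃ C : Set (GSp4 k), IsCompact C ∧
    ∀ g : GSp4 k, ∃ b ∈ borel k, ∃ c ∈ C, g = b * c := by
  refine ⟨(compactGSp k)⁻¹, isCompact_compactGSp.inv, fun g => ?_⟩
  obtain ⟨c, hc, h⟩ := exists_mul_mem_borel g
  exact ⟨_, h, c⁻¹, Set.inv_mem_inv.2 hc, by simp⟩

theorem smoothFunctions_anti {G : Type*} [Group G] [TopologicalSpace G] {H H' : Subgroup G}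
    (h : H ≤ H') : smoothFunctions H' ≤ smoothFunctions H :=
  fun _ hf => ⟨hf.1, fun x hx => hf.2 x (h hx)⟩

/-- The lattice does not depend on `g` because the flag variety is compact. -/
theorem exists_lattice_forall_apply_mul_unip_eq {f : GSp4 k → ℂ} (hf : f ∈ smoothFunctions (borel k)) :
    ∃ γ, ∀ n ∈ lattice k γ, ∀ g, f (g * unip n) = f g := by
  obtain ⟨C, hC, hBC⟩ := exists_isCompact_borel_mul k
  have h := eventually_forall_apply_mul_eq hC hBC hf
  have h2 : ∀ᶠ n in nhds (0 : symmMat k), ∀ g, f (g * unip n) = f g :=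
    (continuous_unip.tendsto' 0 1 unip_zero).eventually h
  obtain ⟨γ, hγ⟩ := exists_lattice_subset h2
  exact ⟨γ, fun n hn => hγ hn⟩

end Iwasawa

/-! ### Integration against `ψ⁻¹` over lattices -/

section Twist
open ValuativeRel MeasureTheory

variable {k : Type*} [Field k]

/-- The additive character of `symmMat k` given by `unipChar`. -/
def symmChar (ψ₀₀ : AddChar k ℂ) (s : Matrix (Fin 2) (Fin 2) k) : AddChar (symmMat k) ℂ where
  toFun n := ψ₀₀ (s * n.1).trace
  map_zero_eq_one' := by simp
  map_add_eq_mul' m n := by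
    simp [Matrix.mul_add, Matrix.trace_add, AddChar.map_add_eq_mul]

theorem symmChar_apply (ψ₀₀ : AddChar k ℂ) (s : Matrix (Fin 2) (Fin 2) k) (n : symmMat k) :
    symmChar ψ₀₀ s n = ψ₀₀ (s * n.1).trace := rfl

theorem AddChar.neg_mul_self {A : Type*} [AddCommGroup A] (ψ : AddChar A ℂ) (a : A) :
    ψ (-a) * ψ a = 1 := by
  rw [← AddChar.map_add_eq_mul, neg_add_cancel, AddChar.map_zero_eq_one]

variable [TopologicalSpace k]

/-- The span of the functions `π(n) f - ψ(n) f` with `f` smooth on the flag variety. -/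
def twistSpan (ψ : AddChar (symmMat k) ℂ) : Submodule ℂ (GSp4 k → ℂ) :=
  Submodule.span ℂ {w | ∃ n, ∃ f ∈ smoothFunctions (borel k),
    w = (fun g => f (g * unip n)) - ψ n • f}

variable (k) in
/-- Smooth functions on the flag variety supported on the open cell `P w N`. -/
def cellFunctions : Submodule ℂ (GSp4 k → ℂ) where
  carrier := {f | f ∈ smoothFunctions (borel k) ∧ ∀ g, (lowL g).det = 0 → f g = 0}
  zero_mem' := ⟨Submodule.zero_mem _, fun _ _ => rfl⟩
  add_mem' := fun ha hb => ⟨Submodule.add_mem _ ha.1 hb.1, fun g hg => by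
    rw [Pi.add_apply, ha.2 g hg, hb.2 g hg, add_zero]⟩
  smul_mem' := fun c _ ha => ⟨Submodule.smul_mem _ c ha.1, fun g hg => by
    rw [Pi.smul_apply, ha.2 g hg, smul_zero]⟩

instance measurableSpace_symmMat : MeasurableSpace (symmMat k) := _root_.borel _

instance borelSpace_symmMat : BorelSpace (symmMat k) := ⟨rfl⟩

variable [ValuativeRel k] [IsNonarchimedeanLocalField k]

/-- The integral of `ψ⁻¹(n) π(n) f` over a lattice. -/
def twist (ψ : AddChar (symmMat k) ℂ) (γ : (ValueGroupWithZero k)ˣ) (f : GSp4 k → ℂ) (g : GSp4 k) :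
    ℂ :=
  ∫ n in (lattice k γ : Set (symmMat k)), ψ (-n) * f (g * unip n) ∂Measure.addHaar

theorem measurableSet_lattice (γ : (ValueGroupWithZero k)ˣ) :
    MeasurableSet (lattice k γ : Set (symmMat k)) := (isOpen_lattice γ).measurableSet

theorem measureReal_lattice_ne_zero (γ : (ValueGroupWithZero k)ˣ) :
    (Measure.addHaar : Measure (symmMat k)).real (lattice k γ : Set (symmMat k)) ≠ 0 := by
  have h1 := (isOpen_lattice (k := k) γ).measure_pos Measure.addHaar ⟨0, (lattice k γ).zero_mem⟩
  have h2 := (isCompact_lattice (k := k) γ).measure_lt_top (μ := Measure.addHaar)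
  exact (ENNReal.toReal_pos h1.ne' h2.ne).ne'

theorem setIntegral_lattice_add {γ : (ValueGroupWithZero k)ˣ} {m : symmMat k}
    (hm : m ∈ lattice k γ) (F : symmMat k → ℂ) :
    ∫ n in (lattice k γ : Set (symmMat k)), F (m + n) ∂Measure.addHaar =
      ∫ n in (lattice k γ : Set (symmMat k)), F n ∂Measure.addHaar := by
  rw [← integral_indicator (measurableSet_lattice γ), ← integral_indicator (measurableSet_lattice γ),
    ← integral_add_left_eq_self (Set.indicator (lattice k γ : Set (symmMat k)) F) m]
  congr 1
  ext n
  by_cases hn : n ∈ lattice k γ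
  · rw [Set.indicator_of_mem (show n ∈ (lattice k γ : Set (symmMat k)) from hn),
      Set.indicator_of_mem (show m + n ∈ (lattice k γ : Set (symmMat k)) from
        (lattice k γ).add_mem hm hn)]
  · rw [Set.indicator_of_notMem (show n ∉ (lattice k γ : Set (symmMat k)) from hn),
      Set.indicator_of_notMem (show m + n ∉ (lattice k γ : Set (symmMat k)) from fun h =>
        hn (((lattice k γ).add_mem_cancel_left hm).1 h))]

theorem twist_mul_unip (ψ : AddChar (symmMat k) ℂ) {γ : (ValueGroupWithZero k)ˣ} {m : symmMat k}
    (hm : m ∈ lattice k γ) (f : GSp4 k → ℂ) (g : GSp4 k) :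
    twist ψ γ f (g * unip m) = ψ m * twist ψ γ f g := by
  unfold twist
  rw [← integral_const_mul, ← setIntegral_lattice_add hm fun n => ψ m * (ψ (-n) * f (g * unip n))]
  congr 1
  ext n
  rw [mul_assoc g, ← unip_add, neg_add, AddChar.map_add_eq_mul]
  linear_combination -(ψ (-n) * f (g * unip (m + n))) * AddChar.neg_mul_self ψ m

/-- Translating by `m` multiplies the integral by `ψ m`, yet leaves it unchanged because `f` does
not see `m` along the orbit `g N`. -/
theorem twist_eq_zero (ψ : AddChar (symmMat k) ℂ) {γ : (ValueGroupWithZero k)ˣ} {m : symmMat k}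
    (hm : m ∈ lattice k γ) (hψ : ψ m ≠ 1) {f : GSp4 k → ℂ} {g : GSp4 k}
    (h : ∀ n, f (g * unip n * unip m) = f (g * unip n)) : twist ψ γ f g = 0 := by
  have h1 := twist_mul_unip ψ hm f g
  have h2 : twist ψ γ f (g * unip m) = twist ψ γ f g := by
    unfold twist
    congr 1
    ext n
    rw [← h n, mul_assoc, mul_assoc, ← unip_add, ← unip_add, add_comm]
  rw [h2] at h1
  have h3 : (ψ m - 1) * twist ψ γ f g = 0 := by linear_combination -h1
  exact (mul_eq_zero.1 h3).resolve_left (sub_ne_zero.2 hψ)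

theorem exists_lattice_symmChar_eq_one {ψ₀₀ : AddChar k ℂ} (hψ : Continuous ψ₀₀)
    (s : Matrix (Fin 2) (Fin 2) k) : ∃ γ, ∀ n ∈ lattice k γ, symmChar ψ₀₀ s n = 1 := by
  obtain ⟨δ, hδ⟩ := exists_ball_forall_eq_one ψ₀₀ hψ
  have hc : Continuous fun n : symmMat k => (s * n.1).trace :=
    (continuous_const.matrix_mul continuous_subtype_val).matrix_trace
  obtain ⟨γ, hγ⟩ := exists_lattice_subset (((isOpen_ball δ).preimage hc).mem_nhds
    (by simp : (0 : symmMat k) ∈ _))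
  exact ⟨γ, fun n hn => hδ _ (hγ hn)⟩

theorem smoothFunctions_translate {G : Type*} [Group G] [TopologicalSpace G] [ContinuousMul G]
    {H : Subgroup G} {f : G → ℂ} (hf : f ∈ smoothFunctions H) (x : G) :
    (fun g => f (g * x)) ∈ smoothFunctions H := smoothFunctions_le_comap H x hf

/-- The normalized integrals over large lattices do not change the class of a function in the
twisted Jacquet module. -/
theorem exists_average {ψ : AddChar (symmMat k) ℂ} (hψ : ∃ γ, ∀ n ∈ lattice k γ, ψ n = 1)
    {f : GSp4 k → ℂ} (hf : f ∈ smoothFunctions (borel k)) :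
    ∃ γ₀, ∀ γ, γ₀ ≤ γ → ∃ e ∈ smoothFunctions (borel k), f - e ∈ twistSpan ψ ∧
      ∀ g, ∃ c : ℂ, e g = c * twist ψ γ f g := by
  obtain ⟨γ₁, h₁⟩ := hψ
  obtain ⟨γ₂, h₂⟩ := exists_lattice_forall_apply_mul_unip_eq hf
  refine ⟨min γ₁ γ₂, fun γ hγ => ?_⟩
  -- Both `ψ` and `f` are invariant under the smaller lattice, so the integral is a finite sum of
  -- translates of `f`. Hence the average is smooth and differs from `f` by generators of
  -- `twistSpan`.
  obtain ⟨S, hSne, -, hS⟩ := exists_finset_setIntegral_eq (Measure.addHaar : Measure (symmMat k))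
    (isCompact_lattice γ) (isOpen_lattice (min γ₁ γ₂)) (lattice_mono hγ)
  have hcard : (S.card : ℂ) ≠ 0 := by simpa using hSne.ne_empty
  refine ⟨(S.card : ℂ)⁻¹ • ∑ a ∈ S, ψ (-a) • (fun g => f (g * unip a)), ?_, ?_, fun g => ?_⟩
  · exact Submodule.smul_mem _ _ (Submodule.sum_mem _ fun a _ =>
      Submodule.smul_mem _ _ (smoothFunctions_translate hf _))
  · have : f - (S.card : ℂ)⁻¹ • ∑ a ∈ S, ψ (-a) • (fun g => f (g * unip a)) =
        (S.card : ℂ)⁻¹ • ∑ a ∈ S, (-ψ (-a)) • ((fun g => f (g * unip a)) - ψ a • f) := by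
      have h3 : ∀ a ∈ S, (-ψ (-a)) • ((fun g => f (g * unip a)) - ψ a • f) =
          f - ψ (-a) • (fun g => f (g * unip a)) := fun a _ => by
        rw [smul_sub, smul_smul, neg_mul, AddChar.neg_mul_self, neg_one_smul, neg_smul]
        abel
      rw [Finset.sum_congr rfl h3, Finset.sum_sub_distrib, Finset.sum_const, smul_sub,
        ← Nat.cast_smul_eq_nsmul ℂ, smul_smul, inv_mul_cancel₀ hcard, one_smul]
    rw [this]
    exact Submodule.smul_mem _ _ (Submodule.sum_mem _ fun a _ =>
      Submodule.smul_mem _ _ (Submodule.subset_span ⟨a, f, hf, rfl⟩))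
  · have h4 := hS (fun n => ψ (-n) * f (g * unip n)) (fun a h hh => by
      rw [unip_add, ← mul_assoc, h₂ h (lattice_mono (min_le_right _ _) hh), neg_add,
        AddChar.map_add_eq_mul, h₁ (-h) (lattice_mono (min_le_left _ _) (neg_mem hh)), mul_one])
    have hm := measureReal_lattice_ne_zero (k := k) γ
    refine ⟨((Measure.addHaar : Measure (symmMat k)).real (lattice k γ : Set (symmMat k)) : ℂ)⁻¹, ?_⟩
    have hm' : ((Measure.addHaar : Measure (symmMat k)).real (lattice k γ : Set (symmMat k)) : ℂ) ≠ 0 :=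
      by exact_mod_cast hm
    simp only [Pi.smul_apply, Finset.sum_apply, smul_eq_mul]
    unfold twist
    field_simp
    linear_combination -h4

theorem twistSpan_le (ψ : AddChar (symmMat k) ℂ) : twistSpan ψ ≤ smoothFunctions (borel k) := by
  refine Submodule.span_le.2 ?_
  rintro _ ⟨n, f, hf, rfl⟩
  exact Submodule.sub_mem _ (smoothFunctions_translate hf _) (Submodule.smul_mem _ _ hf)

theorem continuous_twist_integrand {ψ : AddChar (symmMat k) ℂ} (hψ : Continuous ψ)
    {f : GSp4 k → ℂ} (hf : f ∈ smoothFunctions (borel k)) (g : GSp4 k) :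
    Continuous fun n => ψ (-n) * f (g * unip n) :=
  (hψ.comp continuous_neg).mul (hf.1.continuous.comp (continuous_const.mul continuous_unip))

theorem integrableOn_twist {ψ : AddChar (symmMat k) ℂ} (hψ : Continuous ψ)
    {f : GSp4 k → ℂ} (hf : f ∈ smoothFunctions (borel k)) (γ : (ValueGroupWithZero k)ˣ)
    (g : GSp4 k) :
    IntegrableOn (fun n => ψ (-n) * f (g * unip n)) (lattice k γ) Measure.addHaar :=
  (continuous_twist_integrand hψ hf g).continuousOn.integrableOn_compact (isCompact_lattice γ)

theorem twist_add {ψ : AddChar (symmMat k) ℂ} (hψ : Continuous ψ) {f f' : GSp4 k → ℂ}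
    (hf : f ∈ smoothFunctions (borel k)) (hf' : f' ∈ smoothFunctions (borel k))
    (γ : (ValueGroupWithZero k)ˣ) (g : GSp4 k) :
    twist ψ γ (f + f') g = twist ψ γ f g + twist ψ γ f' g := by
  unfold twist
  rw [← integral_add (integrableOn_twist hψ hf γ g) (integrableOn_twist hψ hf' γ g)]
  simp only [Pi.add_apply, mul_add]

theorem twist_smul (ψ : AddChar (symmMat k) ℂ) (c : ℂ) (f : GSp4 k → ℂ)
    (γ : (ValueGroupWithZero k)ˣ) (g : GSp4 k) :
    twist ψ γ (c • f) g = c * twist ψ γ f g := by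
  unfold twist
  rw [← integral_const_mul]
  congr 1
  ext n
  rw [Pi.smul_apply, smul_eq_mul]
  ring

/-- Elements of `twistSpan` are killed by the integrals over all large lattices. -/
theorem exists_forall_twist_eq_zero {ψ : AddChar (symmMat k) ℂ} (hψ : Continuous ψ)
    {j : GSp4 k → ℂ} (hj : j ∈ twistSpan ψ) :
    ∃ γ₀, ∀ γ, γ₀ ≤ γ → ∀ g, twist ψ γ j g = 0 := by
  induction hj using Submodule.span_induction with
  | mem w hw =>
    obtain ⟨m, f, hf, rfl⟩ := hw
    obtain ⟨γ₀, h₀⟩ := exists_mem_lattice m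
    refine ⟨γ₀, fun γ hγ g => ?_⟩
    rw [sub_eq_add_neg, ← neg_smul, twist_add hψ (smoothFunctions_translate hf _)
      (Submodule.smul_mem _ _ hf), twist_smul]
    have h1 : twist ψ γ (fun g => f (g * unip m)) g = twist ψ γ f (g * unip m) := by
      unfold twist
      congr 1
      ext n
      change ψ (-n) * f (g * unip n * unip m) = ψ (-n) * f (g * unip m * unip n)
      rw [mul_assoc, mul_assoc, ← unip_add, ← unip_add, add_comm]
    rw [h1, twist_mul_unip ψ (lattice_mono hγ h₀)]
    ring
  | zero => exact ⟨1, fun γ _ g => by simp [twist]⟩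
  | add x y hx hy ihx ihy =>
    obtain ⟨γ₁, h₁⟩ := ihx
    obtain ⟨γ₂, h₂⟩ := ihy
    refine ⟨max γ₁ γ₂, fun γ hγ g => ?_⟩
    rw [twist_add hψ (twistSpan_le ψ hx) (twistSpan_le ψ hy), h₁ γ ((le_max_left _ _).trans hγ),
      h₂ γ ((le_max_right _ _).trans hγ), add_zero]
  | smul c x hx ih =>
    obtain ⟨γ₁, h₁⟩ := ih
    exact ⟨γ₁, fun γ hγ g => by rw [twist_smul, h₁ γ hγ, mul_zero]⟩

end Twist

/-! ### Linear algebra of flags relative to the plane `W` -/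

section Decomposition
open ValuativeRel MeasureTheory

variable {k : Type*} [Field k]

/-- The symmetric product `p ᵗq + q ᵗp` of two column vectors. -/
def symProd (p q : Fin 2 → k) : symmMat k :=
  ⟨Matrix.vecMulVec p q + Matrix.vecMulVec q p, by
    change (_ + _)ᵀ = _
    rw [Matrix.transpose_add, Matrix.transpose_vecMulVec, Matrix.transpose_vecMulVec, add_comm]⟩

theorem symProd_apply (p q : Fin 2 → k) (i j : Fin 2) :
    (symProd p q).1 i j = p i * q j + q i * p j := rfl

theorem trace_mul_symProd {s : Matrix (Fin 2) (Fin 2) k} (hs : s.IsSymm) (p q : Fin 2 → k) :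
    (s * (symProd p q).1).trace = 2 * (p ⬝ᵥ s.mulVec q) := by
  have h01 : s 1 0 = s 0 1 := hs.apply 0 1
  simp only [Matrix.trace, Matrix.diag, Matrix.mul_apply, symProd_apply, Fin.sum_univ_two,
    dotProduct, Matrix.mulVec, h01]
  ring

theorem exists_smul_eq_of_det_eq_zero {M : Matrix (Fin 2) (Fin 2) k} (h : M.det = 0)
    (h0 : M 0 ≠ 0) : ∃ c : k, M 1 = c • M 0 := by
  rw [Matrix.det_fin_two] at h
  by_cases ha : M 0 0 = 0
  · have hb : M 0 1 ≠ 0 := fun hb => h0 (by ext j; fin_cases j <;> simp [ha, hb])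
    have hc : M 1 0 = 0 := by
      rw [ha, zero_mul, zero_sub, neg_eq_zero] at h
      exact (mul_eq_zero.1 h).resolve_left hb
    refine ⟨M 1 1 / M 0 1, ?_⟩
    ext j; fin_cases j <;> simp [ha, hc, hb]
  · refine ⟨M 1 0 / M 0 0, ?_⟩
    ext j; fin_cases j
    · simp [ha]
    · simp
      field_simp
      linear_combination h

theorem exists_smul_eq_of_dotProduct_eq_zero {x v w : Fin 2 → k} (hx : x ≠ 0) (hv : v ≠ 0)
    (hxv : x ⬝ᵥ v = 0) (hxw : x ⬝ᵥ w = 0) : ∃ c : k, w = c • v := by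
  have h : (Matrix.of ![v, w]).det = 0 := by
    refine Matrix.exists_mulVec_eq_zero_iff.1 ⟨x, hx, ?_⟩
    ext i; fin_cases i
    · simpa [Matrix.mulVec, dotProduct_comm] using hxv
    · simpa [Matrix.mulVec, dotProduct_comm] using hxw
  exact exists_smul_eq_of_det_eq_zero h hv

theorem dotProduct_lowL_lowR (g : GSp4 k) : lowL g 0 ⬝ᵥ lowR g 1 = lowL g 1 ⬝ᵥ lowR g 0 := by
  have := congrFun (congrFun (lowL_mul_lowR_transpose g) 0) 1
  simp only [Matrix.mul_apply, Fin.sum_univ_two, Matrix.transpose_apply] at this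
  simp only [dotProduct, Fin.sum_univ_two, this]
  ring

/-- A flag whose plane meets `W` in a line other than its own line is determined by that line. -/
theorem mul_inv_mem_borel_of_det_eq_zero {g g' : GSp4 k} {a : k}
    (hL : lowL g' 0 = a • lowL g 0) (hR : lowR g' 0 = a • lowR g 0) (h0 : lowL g' 0 ≠ 0)
    (hg : (lowL g).det = 0) (hg' : (lowL g').det = 0) : g' * g⁻¹ ∈ borel k := by
  have ha : a ≠ 0 := by rintro rfl; simp [hL] at h0
  have h0' : lowL g 0 ≠ 0 := fun h => h0 (by rw [hL, h, smul_zero])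
  obtain ⟨c, hc⟩ := exists_smul_eq_of_det_eq_zero hg h0'
  obtain ⟨c', hc'⟩ := exists_smul_eq_of_det_eq_zero hg' h0
  -- The combination `row 1 - c • row 0` of the two rows lies in `W`, and isotropy makes its
  -- `R`-part orthogonal to `lowL g 0`. The orthogonal of a nonzero vector of `k²` is a line, so
  -- both planes meet `W` in the same line.
  have hv : lowL g 0 ⬝ᵥ (lowR g 1 - c • lowR g 0) = 0 := by
    rw [dotProduct_sub, dotProduct_lowL_lowR, hc, smul_dotProduct, dotProduct_smul, sub_self]
  have hv' : lowL g 0 ⬝ᵥ (lowR g' 1 - c' • lowR g' 0) = 0 := by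
    have : lowL g' 0 ⬝ᵥ (lowR g' 1 - c' • lowR g' 0) = 0 := by
      rw [dotProduct_sub, dotProduct_lowL_lowR, hc', smul_dotProduct, dotProduct_smul, sub_self]
    rw [hL, smul_dotProduct, smul_eq_mul] at this
    exact (mul_eq_zero.1 this).resolve_left ha
  have hne : lowR g 1 - c • lowR g 0 ≠ 0 := by
    intro h
    have := vecMul_lowL_ne_zero g (u := ![-c, 1]) (by
      ext j
      have := congrFun hc j
      simp at this
      simp [Matrix.vecMul, dotProduct, this]) (by
      ext j
      have := congrFun h j
      simp at this
      simp [Matrix.vecMul, dotProduct]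
      linear_combination this)
    simpa using congrFun this 1
  obtain ⟨d, hd⟩ := exists_smul_eq_of_dotProduct_eq_zero h0' hne hv hv'
  refine mul_inv_mem_borel_of_low (X := !![a, 0; c' * a - d * c, d]) rfl ?_ ?_
  · ext i j
    fin_cases i
    · simpa [Matrix.mul_apply] using congrFun hL j
    · have h1 := congrFun hc' j
      have h2 := congrFun hc j
      have h3 := congrFun hL j
      simp at h1 h2 h3
      simp [Matrix.mul_apply]
      linear_combination h1 + c' * h3 - d * h2
  · ext i j
    fin_cases i
    · simpa [Matrix.mul_apply] using congrFun hR j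
    · have h1 := congrFun hd j
      have h3 := congrFun hR j
      simp at h1 h3
      simp [Matrix.mul_apply]
      linear_combination h1 + c' * h3

variable [ValuativeRel k] [TopologicalSpace k] [IsNonarchimedeanLocalField k]

theorem continuous_symProd : Continuous fun p : (Fin 2 → k) × (Fin 2 → k) => symProd p.1 p.2 := by
  refine Continuous.subtype_mk ?_ _
  exact ((continuous_fst.matrix_vecMulVec continuous_snd).add
    (continuous_snd.matrix_vecMulVec continuous_fst))

/-- For every line `⟨u⟩`, the matrices `u ᵗw + w ᵗu` of bounded size detect a nondegenerate
character. -/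
theorem exists_symProd_mem_lattice (h2 : (2 : k) ≠ 0) {ψ₀₀ : AddChar k ℂ} (hψ_ne : ψ₀₀ ≠ 1)
    {s : Matrix (Fin 2) (Fin 2) k} (hs : s.IsSymm) (hs_det : s.det ≠ 0) :
    ∃ γ, ∀ u : Fin 2 → k, u ≠ 0 → ∃ w : Fin 2 → k, symProd u w ∈ lattice k γ ∧
      symmChar ψ₀₀ s (symProd u w) ≠ 1 := by
  obtain ⟨t, ht⟩ : ∃ t, ψ₀₀ t ≠ 1 := by
    by_contra! h
    exact hψ_ne (by ext x; simp [h x])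
  have hu : IsUnit s.det := isUnit_iff_ne_zero.2 hs_det
  -- By `trace_mul_symProd`, the character takes the value `ψ₀₀ (t * p i)` at `symProd p (q i)`.
  let q : Fin 2 → Fin 2 → k := fun i => (t / 2) • s⁻¹.mulVec (Pi.single i 1)
  have hC : IsCompact (Set.univ.pi fun _ : Fin 2 => (ball k 1 : Set k)) :=
    isCompact_univ_pi fun _ => isCompact_ball 1
  have hK : ∀ i, ∃ γ, (fun p => symProd p (q i)) '' (Set.univ.pi fun _ : Fin 2 => (ball k 1 : Set k)) ⊆
      lattice k γ := fun i => exists_subset_lattice (hC.image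
        (continuous_symProd.comp (continuous_id.prodMk continuous_const)))
  choose γ hγ using hK
  refine ⟨max (γ 0) (γ 1), fun u hu0 => ?_⟩
  -- Dividing `u` by its largest coordinate places it in a compact set and makes that coordinate
  -- `1`; this is what makes the lattice independent of `u`.
  obtain ⟨i, hi, hmax⟩ : ∃ i, u i ≠ 0 ∧ ∀ j, u j / u i ∈ ball k 1 := by
    obtain ⟨i, -, hi⟩ := Finset.exists_max_image Finset.univ (fun i => valuation k (u i)) ⟨0, by simp⟩
    have hne : u i ≠ 0 := by
      intro h0
      refine hu0 (funext fun j => ?_)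
      have := hi j (Finset.mem_univ _)
      simpa [h0] using this
    refine ⟨i, hne, fun j => mem_ball.2 ?_⟩
    rw [map_div₀]
    exact div_le_one_of_le₀ (hi j (Finset.mem_univ _)) zero_le
  have hsc : symProd u ((u i)⁻¹ • q i) = symProd (fun j => u j / u i) (q i) := by
    apply Subtype.ext
    ext a b
    simp only [symProd_apply, Pi.smul_apply, smul_eq_mul]
    field_simp
  refine ⟨(u i)⁻¹ • q i, ?_, ?_⟩
  · rw [hsc]
    have h1 := hγ i ⟨fun j => u j / u i, fun j _ => hmax j, rfl⟩
    refine lattice_mono ?_ h1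
    fin_cases i
    · exact le_max_left _ _
    · exact le_max_right _ _
  · rw [hsc, symmChar_apply, trace_mul_symProd hs]
    have : s.mulVec (q i) = (t / 2) • Pi.single i 1 := by
      simp only [q]
      rw [Matrix.mulVec_smul, Matrix.mulVec_mulVec, Matrix.mul_nonsing_inv _ hu, Matrix.one_mulVec]
    rw [this, dotProduct_smul, dotProduct_single, div_self hi]
    convert ht using 2
    simp
    field_simp

end Decomposition

/-! ### Reduction to functions supported on the open cell -/

section OpenCell
open ValuativeRel MeasureTheory

variable {k : Type*} [Field k] [ValuativeRel k] [TopologicalSpace k] [IsNonarchimedeanLocalField k]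

/-- With `u = lowR g 0`, the element adds `(lowL g 1 ⬝ᵥ u) • w + (lowL g 1 ⬝ᵥ w) • u` to the
`R`-part of the fourth row. The first term vanishes by isotropy and the second is a multiple of the
third row. -/
theorem unip_conj_mem_borel {g : GSp4 k} (hg : lowL g 0 = 0) (w : Fin 2 → k) :
    g * unip (symProd (lowR g 0) w) * g⁻¹ ∈ borel k := by
  have h := dotProduct_lowL_lowR g
  rw [hg, zero_dotProduct] at h
  refine mul_inv_mem_borel_of_low (X := !![1, 0; lowL g 1 ⬝ᵥ w, 1]) rfl ?_ ?_
  · rw [lowL_mul_unip]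
    ext i j
    have hgj := congrFun hg j
    simp at hgj
    fin_cases i <;> simp [Matrix.mul_apply, hgj]
  · rw [lowR_mul_unip]
    ext i j
    have hg0 := congrFun hg 0
    have hg1 := congrFun hg 1
    simp at hg0 hg1
    simp only [dotProduct, Fin.sum_univ_two] at h
    fin_cases i
    · simp [Matrix.mul_apply, hg0, hg1]
    · simp [Matrix.mul_apply, symProd_apply, dotProduct]
      linear_combination -w j * h

/-- Modulo `twistSpan`, a function can be made to vanish at the flags whose line lies in `W`. -/
theorem exists_vanishing_on_plane (h2 : (2 : k) ≠ 0) {ψ₀₀ : AddChar k ℂ} (hψ : Continuous ψ₀₀)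
    (hψ_ne : ψ₀₀ ≠ 1) {s : Matrix (Fin 2) (Fin 2) k} (hs : s.IsSymm) (hs_det : s.det ≠ 0)
    {f : GSp4 k → ℂ} (hf : f ∈ smoothFunctions (borel k)) :
    ∃ f₁ ∈ smoothFunctions (borel k), f - f₁ ∈ twistSpan (symmChar ψ₀₀ s) ∧
      ∀ g, lowL g 0 = 0 → f₁ g = 0 := by
  obtain ⟨γ₁, h₁⟩ := exists_average (exists_lattice_symmChar_eq_one hψ s) hf
  obtain ⟨γ₂, h₂⟩ := exists_symProd_mem_lattice h2 hψ_ne hs hs_det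
  obtain ⟨e, he, hfe, hetw⟩ := h₁ (max γ₁ γ₂) (le_max_left _ _)
  refine ⟨e, he, hfe, fun g hg => ?_⟩
  obtain ⟨c, hc⟩ := hetw g
  have hu : lowR g 0 ≠ 0 := by
    intro h0
    have := vecMul_lowL_ne_zero g (u := Pi.single 0 1)
      (by rw [Matrix.single_one_vecMul]; exact hg) (by rw [Matrix.single_one_vecMul]; exact h0)
    simpa using congrFun this 0
  -- `symProd (lowR g 0) w` fixes every flag in the orbit `g N`, since the line of the flag lies in
  -- `W` and is the same along the orbit.
  obtain ⟨w, hw, hψw⟩ := h₂ _ hu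
  rw [hc, twist_eq_zero _ (lattice_mono (le_max_right _ _) hw) hψw, mul_zero]
  intro n
  have hL : lowL (g * unip n) 0 = 0 := by rw [lowL_mul_unip, hg]
  have hR : lowR (g * unip n) 0 = lowR g 0 := by
    rw [lowR_mul_unip]
    ext j
    simp [Matrix.add_apply, Matrix.mul_apply, congrFun hg]
  have := unip_conj_mem_borel hL w
  rw [hR] at this
  exact smoothFunctions_apply_eq hf this

/-- Left multiplication by `middleEmb t` keeps the line of `g` and moves its plane among the
isotropic planes through that line. The determinant is `det t` times a linear form in the bottom row
of `t`, so it can be made to vanish. The compact range of `t` is what makes the extension to `Q \ G`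
locally constant. -/
theorem exists_middleEmb_det_eq_zero (g : GSp4 k) :
    ∃ t ∈ (compactGL k)⁻¹, (lowL (middleEmb t * g)).det = 0 := by
  have hdet : ∀ t : GL (Fin 2) k, (lowL (middleEmb t * g)).det = t.1.det *
      (t.1 1 0 * (lowL g 0 0 * (mat g).toBlocks₁₁ 1 1 - lowL g 0 1 * (mat g).toBlocks₁₁ 1 0) +
        t.1 1 1 * (lowL g).det) := by
    intro t
    obtain ⟨h0, -, h1⟩ := low_middleEmb_mul g t
    rw [Matrix.det_fin_two (lowL (middleEmb t * g)), h0, h1, Matrix.det_fin_two (lowL g)]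
    simp only [Pi.add_apply, Pi.smul_apply, smul_eq_mul]
    ring
  obtain ⟨t, ht, h⟩ := exists_compactGL_row (lowL g).det
    (-(lowL g 0 0 * (mat g).toBlocks₁₁ 1 1 - lowL g 0 1 * (mat g).toBlocks₁₁ 1 0))
  refine ⟨t⁻¹, Set.inv_mem_inv.2 ht, ?_⟩
  rw [hdet]
  have e10 : (t⁻¹).1 1 0 = -((t.1.det)⁻¹ * t.1 1 0) := by
    rw [Matrix.coe_units_inv, Matrix.inv_def, Matrix.adjugate_fin_two, Ring.inverse_eq_inv']
    simp
  have e11 : (t⁻¹).1 1 1 = (t.1.det)⁻¹ * t.1 0 0 := by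
    rw [Matrix.coe_units_inv, Matrix.inv_def, Matrix.adjugate_fin_two, Ring.inverse_eq_inv']
    simp
  rw [e10, e11]
  linear_combination (t⁻¹).1.det * (t.1.det)⁻¹ * h

/-- Extension to `Q \ G` of a function on the flags whose plane meets `W`. -/
theorem exists_klingen_extension {f : GSp4 k → ℂ} (hf : f ∈ smoothFunctions (borel k))
    (hf0 : ∀ g, lowL g 0 = 0 → f g = 0) :
    ∃ q ∈ smoothFunctions (klingenParabolic k), ∀ g, (lowL g).det = 0 → q g = f g := by
  choose κ hκ hκdet using exists_middleEmb_det_eq_zero (k := k)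
  -- At a flag whose plane meets `W`, the value of `f` depends only on the line: a line outside `W`
  -- determines the flag, and `f` vanishes if the line lies in `W`.
  have hcompat : ∀ (y y' : GSp4 k) (g : GSp4 k), y ∈ klingenParabolic k → y' ∈ klingenParabolic k →
      (lowL (y * g)).det = 0 → (lowL (y' * g)).det = 0 → f (y' * g) = f (y * g) := by
    intro y y' g hy hy' hd hd'
    obtain ⟨a, ha⟩ : ∃ a, a = mat (y' * y⁻¹) (Sum.inr 0) (Sum.inr 0) := ⟨_, rfl⟩
    have hrow := row_mul_of_mem_klingenParabolic (Subgroup.mul_mem _ hy' (Subgroup.inv_mem _ hy)) (y * g)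
    rw [← mul_assoc, inv_mul_cancel_right, ← ha] at hrow
    have hL : lowL (y' * g) 0 = a • lowL (y * g) 0 := by
      ext j; exact congrFun hrow (Sum.inl j)
    have hR : lowR (y' * g) 0 = a • lowR (y * g) 0 := by
      ext j; exact congrFun hrow (Sum.inr j)
    by_cases h0 : lowL (y' * g) 0 = 0
    · rw [hf0 _ h0]
      by_cases h0' : lowL (y * g) 0 = 0
      · rw [hf0 _ h0']
      · exfalso
        have ha0 : a = 0 := by
          rw [hL] at h0
          exact (smul_eq_zero.1 h0).resolve_right h0'
        have := vecMul_lowL_ne_zero (y' * g) (u := Pi.single 0 1)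
          (by rw [Matrix.single_one_vecMul]; exact h0)
          (by rw [Matrix.single_one_vecMul]; change lowR _ 0 = 0; rw [hR, ha0, zero_smul])
        simpa using congrFun this 0
    · exact smoothFunctions_apply_eq hf (mul_inv_mem_borel_of_det_eq_zero hL hR h0 hd hd')
  have hQ : ∀ g, middleEmb (κ g) ∈ klingenParabolic k := fun g => middleEmb_mem_klingenParabolic _
  refine ⟨fun g => f (middleEmb (κ g) * g), ⟨?_, ?_⟩, ?_⟩
  · rw [IsLocallyConstant.iff_eventually_eq]
    intro g
    obtain ⟨z, hz⟩ : ∃ z, z = f (middleEmb (κ g) * g) := ⟨_, rfl⟩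
    -- The choice `κ` need not be continuous. By the tube lemma, for all `g'` near `g` and every `t`
    -- in the compact set, either the determinant is nonzero or the value is `z`; hence any choice
    -- `κ g'` gives `z`.
    have hopen : IsOpen {p : GL (Fin 2) k × GSp4 k |
        (lowL (middleEmb p.1 * p.2)).det ≠ 0 ∨ f (middleEmb p.1 * p.2) = z} := by
      have hc : Continuous fun p : GL (Fin 2) k × GSp4 k => middleEmb p.1 * p.2 :=
        (continuous_middleEmb.comp continuous_fst).mul continuous_snd
      refine IsOpen.union ?_ ?_
      · exact isOpen_compl_singleton.preimage (continuous_lowL.comp hc).matrix_det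
      · exact (hf.1.comp_continuous hc).isOpen_fiber z
    have hsub : (compactGL k)⁻¹ ×ˢ ({g} : Set (GSp4 k)) ⊆ {p : GL (Fin 2) k × GSp4 k |
        (lowL (middleEmb p.1 * p.2)).det ≠ 0 ∨ f (middleEmb p.1 * p.2) = z} := by
      rintro ⟨t, g'⟩ ⟨_, hg'⟩
      rw [Set.mem_singleton_iff] at hg'
      subst hg'
      by_cases hd : (lowL (middleEmb t * g')).det = 0
      · exact Or.inr (by
          rw [hz]
          exact hcompat _ _ _ (hQ g') (middleEmb_mem_klingenParabolic t) (hκdet g') hd)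
      · exact Or.inl hd
    obtain ⟨U, V, hU, hV, hCU, hgV, hUV⟩ := generalized_tube_lemma isCompact_compactGL.inv
      isCompact_singleton hopen hsub
    filter_upwards [hV.mem_nhds (hgV rfl)] with g' hg'
    rw [← hz]
    exact (hUV (Set.mk_mem_prod (hCU (hκ g')) hg')).resolve_left (fun h => h (hκdet g'))
  · intro y hy g
    have := hcompat (middleEmb (κ g)) (middleEmb (κ (y * g)) * y) g (hQ g)
      (Subgroup.mul_mem _ (hQ _) hy) (hκdet g) (by rw [mul_assoc]; exact hκdet _)
    rw [mul_assoc] at this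
    exact this
  · intro g hg
    have := hcompat 1 (middleEmb (κ g)) g (Subgroup.one_mem _) (hQ g) (by rwa [one_mul]) (hκdet g)
    rw [one_mul] at this
    exact this

theorem borel_le_klingen : borel k ≤ klingenParabolic k := inf_le_right

theorem borel_le_siegel : borel k ≤ siegelParabolic k := inf_le_left

/-- Modulo functions on `Q \ G` and `twistSpan`, smooth functions on the flag variety are supported
on the open cell. -/
theorem exists_cellFunctions_decomposition (h2 : (2 : k) ≠ 0) {ψ₀₀ : AddChar k ℂ}
    (hψ : Continuous ψ₀₀) (hψ_ne : ψ₀₀ ≠ 1) {s : Matrix (Fin 2) (Fin 2) k} (hs : s.IsSymm)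
    (hs_det : s.det ≠ 0) {f : GSp4 k → ℂ} (hf : f ∈ smoothFunctions (borel k)) :
    ∃ φ ∈ cellFunctions k, ∃ q ∈ smoothFunctions (klingenParabolic k),
      f - φ - q ∈ twistSpan (symmChar ψ₀₀ s) := by
  obtain ⟨f₁, hf₁, hff₁, h0⟩ := exists_vanishing_on_plane h2 hψ hψ_ne hs hs_det hf
  obtain ⟨q, hq, hqf⟩ := exists_klingen_extension hf₁ h0
  refine ⟨f₁ - q, ⟨Submodule.sub_mem _ hf₁ (smoothFunctions_anti borel_le_klingen hq), fun g hg => ?_⟩,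
    q, hq, ?_⟩
  · rw [Pi.sub_apply, hqf g hg, sub_self]
  · rwa [sub_sub, sub_add_cancel]

end OpenCell

/-! ### `GL₂` and the projective line of first rows -/

section GLTwo
variable {k : Type*} [Field k]

theorem det_ne_zero_GL (h : GL (Fin 2) k) : h.1.det ≠ 0 :=
  ((Matrix.isUnit_iff_isUnit_det _).1 h.isUnit).ne_zero

theorem coe_inv_GL (h : GL (Fin 2) k) : (h⁻¹).1 = (h.1.det)⁻¹ • h.1.adjugate := by
  rw [Matrix.coe_units_inv, Matrix.inv_def, Ring.inverse_eq_inv']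

variable (k) in
/-- Lower triangular matrices in `GL₂`. -/
def lowerTriangular : Subgroup (GL (Fin 2) k) where
  carrier := {t | t.1 0 1 = 0}
  one_mem' := by simp
  mul_mem' := by
    intro a b ha hb
    change a.1 0 1 = 0 at ha
    change b.1 0 1 = 0 at hb
    change (a.1 * b.1) 0 1 = 0
    simp [Matrix.mul_apply, ha, hb]
  inv_mem' := by
    intro a ha
    change a.1 0 1 = 0 at ha
    change (a⁻¹).1 0 1 = 0
    rw [coe_inv_GL, Matrix.adjugate_fin_two]
    simp [ha]

theorem mem_lowerTriangular {t : GL (Fin 2) k} : t ∈ lowerTriangular k ↔ t.1 0 1 = 0 := Iff.rfl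

theorem mul_inv_mem_lowerTriangular {h h' : GL (Fin 2) k} {a : k} (hrow : h'.1 0 = a • h.1 0) :
    h' * h⁻¹ ∈ lowerTriangular k := by
  rw [mem_lowerTriangular, Units.val_mul, coe_inv_GL, Matrix.adjugate_fin_two]
  have h0 := congrFun hrow 0
  have h1 := congrFun hrow 1
  simp at h0 h1
  simp [Matrix.mul_apply, h0, h1]
  ring

/-- A matrix with nonzero determinant, as an element of `GL₂`. -/
def toGL (M : {M : Matrix (Fin 2) (Fin 2) k // M.det ≠ 0}) : GL (Fin 2) k :=
  Matrix.GeneralLinearGroup.mkOfDetNeZero M.1 M.2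

@[simp] theorem coe_toGL (M : {M : Matrix (Fin 2) (Fin 2) k // M.det ≠ 0}) : (toGL M).1 = M.1 := rfl

variable [TopologicalSpace k]

variable (k) in
/-- The locally constant functions on the projective line, as functions on `GL₂` depending only on
the line spanned by the first row. -/
abbrev rowFunctions : Submodule ℂ (GL (Fin 2) k → ℂ) := smoothFunctions (lowerTriangular k)

theorem rowFunctions_apply_eq {y : GL (Fin 2) k → ℂ} (hy : y ∈ rowFunctions k)
    {h h' : GL (Fin 2) k} {a : k} (hrow : h'.1 0 = a • h.1 0) : y h' = y h :=
  smoothFunctions_apply_eq hy (mul_inv_mem_lowerTriangular hrow)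

variable [IsTopologicalDivisionRing k]

theorem continuous_toGL : Continuous (toGL : _ → GL (Fin 2) k) := by
  refine Units.continuous_iff.2 ⟨continuous_subtype_val, ?_⟩
  have : (fun x : {M : Matrix (Fin 2) (Fin 2) k // M.det ≠ 0} => ((toGL x)⁻¹).1) =
      fun x => (x.1.det)⁻¹ • x.1.adjugate := by
    ext1 x; exact coe_inv_GL _
  change Continuous fun x : {M : Matrix (Fin 2) (Fin 2) k // M.det ≠ 0} => ((toGL x)⁻¹).1
  rw [this]
  have hd : Continuous fun x : {M : Matrix (Fin 2) (Fin 2) k // M.det ≠ 0} => x.1.det :=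
    continuous_subtype_val.matrix_det
  exact (hd.inv₀ fun x => x.2).smul continuous_subtype_val.matrix_adjugate

end GLTwo

theorem isOpen_setOf_eq_of_isLocallyConstant {X Y : Type*} [TopologicalSpace X] {f g : X → Y}
    (hf : IsLocallyConstant f) (hg : IsLocallyConstant g) : IsOpen {x | f x = g x} := by
  rw [isOpen_iff_mem_nhds]
  intro x hx
  filter_upwards [hf.eventually_eq x, hg.eventually_eq x] with x' h h'
  exact h.trans (hx.trans h'.symm)

/-! ### Functions on the open cell and their integrals along `N` -/

section Bessel
open ValuativeRel MeasureTheory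

variable {k : Type*} [Field k] [ValuativeRel k] [TopologicalSpace k] [IsNonarchimedeanLocalField k]

theorem cellFunctions_le : cellFunctions k ≤ smoothFunctions (borel k) := fun _ h => h.1

/-- Functions supported on the open cell have support in a bounded part of it. -/
theorem exists_lattice_support {φ : GSp4 k → ℂ} (hφ : φ ∈ cellFunctions k) :
    ∃ γ, ∀ g, φ g ≠ 0 → ∀ n : symmMat k, lowR g = lowL g * n.1 → n ∈ lattice k γ := by
  obtain ⟨C, hC, hBC⟩ := exists_isCompact_borel_mul k
  -- The coordinate `n = L⁻¹ R` depends only on the coset of `B` and is continuous where `det L ≠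
  -- 0`, so it is bounded on this compact set.
  have hK : IsCompact (C ∩ {g | φ g ≠ 0}) :=
    hC.inter_right ((hφ.1.1.isOpen_fiber 0).isClosed_compl)
  have hdet : ∀ g, φ g ≠ 0 → (lowL g).det ≠ 0 := fun g hg h => hg (hφ.2 g h)
  have hcont : ∀ i j, ContinuousOn
      (fun g : GSp4 k => (((lowL g).det)⁻¹ • ((lowL g).adjugate * lowR g)) i j) (C ∩ {g | φ g ≠ 0}) := by
    intro i j
    have h1 : Continuous fun g : GSp4 k => ((lowL g).adjugate * lowR g) i j :=
      (continuous_lowL.matrix_adjugate.matrix_mul continuous_lowR).matrix_elem i j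
    exact (continuous_lowL.matrix_det.continuousOn.inv₀ fun g hg => hdet g hg.2).mul h1.continuousOn
  choose γ hγ using fun i j => exists_forall_mem_ball (hK.image_of_continuousOn (hcont i j))
  refine ⟨Finset.univ.sup' ⟨(0, 0), by simp⟩ fun p : Fin 2 × Fin 2 => γ p.1 p.2,
    fun g hg n hn i j => ball_mono (Finset.le_sup' (fun p : Fin 2 × Fin 2 => γ p.1 p.2)
      (Finset.mem_univ (i, j))) ?_⟩
  obtain ⟨b, hb, c, hc, rfl⟩ := hBC g
  have hc0 : φ c ≠ 0 := by rwa [hφ.1.2 b hb] at hg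
  obtain ⟨h1, h2⟩ := low_mul_of_mem_siegel hb.1 c
  rw [h1, h2, Matrix.mul_assoc] at hn
  have hub : IsUnit (lowR b).det := isUnit_iff_ne_zero.2 (det_lowR_ne_zero hb.1)
  have hn' : lowR c = lowL c * n.1 := by
    have := congrArg (fun M => (lowR b)⁻¹ * M) hn
    simpa [Matrix.nonsing_inv_mul_cancel_left _ _ hub] using this
  have hn2 : n.1 = ((lowL c).det)⁻¹ • ((lowL c).adjugate * lowR c) := by
    rw [hn', ← Matrix.mul_assoc, Matrix.adjugate_mul, Matrix.smul_mul, Matrix.one_mul, smul_smul,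
      inv_mul_cancel₀ (hdet c hc0), one_smul]
  exact hγ i j ⟨c, ⟨hc, hc0⟩, by rw [hn2]⟩

/-- The integral over `N` of a function on the open cell against `ψ⁻¹`. -/
def cellIntegral (ψ : AddChar (symmMat k) ℂ) (φ : GSp4 k → ℂ) (h : GL (Fin 2) k) : ℂ :=
  ∫ n, ψ (-n) * φ (cell h n) ∂Measure.addHaar

/-- The support along `N` is bounded uniformly in `h`, so integrals over `N` can be replaced by
`twist` over any large lattice. -/
theorem exists_forall_cellIntegral_eq (ψ : AddChar (symmMat k) ℂ) {φ : GSp4 k → ℂ}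
    (hφ : φ ∈ cellFunctions k) :
    ∃ γ₀, (∀ h n, φ (cell h n) ≠ 0 → n ∈ lattice k γ₀) ∧
      ∀ γ, γ₀ ≤ γ → ∀ h, cellIntegral ψ φ h = twist ψ γ φ (cell h 0) := by
  obtain ⟨γ₀, h₀⟩ := exists_lattice_support hφ
  have hs : ∀ h n, φ (cell h n) ≠ 0 → n ∈ lattice k γ₀ := fun h n hn => h₀ _ hn n (by simp)
  refine ⟨γ₀, hs, fun γ hγ h => ?_⟩
  unfold twist cellIntegral
  simp only [cell_mul_unip, zero_add]
  refine (setIntegral_eq_integral_of_forall_compl_eq_zero fun n hn => ?_).symm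
  rw [mul_eq_zero]
  refine Or.inr (by_contra fun hne => hn (lattice_mono hγ (hs h n hne)))

theorem cellIntegral_add {ψ : AddChar (symmMat k) ℂ} (hψ : Continuous ψ) {φ φ' : GSp4 k → ℂ}
    (hφ : φ ∈ cellFunctions k) (hφ' : φ' ∈ cellFunctions k) (h : GL (Fin 2) k) :
    cellIntegral ψ (φ + φ') h = cellIntegral ψ φ h + cellIntegral ψ φ' h := by
  obtain ⟨γ₁, -, h₁⟩ := exists_forall_cellIntegral_eq ψ hφ
  obtain ⟨γ₂, -, h₂⟩ := exists_forall_cellIntegral_eq ψ hφ'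
  obtain ⟨γ₃, -, h₃⟩ := exists_forall_cellIntegral_eq ψ (Submodule.add_mem _ hφ hφ')
  rw [h₁ (max γ₁ (max γ₂ γ₃)) (by simp), h₂ (max γ₁ (max γ₂ γ₃)) (by simp),
    h₃ (max γ₁ (max γ₂ γ₃)) (by simp), twist_add hψ hφ.1 hφ'.1]

theorem cellIntegral_smul (ψ : AddChar (symmMat k) ℂ) (c : ℂ) (φ : GSp4 k → ℂ)
    (h : GL (Fin 2) k) : cellIntegral ψ (c • φ) h = c * cellIntegral ψ φ h := by
  unfold cellIntegral
  rw [← integral_const_mul]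
  congr 1
  ext n
  rw [Pi.smul_apply, smul_eq_mul]
  ring

theorem cell_mem_borel_coset {h h' : GL (Fin 2) k} (hh : h' * h⁻¹ ∈ lowerTriangular k)
    (n : symmMat k) : cell h' n * (cell h n)⁻¹ ∈ borel k := by
  refine mul_inv_mem_borel_of_low (X := (h' * h⁻¹).1) hh ?_ ?_
  · rw [lowL_cell, lowL_cell, ← Units.val_mul, inv_mul_cancel_right]
  · rw [lowR_cell, lowR_cell, ← Matrix.mul_assoc, ← Units.val_mul, inv_mul_cancel_right]

theorem continuous_cell_right (h : GL (Fin 2) k) : Continuous (cell h) := by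
  unfold cell
  fun_prop

/-- The integrand is locally constant in `h`, uniformly for `n` in the compact lattice carrying the
support; a lower triangular factor on the left of `h` does not change the flag. -/
theorem cellIntegral_mem {ψ : AddChar (symmMat k) ℂ} {φ : GSp4 k → ℂ}
    (hφ : φ ∈ cellFunctions k) : cellIntegral ψ φ ∈ rowFunctions k := by
  refine ⟨?_, fun b hb h => ?_⟩
  · obtain ⟨γ, -, h₁⟩ := exists_forall_cellIntegral_eq ψ hφ
    rw [IsLocallyConstant.iff_eventually_eq]
    intro h
    obtain ⟨F, hF⟩ : ∃ F : GL (Fin 2) k → symmMat k → ℂ, ∀ h n, F h n = φ (cell h n) :=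
      ⟨_, fun _ _ => rfl⟩
    have hF1 : IsLocallyConstant fun p : GL (Fin 2) k × symmMat k => F p.1 p.2 := by
      simp only [hF]
      exact hφ.1.1.comp_continuous continuous_cell
    have hF2 : IsLocallyConstant fun p : GL (Fin 2) k × symmMat k => F h p.2 := by
      simp only [hF]
      exact hφ.1.1.comp_continuous ((continuous_cell_right h).comp continuous_snd)
    obtain ⟨U, V, hU, hV, hCU, hgV, hUV⟩ := generalized_tube_lemma (s := {h})
      (t := (lattice k γ : Set (symmMat k))) isCompact_singleton
      (isCompact_lattice γ) (isOpen_setOf_eq_of_isLocallyConstant hF1 hF2) (by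
        rintro ⟨h', n⟩ ⟨hh, -⟩
        rw [Set.mem_singleton_iff] at hh
        subst hh
        rfl)
    filter_upwards [hU.mem_nhds (hCU rfl)] with h' hh'
    rw [h₁ γ le_rfl, h₁ γ le_rfl]
    unfold twist
    refine setIntegral_congr_fun (measurableSet_lattice γ) fun n hn => ?_
    have h2 : F h' n = F h n := hUV (Set.mk_mem_prod hh' (hgV hn))
    rw [hF, hF] at h2
    simp only [cell_mul_unip, zero_add, h2]
  · unfold cellIntegral
    congr 1
    ext n
    rw [smoothFunctions_apply_eq hφ.1 (cell_mem_borel_coset (h := h) (h' := b * h)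
      (by simpa using hb) n)]

/-- The function on the open cell that is `y` on rows and the indicator of a lattice on `N`. -/
def cellExtend (γ : (ValueGroupWithZero k)ˣ) (y : GL (Fin 2) k → ℂ) (g : GSp4 k) : ℂ :=
  open Classical in
  if h : (lowL g).det ≠ 0 ∧ ∃ n ∈ lattice k γ, lowR g = lowL g * n.1 then y (toGL ⟨lowL g, h.1⟩) else 0

theorem cellExtend_cell (γ : (ValueGroupWithZero k)ˣ) (y : GL (Fin 2) k → ℂ) (h : GL (Fin 2) k)
    (n : symmMat k) : cellExtend γ y (cell h n) =
      (lattice k γ : Set (symmMat k)).indicator (fun _ => y h) n := by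
  unfold cellExtend
  by_cases hn : n ∈ lattice k γ
  · rw [Set.indicator_of_mem (show n ∈ (lattice k γ : Set (symmMat k)) from hn), dif_pos
      ⟨by rw [lowL_cell]; exact det_ne_zero_GL h, n, hn, by simp⟩]
    congr 1
    apply Units.ext
    simp
  · rw [Set.indicator_of_notMem (show n ∉ (lattice k γ : Set (symmMat k)) from hn), dif_neg]
    rintro ⟨-, m, hm, he⟩
    rw [lowR_cell, lowL_cell] at he
    have : n = m := by
      apply Subtype.ext
      have h1 := congrArg (fun M => (h⁻¹).1 * M) he
      simpa [← Matrix.mul_assoc, ← Units.val_mul] using h1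
    exact hn (this ▸ hm)

theorem isOpen_det_lowL_ne_zero : IsOpen {g : GSp4 k | (lowL g).det ≠ 0} :=
  isOpen_compl_singleton.preimage continuous_lowL.matrix_det

theorem det_lowL_ne_zero_of_lowR_eq {g : GSp4 k} {n : Matrix (Fin 2) (Fin 2) k}
    (h : lowR g = lowL g * n) : (lowL g).det ≠ 0 := by
  intro h0
  obtain ⟨v, hv, hv0⟩ := Matrix.exists_vecMul_eq_zero_iff.2 h0
  exact hv (vecMul_lowL_ne_zero g hv0 (by rw [h, ← Matrix.vecMul_vecMul, hv0, Matrix.zero_vecMul]))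

/-- Closed, as the projection along a compact lattice of the closed condition `R = L n`, which by
itself forces `det L ≠ 0`. Open, because `n = L⁻¹ R` is continuous on the cell and lattices are
open. -/
theorem isClopen_cell_lattice (γ : (ValueGroupWithZero k)ˣ) :
    IsClopen {g : GSp4 k | (lowL g).det ≠ 0 ∧ ∃ n ∈ lattice k γ, lowR g = lowL g * n.1} := by
  constructor
  · have : CompactSpace (lattice k γ) := isCompact_iff_compactSpace.1 (isCompact_lattice γ)
    have hc : IsClosed {p : lattice k γ × GSp4 k | lowR p.2 = lowL p.2 * p.1.1.1} := by
      refine isClosed_eq (by fun_prop) ?_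
      exact (continuous_lowL.comp continuous_snd).matrix_mul
        (continuous_subtype_val.comp (continuous_subtype_val.comp continuous_fst))
    have := isClosedMap_snd_of_compactSpace _ hc
    convert this using 1
    ext g
    constructor
    · rintro ⟨-, n, hn, he⟩
      exact ⟨⟨⟨n, hn⟩, g⟩, he, rfl⟩
    · rintro ⟨⟨⟨n, hn⟩, g'⟩, he, rfl⟩
      exact ⟨det_lowL_ne_zero_of_lowR_eq he, n, hn, he⟩
  · rw [isOpen_iff_mem_nhds]
    rintro g ⟨hg, n, hn, he⟩
    have hc : ∀ i j, ContinuousAt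
        (fun g : GSp4 k => (((lowL g).det)⁻¹ • ((lowL g).adjugate * lowR g)) i j) g := by
      intro i j
      have h1 : Continuous fun g : GSp4 k => ((lowL g).adjugate * lowR g) i j :=
        (continuous_lowL.matrix_adjugate.matrix_mul continuous_lowR).matrix_elem i j
      exact (continuous_lowL.matrix_det.continuousAt.inv₀ hg).mul h1.continuousAt
    have key : ∀ (g : GSp4 k), (lowL g).det ≠ 0 → ∀ n : symmMat k, lowR g = lowL g * n.1 →
        ((lowL g).det)⁻¹ • ((lowL g).adjugate * lowR g) = n.1 := by
      intro g hg n he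
      rw [he, ← Matrix.mul_assoc, Matrix.adjugate_mul, Matrix.smul_mul, Matrix.one_mul, smul_smul,
        inv_mul_cancel₀ hg, one_smul]
    have hev : ∀ᶠ g' in nhds g, ∀ i j,
        (((lowL g').det)⁻¹ • ((lowL g').adjugate * lowR g')) i j ∈ ball k γ := by
      rw [Filter.eventually_all]
      intro i
      rw [Filter.eventually_all]
      intro j
      refine (hc i j).eventually ((isOpen_ball γ).mem_nhds ?_)
      change (((lowL g).det)⁻¹ • ((lowL g).adjugate * lowR g)) i j ∈ ball k γ
      rw [key g hg n he]
      exact hn i j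
    filter_upwards [hev, isOpen_det_lowL_ne_zero.mem_nhds hg] with g' h1 h2
    obtain ⟨m, -, hm⟩ := exists_lowR_eq h2
    refine ⟨h2, m, fun i j => ?_, hm⟩
    rw [← key g' h2 m hm]
    exact h1 i j

theorem isLocallyConstant_cellExtend (γ : (ValueGroupWithZero k)ˣ) {y : GL (Fin 2) k → ℂ}
    (hy : IsLocallyConstant y) : IsLocallyConstant (cellExtend γ y) := by
  rw [IsLocallyConstant.iff_eventually_eq]
  intro g
  by_cases hg : (lowL g).det ≠ 0 ∧ ∃ n ∈ lattice k γ, lowR g = lowL g * n.1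
  · have h1 : IsLocallyConstant fun x : {g : GSp4 k // (lowL g).det ≠ 0} =>
        y (toGL ⟨lowL x.1, x.2⟩) :=
      hy.comp_continuous (continuous_toGL.comp
        ((continuous_lowL.comp continuous_subtype_val).subtype_mk _))
    have h2 := h1.eventually_eq ⟨g, hg.1⟩
    have h3 : ∀ᶠ g' in nhds g, ∀ h : (lowL g').det ≠ 0,
        y (toGL ⟨lowL g', h⟩) = y (toGL ⟨lowL g, hg.1⟩) := by
      rw [← (isOpen_det_lowL_ne_zero (k := k)).isOpenEmbedding_subtypeVal.map_nhds_eq ⟨g, hg.1⟩,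
        Filter.eventually_map]
      filter_upwards [h2] with x hx _
      exact hx
    filter_upwards [h3, (isClopen_cell_lattice γ).isOpen.mem_nhds hg] with g' h4 h5
    unfold cellExtend
    rw [dif_pos hg, dif_pos h5, h4]
  · filter_upwards [(isClopen_cell_lattice γ).compl.isOpen.mem_nhds hg] with g' h5
    unfold cellExtend
    rw [dif_neg hg]
    exact dif_neg h5

/-- Invariance of `y` is a hypothesis so that this serves both `B` with functions on the projective
line and `P` with constants. -/
theorem cellExtend_mul (γ : (ValueGroupWithZero k)ˣ) {y : GL (Fin 2) k → ℂ} {b : GSp4 k}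
    (hb : b ∈ siegelParabolic k) (hyb : ∀ h h' : GL (Fin 2) k, h'.1 = lowR b * h.1 → y h' = y h)
    (g : GSp4 k) : cellExtend γ y (b * g) = cellExtend γ y g := by
  have hub : IsUnit (lowR b).det := isUnit_iff_ne_zero.2 (det_lowR_ne_zero hb)
  obtain ⟨h1, h2⟩ := low_mul_of_mem_siegel hb g
  have hiff : ((lowL (b * g)).det ≠ 0 ∧ ∃ n ∈ lattice k γ, lowR (b * g) = lowL (b * g) * n.1) ↔
      ((lowL g).det ≠ 0 ∧ ∃ n ∈ lattice k γ, lowR g = lowL g * n.1) := by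
    rw [h1, h2, Matrix.det_mul, mul_ne_zero_iff]
    refine ⟨?_, ?_⟩
    · rintro ⟨⟨-, h⟩, n, hn, he⟩
      refine ⟨h, n, hn, ?_⟩
      have := congrArg (fun M => (lowR b)⁻¹ * M) he
      simpa [Matrix.mul_assoc, Matrix.nonsing_inv_mul_cancel_left _ _ hub] using this
    · rintro ⟨h, n, hn, he⟩
      exact ⟨⟨hub.ne_zero, h⟩, n, hn, by rw [he, Matrix.mul_assoc]⟩
  unfold cellExtend
  by_cases hg : (lowL g).det ≠ 0 ∧ ∃ n ∈ lattice k γ, lowR g = lowL g * n.1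
  · rw [dif_pos hg, dif_pos (hiff.2 hg)]
    exact hyb _ _ h1
  · rw [dif_neg hg, dif_neg (fun h => hg (hiff.1 h))]

theorem cellExtend_mem (γ : (ValueGroupWithZero k)ˣ) {y : GL (Fin 2) k → ℂ}
    (hy : y ∈ rowFunctions k) : cellExtend γ y ∈ cellFunctions k := by
  refine ⟨⟨isLocallyConstant_cellExtend γ hy.1, fun b hb g => cellExtend_mul γ hb.1 ?_ g⟩, ?_⟩
  · intro h h' hh
    refine rowFunctions_apply_eq hy (a := lowR b 0 0) ?_
    rw [hh]
    ext j
    simp [Matrix.mul_apply, lowR_apply_of_mem_klingen hb.2]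
  · intro g hg
    unfold cellExtend
    rw [dif_neg (fun h => h.1 hg)]

theorem cellExtend_const_mem (γ : (ValueGroupWithZero k)ˣ) (c : ℂ) :
    cellExtend γ (fun _ => c) ∈ smoothFunctions (siegelParabolic k) :=
  ⟨isLocallyConstant_cellExtend γ (IsLocallyConstant.const c),
    fun _ hb g => cellExtend_mul γ hb (fun _ _ _ => rfl) g⟩

/-- This yields the surjectivity of `cellIntegral` onto `rowFunctions`. -/
theorem cellIntegral_cellExtend {ψ : AddChar (symmMat k) ℂ} {γ : (ValueGroupWithZero k)ˣ}
    (hψ : ∀ n ∈ lattice k γ, ψ n = 1) (y : GL (Fin 2) k → ℂ) (h : GL (Fin 2) k) :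
    cellIntegral ψ (cellExtend γ y) h =
      (Measure.addHaar : Measure (symmMat k)).real (lattice k γ : Set (symmMat k)) * y h := by
  unfold cellIntegral
  have : (fun n => ψ (-n) * cellExtend γ y (cell h n)) =
      (lattice k γ : Set (symmMat k)).indicator (fun _ => y h) := by
    ext n
    rw [cellExtend_cell]
    by_cases hn : n ∈ (lattice k γ : Set (symmMat k))
    · rw [Set.indicator_of_mem hn, hψ _ (neg_mem (show n ∈ lattice k γ from hn)), one_mul]
    · rw [Set.indicator_of_notMem hn, mul_zero]
  rw [this, integral_indicator (measurableSet_lattice γ), setIntegral_const, Complex.real_smul]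

end Bessel

/-! ### The functions on the open cell that die in the quotient -/

section Kernel
open ValuativeRel MeasureTheory

variable {k : Type*} [Field k] [ValuativeRel k] [TopologicalSpace k] [IsNonarchimedeanLocalField k]

theorem continuous_symmChar {ψ₀₀ : AddChar k ℂ} (hψ : Continuous ψ₀₀)
    (s : Matrix (Fin 2) (Fin 2) k) : Continuous (symmChar ψ₀₀ s) :=
  hψ.comp (continuous_const.matrix_mul continuous_subtype_val).matrix_trace

/-- A function on the open cell with vanishing integrals is killed in the twisted Jacquet module. -/
theorem mem_twistSpan_of_cellIntegral_eq_zero {ψ : AddChar (symmMat k) ℂ}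
    (hψ : ∃ γ, ∀ n ∈ lattice k γ, ψ n = 1) {φ : GSp4 k → ℂ} (hφ : φ ∈ cellFunctions k)
    (h0 : ∀ h, cellIntegral ψ φ h = 0) : φ ∈ twistSpan ψ := by
  obtain ⟨γ₁, h₁⟩ := exists_average hψ hφ.1
  obtain ⟨γ₂, hs, h₂⟩ := exists_forall_cellIntegral_eq ψ hφ
  obtain ⟨e, he, hfe, htw⟩ := h₁ (max γ₁ γ₂) (le_max_left _ _)
  have hcell : ∀ h, twist ψ (max γ₁ γ₂) φ (cell h 0) = 0 := fun h => by
    rw [← h₂ _ (le_max_right _ _), h0]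
  -- Off the cell `φ` itself vanishes. On the cell, if the `N`-coordinate of `g` is in the lattice,
  -- equivariance reduces to `cell h 0`; if not, the translates of `g` by the lattice miss the
  -- support.
  have hzero : ∀ g, twist ψ (max γ₁ γ₂) φ g = 0 := by
    intro g
    by_cases hg : (lowL g).det = 0
    · unfold twist
      have h3 : ∀ n, φ (g * unip n) = 0 := fun n => hφ.2 _ (by rwa [lowL_mul_unip])
      simp [h3]
    · obtain ⟨n, -, hn⟩ := exists_lowR_eq hg
      have hcoset : ∀ m, φ (g * unip m) = φ (cell (toGL ⟨lowL g, hg⟩) (n + m)) := fun m =>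
        smoothFunctions_apply_eq hφ.1 (mul_inv_mem_borel_of_low (X := 1) (by simp)
          (by rw [lowL_mul_unip, lowL_cell]; simp) (by
            rw [lowR_mul_unip, lowR_cell, hn]
            simp [Matrix.mul_add, add_comm]))
      by_cases hnl : n ∈ lattice k (max γ₁ γ₂)
      · have h3 : twist ψ (max γ₁ γ₂) φ g =
            twist ψ (max γ₁ γ₂) φ (cell (toGL ⟨lowL g, hg⟩) 0 * unip n) := by
          unfold twist
          congr 1
          ext m
          rw [hcoset, cell_mul_unip, cell_mul_unip, zero_add]
        rw [h3, twist_mul_unip _ hnl, hcell, mul_zero]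
      · unfold twist
        refine setIntegral_eq_zero_of_forall_eq_zero fun m hm => ?_
        rw [hcoset, mul_eq_zero]
        refine Or.inr (by_contra fun hne => hnl ?_)
        have := lattice_mono (le_max_right γ₁ γ₂) (hs _ _ hne)
        exact ((lattice k (max γ₁ γ₂)).add_mem_cancel_right hm).1 this
  have he0 : e = 0 := by
    ext g
    obtain ⟨c, hc⟩ := htw g
    rw [hc, hzero, mul_zero, Pi.zero_apply]
  simpa [he0] using hfe

/-- For a line that is not isotropic for `s`, the integrals of functions on `Q \ G` vanish. -/
theorem exists_forall_twist_klingen_eq_zero (h2 : (2 : k) ≠ 0) {ψ₀₀ : AddChar k ℂ}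
    (hψ_ne : ψ₀₀ ≠ 1) {s : Matrix (Fin 2) (Fin 2) k} (hs : s.IsSymm) {h : GL (Fin 2) k}
    (hh : ![h.1 0 1, -h.1 0 0] ⬝ᵥ s.mulVec ![h.1 0 1, -h.1 0 0] ≠ 0) {q : GSp4 k → ℂ}
    (hq : q ∈ smoothFunctions (klingenParabolic k)) :
    ∃ γ₀, ∀ γ, γ₀ ≤ γ → twist (symmChar ψ₀₀ s) γ q (cell h 0) = 0 := by
  obtain ⟨t, ht⟩ : ∃ t, ψ₀₀ t ≠ 1 := by
    by_contra! h
    exact hψ_ne (by ext x; simp [h x])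
  obtain ⟨u, hu⟩ : ∃ u : Fin 2 → k, u = ![h.1 0 1, -h.1 0 0] := ⟨_, rfl⟩
  rw [← hu] at hh
  -- The vector `u` is orthogonal to the first row of `h`, so multiples of `u ᵗu` do not move the
  -- line of the flag. The scalar makes `trace (s m)` equal to `t`.
  obtain ⟨m, hm⟩ : ∃ m, m = symProd u ((t / (2 * (u ⬝ᵥ s.mulVec u))) • u) := ⟨_, rfl⟩
  obtain ⟨γ₀, h₀⟩ := exists_mem_lattice m
  have hψm : symmChar ψ₀₀ s m ≠ 1 := by
    rw [hm, symmChar_apply, trace_mul_symProd hs, Matrix.mulVec_smul, dotProduct_smul]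
    convert ht using 2
    simp only [smul_eq_mul]
    field_simp
  refine ⟨γ₀, fun γ hγ => twist_eq_zero _ (lattice_mono hγ h₀) hψm fun n => ?_⟩
  refine smoothFunctions_apply_eq hq (mul_inv_mem_klingen_of_low (a := 1) ?_ ?_)
  · rw [lowL_mul_unip, one_smul]
  · rw [lowR_mul_unip, lowL_mul_unip, lowL_cell, one_smul]
    ext j
    have : ∑ i, h.1 0 i * u i = 0 := by simp [hu]; ring
    have h3 : (h.1 * m.1) 0 j = 0 := by
      rw [Fin.sum_univ_two] at this
      rw [Matrix.mul_apply, hm]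
      simp only [symProd_apply, Fin.sum_univ_two, Pi.smul_apply, smul_eq_mul]
      linear_combination (2 * (t / (2 * (u ⬝ᵥ s.mulVec u))) * u j) * this
    rw [Matrix.add_apply, h3, zero_add]

/-- For fixed `n`, all the elements `cell h n` define the same plane. -/
theorem twist_siegel_cell (ψ : AddChar (symmMat k) ℂ) (γ : (ValueGroupWithZero k)ˣ)
    {p : GSp4 k → ℂ} (hp : p ∈ smoothFunctions (siegelParabolic k)) (h h' : GL (Fin 2) k) :
    twist ψ γ p (cell h 0) = twist ψ γ p (cell h' 0) := by
  unfold twist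
  congr 1
  ext n
  rw [smoothFunctions_apply_eq hp (mul_inv_mem_siegel_of_low (g := cell h' 0 * unip n)
    (g' := cell h 0 * unip n) (X := (h * h'⁻¹).1) ?_ ?_)]
  · rw [lowL_mul_unip, lowL_mul_unip, lowL_cell, lowL_cell, ← Units.val_mul, inv_mul_cancel_right]
  · rw [cell_mul_unip, cell_mul_unip, lowR_cell, lowR_cell, ← Matrix.mul_assoc, ← Units.val_mul,
      inv_mul_cancel_right]

/-- Lower and upper unipotent translates move any line off the isotropic lines of `s`. -/
theorem exists_frequently_not_isotropic {s : Matrix (Fin 2) (Fin 2) k} (hs : s.IsSymm)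
    (h2 : (2 : k) ≠ 0) (hs_det : s.det ≠ 0) (h : GL (Fin 2) k) : ∀ U ∈ nhds h,
      ∃ h' ∈ U, ![h'.1 0 1, -h'.1 0 0] ⬝ᵥ s.mulVec ![h'.1 0 1, -h'.1 0 0] ≠ 0 := by
  intro U hU
  have h10 : s 1 0 = s 0 1 := hs.apply 0 1
  -- Along a one-parameter unipotent group the form is a quadratic polynomial in `x` with linear
  -- coefficient `2 * α`. If `α` vanished for both the lower and the upper group at an isotropic
  -- line, `s` or `h` would be singular.
  obtain ⟨E, hE, hE1, α, β, hα, hEf⟩ : ∃ E : k → GL (Fin 2) k, Continuous E ∧ E 0 = h ∧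
      ∃ α β : k, (![h.1 0 1, -h.1 0 0] ⬝ᵥ s.mulVec ![h.1 0 1, -h.1 0 0] = 0 → α ≠ 0) ∧
      ∀ x, ![(E x).1 0 1, -(E x).1 0 0] ⬝ᵥ s.mulVec ![(E x).1 0 1, -(E x).1 0 0] =
        ![h.1 0 1, -h.1 0 0] ⬝ᵥ s.mulVec ![h.1 0 1, -h.1 0 0] + 2 * α * x + β * x ^ 2 := by
    by_cases hc : h.1 0 1 * (h.1 0 1 * s 0 1 - h.1 0 0 * s 1 1) = 0
    · refine ⟨fun x => h * (swapGL k * lowerGL x * swapGL k), ?_, ?_,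
        h.1 0 0 * (h.1 0 1 * s 0 0 - h.1 0 0 * s 0 1), h.1 0 0 ^ 2 * s 0 0, ?_, ?_⟩
      · exact continuous_const.mul ((continuous_const.mul continuous_lowerGL).mul continuous_const)
      · apply Units.ext
        ext i j
        fin_cases i <;> fin_cases j <;> simp [swapGL, lowerGL, ← Matrix.one_fin_two]
      · intro hz ha
        simp [dotProduct, Matrix.mulVec, h10] at hz
        have hdet := det_ne_zero_GL h
        rw [Matrix.det_fin_two] at hdet hs_det
        rw [h10] at hs_det
        rcases mul_eq_zero.1 hc with hb | hb
        · have ha' : h.1 0 0 ≠ 0 := by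
            intro h0
            exact hdet (by rw [h0, hb]; ring)
          have e1 := (mul_eq_zero.1 ha).resolve_left ha'
          rw [hb] at e1 hz
          have e2 : s 0 1 = 0 := by simpa [ha'] using e1
          have e3 : s 1 1 = 0 := by simpa [ha'] using hz
          exact hs_det (by rw [e2, e3]; ring)
        · rcases mul_eq_zero.1 ha with ha' | ha'
          · have hb' : h.1 0 1 ≠ 0 := by
              intro h0
              exact hdet (by rw [h0, ha']; ring)
            rw [ha'] at hb hz
            have e2 : s 0 1 = 0 := by simpa [hb'] using hb
            have e3 : s 0 0 = 0 := by simpa [hb'] using hz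
            exact hs_det (by rw [e2, e3]; ring)
          · have e1 : h.1 0 1 * (s 0 0 * s 1 1 - s 0 1 * s 0 1) = 0 := by
              linear_combination s 1 1 * ha' - s 0 1 * hb
            have e2 : h.1 0 0 * (s 0 0 * s 1 1 - s 0 1 * s 0 1) = 0 := by
              linear_combination s 0 1 * ha' - s 0 0 * hb
            have e3 := (mul_eq_zero.1 e1).resolve_right hs_det
            have e4 := (mul_eq_zero.1 e2).resolve_right hs_det
            exact hdet (by rw [e3, e4]; ring)
      · intro x
        simp [swapGL, lowerGL, Matrix.mul_apply, dotProduct, Matrix.mulVec, h10]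
        ring
    · refine ⟨fun x => h * lowerGL x, continuous_const.mul continuous_lowerGL, ?_,
        -(h.1 0 1 * (h.1 0 1 * s 0 1 - h.1 0 0 * s 1 1)), h.1 0 1 ^ 2 * s 1 1,
        fun _ => neg_ne_zero.2 hc, ?_⟩
      · apply Units.ext
        ext i j
        fin_cases i <;> fin_cases j <;> simp [lowerGL, ← Matrix.one_fin_two]
      · intro x
        simp [lowerGL, Matrix.mul_apply, dotProduct, Matrix.mulVec, h10]
        ring
  by_cases hz : ![h.1 0 1, -h.1 0 0] ⬝ᵥ s.mulVec ![h.1 0 1, -h.1 0 0] = 0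
  · have hα := hα hz
    have hU' : E ⁻¹' U ∈ nhds (0 : k) := hE.continuousAt.preimage_mem_nhds (by rwa [hE1])
    have hV : {x : k | 2 * α + β * x ≠ 0} ∈ nhds (0 : k) := by
      refine IsOpen.mem_nhds (isOpen_compl_singleton.preimage (by fun_prop :
        Continuous fun x : k => 2 * α + β * x)) ?_
      change 2 * α + β * 0 ≠ 0
      rw [mul_zero, add_zero]
      exact mul_ne_zero h2 hα
    obtain ⟨x, ⟨hx1, hx2⟩, hx0⟩ := Filter.nonempty_of_mem (Filter.inter_mem
      (mem_nhdsWithin_of_mem_nhds (Filter.inter_mem hU' hV))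
      (self_mem_nhdsWithin : ({0}ᶜ : Set k) ∈ nhdsWithin (0 : k) {0}ᶜ))
    refine ⟨E x, hx1, ?_⟩
    rw [hEf, hz]
    have : 0 + 2 * α * x + β * x ^ 2 = (2 * α + β * x) * x := by ring
    rw [this]
    exact mul_ne_zero hx2 hx0
  · exact ⟨h, mem_of_mem_nhds hU, hz⟩

/-- A function on the open cell dies in the twisted Jacquet module of the Steinberg representation
exactly if its integral over `N` is constant on the projective line. -/
theorem mem_sup_twistSpan_iff (h2 : (2 : k) ≠ 0) {ψ₀₀ : AddChar k ℂ}
    (hψ : Continuous ψ₀₀) (hψ_ne : ψ₀₀ ≠ 1) {s : Matrix (Fin 2) (Fin 2) k} (hs : s.IsSymm)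
    (hs_det : s.det ≠ 0) {φ : GSp4 k → ℂ} (hφ : φ ∈ cellFunctions k) :
    φ ∈ twistSpan (symmChar ψ₀₀ s) ⊔
      (smoothFunctions (siegelParabolic k) ⊔ smoothFunctions (klingenParabolic k)) ↔
      ∃ c, ∀ h, cellIntegral (symmChar ψ₀₀ s) φ h = c := by
  have hψc := continuous_symmChar hψ s
  constructor
  · intro hmem
    obtain ⟨j, hj, r, hr, hjr⟩ := Submodule.mem_sup.1 hmem
    obtain ⟨p, hp, q, hq, rfl⟩ := Submodule.mem_sup.1 hr
    obtain ⟨γ₁, h₁⟩ := exists_forall_twist_eq_zero hψc hj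
    obtain ⟨γ₂, -, h₂⟩ := exists_forall_cellIntegral_eq (symmChar ψ₀₀ s) hφ
    have hp' := smoothFunctions_anti borel_le_siegel hp
    have hq' := smoothFunctions_anti borel_le_klingen hq
    -- Over a large lattice `j` and `q` contribute nothing at these lines, and the contribution of
    -- `p` is the same for all lines.
    have hgood : ∀ h h' : GL (Fin 2) k,
        ![h.1 0 1, -h.1 0 0] ⬝ᵥ s.mulVec ![h.1 0 1, -h.1 0 0] ≠ 0 →
        ![h'.1 0 1, -h'.1 0 0] ⬝ᵥ s.mulVec ![h'.1 0 1, -h'.1 0 0] ≠ 0 →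
        cellIntegral (symmChar ψ₀₀ s) φ h = cellIntegral (symmChar ψ₀₀ s) φ h' := by
      intro h h' hh hh'
      obtain ⟨γ₃, h₃⟩ := exists_forall_twist_klingen_eq_zero h2 hψ_ne hs hh hq
      obtain ⟨γ₄, h₄⟩ := exists_forall_twist_klingen_eq_zero h2 hψ_ne hs hh' hq
      obtain ⟨γ, g₁, g₂, g₃, g₄⟩ : ∃ γ, γ₁ ≤ γ ∧ γ₂ ≤ γ ∧ γ₃ ≤ γ ∧ γ₄ ≤ γ :=
        ⟨max (max γ₁ γ₂) (max γ₃ γ₄), by simp, by simp, by simp, by simp⟩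
      rw [h₂ γ g₂, h₂ γ g₂, ← hjr, twist_add hψc (twistSpan_le _ hj) (Submodule.add_mem _ hp' hq'),
        twist_add hψc hp' hq', twist_add hψc (twistSpan_le _ hj) (Submodule.add_mem _ hp' hq'),
        twist_add hψc hp' hq', h₁ γ g₁, h₁ γ g₁, h₃ γ g₃, h₄ γ g₄, twist_siegel_cell _ _ hp h h']
    obtain ⟨h₀, -, hh₀⟩ := exists_frequently_not_isotropic hs h2 hs_det 1 _ Filter.univ_mem
    refine ⟨cellIntegral (symmChar ψ₀₀ s) φ h₀, fun h => ?_⟩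
    -- Density of the non-isotropic lines and local constancy of the integral extend the equality to
    -- every line.
    obtain ⟨h', hh', hgd⟩ := exists_frequently_not_isotropic hs h2 hs_det h _
      ((cellIntegral_mem hφ).1.eventually_eq h)
    have e : cellIntegral (symmChar ψ₀₀ s) φ h' = cellIntegral (symmChar ψ₀₀ s) φ h := hh'
    rw [← e, hgood h' h₀ hgd hh₀]
  · rintro ⟨c, hc⟩
    obtain ⟨γ, hγ⟩ := exists_lattice_symmChar_eq_one hψ s
    obtain ⟨μ, hμ⟩ : ∃ μ : ℂ, μ = (Measure.addHaar : Measure (symmMat k)).real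
      (lattice k γ : Set (symmMat k)) := ⟨_, rfl⟩
    have hμ0 : μ ≠ 0 := by
      rw [hμ]
      exact_mod_cast measureReal_lattice_ne_zero γ
    have h1 : (fun _ : GL (Fin 2) k => c / μ) ∈ rowFunctions k :=
      ⟨IsLocallyConstant.const _, fun _ _ _ => rfl⟩
    have h3 := cellExtend_mem γ h1
    -- The subtracted function comes from `P \ G`; division by the volume `μ` makes its integral
    -- equal to `c`.
    have h4 : φ - cellExtend γ (fun _ => c / μ) ∈ twistSpan (symmChar ψ₀₀ s) := by
      refine mem_twistSpan_of_cellIntegral_eq_zero ⟨γ, hγ⟩ (Submodule.sub_mem _ hφ h3) fun h => ?_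
      rw [sub_eq_add_neg, ← neg_one_smul ℂ, cellIntegral_add hψc hφ (Submodule.smul_mem _ _ h3),
        cellIntegral_smul, hc, cellIntegral_cellExtend hγ, ← hμ]
      field_simp
      ring
    exact Submodule.mem_sup.2 ⟨_, h4, _, Submodule.mem_sup_left (cellExtend_const_mem γ (c / μ)),
      sub_add_cancel _ _⟩

end Kernel

/-! ### The Levi action on `N` preserves Haar measure -/

section Modulus
open ValuativeRel MeasureTheory
open scoped NNReal

variable {k : Type*} [Field k]

/-- A character of `GL₂` with values in `ℝ≥0` that is trivial on scalars is trivial. -/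
theorem monoidHom_GL_eq_one {x : k} (hx : x ≠ 0) (hx1 : x ≠ 1) (δ : GL (Fin 2) k →* ℝ≥0)
    (hδ : ∀ (a : k) (ha : a ≠ 0), δ (toGL ⟨!![a, 0; 0, a], by simp [Matrix.det_fin_two, ha]⟩) = 1)
    (g : GL (Fin 2) k) : δ g = 1 := by
  have hone : ∀ g : GL (Fin 2) k, δ g ≠ 0 := fun g h => by
    have := map_mul δ g g⁻¹
    rw [mul_inv_cancel, map_one, h, zero_mul] at this
    exact one_ne_zero this
  have hconj : ∀ g h : GL (Fin 2) k, δ (g * h * g⁻¹) = δ h := fun g h => by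
    rw [map_mul, map_mul, mul_comm (δ g), mul_assoc, ← map_mul, mul_inv_cancel, map_one, mul_one]
  suffices H : ∀ (M : Matrix (Fin 2) (Fin 2) k) (hM : M.det ≠ 0), δ (toGL ⟨M, hM⟩) = 1 by
    have := H g.1 (det_ne_zero_GL g)
    rwa [show toGL ⟨g.1, det_ne_zero_GL g⟩ = g from Units.ext rfl] at this
  intro M hM
  refine Matrix.diagonal_transvection_induction_of_det_ne_zero
    (fun M => ∀ hM : M.det ≠ 0, δ (toGL ⟨M, hM⟩) = 1) M hM ?_ ?_ ?_ hM
  · intro D hD _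
    have hD' : D 0 ≠ 0 ∧ D 1 ≠ 0 := by
      simpa [Matrix.det_diagonal, mul_ne_zero_iff] using hD
    -- The product of a diagonal matrix and its conjugate by `swapGL` is scalar, so `δ` has square
    -- `1` on it, and `1` is the only square root of `1` in `ℝ≥0`.
    have h1 : toGL ⟨Matrix.diagonal D, hD⟩ *
        (swapGL k * toGL ⟨Matrix.diagonal D, hD⟩ * (swapGL k)⁻¹) =
        toGL ⟨!![D 0 * D 1, 0; 0, D 0 * D 1], by simp [Matrix.det_fin_two, hD']⟩ := by
      have hs : (swapGL k)⁻¹ = swapGL k := rfl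
      have hdiag : Matrix.diagonal D = !![D 0, 0; 0, D 1] := by
        ext i j
        fin_cases i <;> fin_cases j <;> rfl
      rw [hs]
      apply Units.ext
      simp only [Units.val_mul, coe_toGL, hdiag]
      ext i j
      fin_cases i <;> fin_cases j <;> simp [swapGL, Matrix.mul_apply, mul_comm]
    have h2 := congrArg δ h1
    rw [map_mul, hconj, hδ _ (mul_ne_zero hD'.1 hD'.2)] at h2
    rw [← pow_two] at h2
    exact (pow_eq_one_iff_of_nonneg zero_le two_ne_zero).1 h2
  · intro t _
    obtain ⟨i, j, hij, c⟩ := t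
    have hdet : ∀ c : k, (Matrix.transvection i j c).det ≠ 0 := fun c => by
      rw [Matrix.det_transvection_of_ne i j hij]; exact one_ne_zero
    obtain ⟨D, hDi, hDj, hDd⟩ : ∃ D : Fin 2 → k, D i = x ∧ D j = 1 ∧ (Matrix.diagonal D).det ≠ 0 := by
      refine ⟨fun l => if l = i then x else 1, by simp, by simp [hij.symm], ?_⟩
      rw [Matrix.det_diagonal, Finset.prod_ne_zero_iff]
      intro l _
      split_ifs
      · exact hx
      · exact one_ne_zero
    -- Conjugation by a diagonal matrix with entries `x` and `1` scales the parameter of a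
    -- transvection by `x`. Hence `δ` is trivial at the parameter `(x - 1) * c`, which is arbitrary
    -- since `x ≠ 1`.
    have h1 : ∀ c : k, δ (toGL ⟨_, hdet (x * c)⟩) = δ (toGL ⟨_, hdet c⟩) := by
      intro c
      rw [← hconj (toGL ⟨_, hDd⟩) (toGL ⟨_, hdet c⟩)]
      congr 1
      rw [eq_mul_inv_iff_mul_eq]
      apply Units.ext
      simp only [Units.val_mul, coe_toGL]
      ext a b
      simp only [Matrix.transvection, Matrix.add_apply, Matrix.one_apply, Matrix.mul_diagonal, Matrix.diagonal_mul, Matrix.single_apply]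
      by_cases hab : i = a ∧ j = b
      · obtain ⟨rfl, rfl⟩ := hab
        simp [hDi, hDj, hij]
      · by_cases h : a = b
        · subst h
          simp [hab]
        · simp [hab, h]
    have h2 : ∀ c : k, δ (toGL ⟨_, hdet ((x - 1) * c)⟩) = 1 := by
      intro c
      have h3 : toGL ⟨_, hdet (x * c)⟩ = toGL ⟨_, hdet ((x - 1) * c)⟩ * toGL ⟨_, hdet c⟩ := by
        apply Units.ext
        simp only [Units.val_mul, coe_toGL]
        rw [Matrix.transvection_mul_transvection_same i j hij]
        congr 1
        ring
      have h4 := h1 c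
      rw [h3, map_mul] at h4
      exact mul_right_cancel₀ (hone _) (h4.trans (one_mul _).symm)
    have h5 := h2 (c / (x - 1))
    have h6 : (x - 1) * (c / (x - 1)) = c := mul_div_cancel₀ _ (sub_ne_zero.2 hx1)
    simp only [h6] at h5
    exact h5
  · intro A B hA hB h1 h2 hAB
    rw [show toGL ⟨A * B, hAB⟩ = toGL ⟨A, hA⟩ * toGL ⟨B, hB⟩ from Units.ext rfl, map_mul, h1, h2,
      mul_one]

/-- Conjugation of `N` by the Levi subgroup, `n ↦ det t • t⁻¹ n ᵗt⁻¹`. -/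
def conjSymm (t : GL (Fin 2) k) (n : symmMat k) : symmMat k :=
  ⟨t.1.det • ((t⁻¹).1 * n.1 * (t⁻¹).1ᵀ), by
    change (_ • _)ᵀ = _
    rw [Matrix.transpose_smul, Matrix.transpose_mul, Matrix.transpose_mul, Matrix.transpose_transpose,
      symmMat_transpose, Matrix.mul_assoc]⟩

theorem conjSymm_one (n : symmMat k) : conjSymm 1 n = n := by
  apply Subtype.ext
  simp [conjSymm]

theorem conjSymm_mul (t t' : GL (Fin 2) k) (n : symmMat k) :
    conjSymm (t * t') n = conjSymm t' (conjSymm t n) := by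
  apply Subtype.ext
  simp only [conjSymm, mul_inv_rev, Units.val_mul, Matrix.det_mul, Matrix.transpose_mul,
    Matrix.mul_smul, Matrix.smul_mul, smul_smul, Matrix.mul_assoc]
  rw [mul_comm]

theorem conjSymm_add (t : GL (Fin 2) k) (m n : symmMat k) :
    conjSymm t (m + n) = conjSymm t m + conjSymm t n := by
  apply Subtype.ext
  simp [conjSymm, Matrix.mul_add, Matrix.add_mul]

theorem cell_mul_leviEmb (h t : GL (Fin 2) k) (n : symmMat k) :
    cell h n * leviEmb t = cell (h * t) (conjSymm t n) := by
  have key : unip n * leviEmb t = leviEmb t * unip (conjSymm t n) := by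
    apply mat_injective
    have h1 : t.1 * (t⁻¹).1 = 1 := Units.mul_inv t
    simp only [mat_mul, mat_unip, mat_leviEmb, Matrix.fromBlocks_multiply, conjSymm,
      Matrix.mul_smul, ← Matrix.mul_assoc, h1, Matrix.one_mul, Matrix.zero_mul, Matrix.mul_zero,
      add_zero, zero_add, smul_zero, Matrix.mul_one]
  rw [cell, cell, mul_assoc, key, map_mul]
  simp only [mul_assoc]

variable [TopologicalSpace k] [IsTopologicalRing k]

theorem continuous_conjSymm (t : GL (Fin 2) k) : Continuous (conjSymm t) := by
  refine Continuous.subtype_mk ?_ _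
  have h : Continuous fun n : symmMat k => (t⁻¹).1 * n.1 * (t⁻¹).1ᵀ :=
    (continuous_const.matrix_mul continuous_subtype_val).matrix_mul continuous_const
  exact h.const_smul t.1.det

/-- `conjSymm` as a topological isomorphism. -/
def conjEquiv (t : GL (Fin 2) k) : symmMat k ≃ₜ+ symmMat k where
  toFun := conjSymm t
  invFun := conjSymm t⁻¹
  left_inv n := by rw [← conjSymm_mul, mul_inv_cancel, conjSymm_one]
  right_inv n := by rw [← conjSymm_mul, inv_mul_cancel, conjSymm_one]
  map_add' := conjSymm_add t
  continuous_toFun := continuous_conjSymm t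
  continuous_invFun := continuous_conjSymm t⁻¹

variable [ValuativeRel k] [IsNonarchimedeanLocalField k]

/-- The modulus is a character of `GL₂`, trivial on scalars because `det = a²` cancels the two
factors `a⁻¹`. This is why `T_s` acts on functions on the projective line without a modulus factor.
-/
theorem addEquivAddHaarChar_conjEquiv (t : GL (Fin 2) k) :
    addEquivAddHaarChar (conjEquiv t) = 1 := by
  obtain ⟨x, hx, hx1⟩ := exists_valuation_lt_one (k := k)
  let δ : GL (Fin 2) k →* ℝ≥0 :=
    { toFun t := addEquivAddHaarChar (conjEquiv t)
      map_one' := by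
        rw [← addEquivAddHaarChar_refl (G := symmMat k)]
        congr 1
        ext1 n
        exact conjSymm_one n
      map_mul' t t' := by
        rw [← addEquivAddHaarChar_trans]
        congr 1
        ext1 n
        exact (congrArg (fun u => conjSymm u n) rfl).trans (conjSymm_mul t t' n) }
  refine monoidHom_GL_eq_one hx (by rintro rfl; simp at hx1) δ (fun a ha => ?_) t
  have hd : (!![a, 0; 0, a] : Matrix (Fin 2) (Fin 2) k).det ≠ 0 := by simp [Matrix.det_fin_two, ha]
  have hrefl : conjEquiv (toGL ⟨!![a, 0; 0, a], hd⟩) = ContinuousAddEquiv.refl (symmMat k) := by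
    ext1 n
    apply Subtype.ext
    change (toGL ⟨!![a, 0; 0, a], hd⟩).1.det • ((toGL ⟨!![a, 0; 0, a], hd⟩)⁻¹.1 * n.1 *
      (toGL ⟨!![a, 0; 0, a], hd⟩)⁻¹.1ᵀ) = n.1
    have hinv : (toGL ⟨!![a, 0; 0, a], hd⟩)⁻¹.1 = a⁻¹ • (1 : Matrix (Fin 2) (Fin 2) k) := by
      rw [coe_inv_GL, coe_toGL, Matrix.adjugate_fin_two]
      ext i j
      fin_cases i <;> fin_cases j <;> simp [Matrix.det_fin_two] <;> field_simp
    rw [hinv, coe_toGL, Matrix.transpose_smul, Matrix.transpose_one, Matrix.smul_mul,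
      Matrix.mul_smul, Matrix.one_mul, Matrix.mul_one, smul_smul, smul_smul, Matrix.det_fin_two_of]
    convert one_smul k n.1 using 2
    field_simp
    ring
  change addEquivAddHaarChar (conjEquiv (toGL ⟨!![a, 0; 0, a], hd⟩)) = 1
  rw [hrefl]
  exact addEquivAddHaarChar_refl

theorem integral_conjSymm (t : GL (Fin 2) k) (F : symmMat k → ℂ) :
    ∫ n, F (conjSymm t n) ∂Measure.addHaar = ∫ n, F n ∂Measure.addHaar := by
  have h := addEquivAddHaarChar_smul_map (Measure.addHaar : Measure (symmMat k)) (conjEquiv t)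
  rw [addEquivAddHaarChar_conjEquiv, one_smul] at h
  conv_rhs => rw [← h]
  exact ((conjEquiv t).toHomeomorph.measurableEmbedding.integral_map F).symm

theorem symmChar_conjSymm (ψ₀₀ : AddChar k ℂ) {s : Matrix (Fin 2) (Fin 2) k} {t : GL (Fin 2) k}
    (ht : t ∈ besselTorus s) (n : symmMat k) :
    symmChar ψ₀₀ s (conjSymm t n) = symmChar ψ₀₀ s n := by
  have ht' : (t⁻¹).1ᵀ * s * (t⁻¹).1 = (t⁻¹).1.det • s := (besselTorus s).inv_mem ht
  have hd : t.1.det * (t⁻¹).1.det = 1 := by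
    rw [← Matrix.det_mul, Units.mul_inv, Matrix.det_one]
  rw [symmChar_apply, symmChar_apply]
  congr 1
  calc (s * (t.1.det • ((t⁻¹).1 * n.1 * (t⁻¹).1ᵀ))).trace
      = t.1.det • ((s * (t⁻¹).1 * n.1) * (t⁻¹).1ᵀ).trace := by
        rw [Matrix.mul_smul, Matrix.trace_smul]; simp only [Matrix.mul_assoc]
    _ = t.1.det • (((t⁻¹).1ᵀ * s * (t⁻¹).1) * n.1).trace := by
        rw [Matrix.trace_mul_comm]; simp only [Matrix.mul_assoc]
    _ = (s * n.1).trace := by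
        rw [ht', Matrix.smul_mul, Matrix.trace_smul, smul_smul, hd, one_smul]

/-- The substitution `n ↦ conjSymm t n` preserves Haar measure, and for `t ∈ T_s` also the
character. -/
theorem cellIntegral_translate (ψ₀₀ : AddChar k ℂ) {s : Matrix (Fin 2) (Fin 2) k}
    {t : GL (Fin 2) k} (ht : t ∈ besselTorus s) (φ : GSp4 k → ℂ) (h : GL (Fin 2) k) :
    cellIntegral (symmChar ψ₀₀ s) (fun g => φ (g * leviEmb t)) h =
      cellIntegral (symmChar ψ₀₀ s) φ (h * t) := by
  unfold cellIntegral
  conv_rhs => rw [← integral_conjSymm t]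
  congr 1
  ext n
  have hneg : -conjSymm t n = conjSymm t (-n) := by
    rw [eq_comm, eq_neg_iff_add_eq_zero, ← conjSymm_add, neg_add_cancel]
    apply Subtype.ext
    simp [conjSymm]
  change symmChar ψ₀₀ s (-n) * φ (cell h n * leviEmb t) =
    symmChar ψ₀₀ s (-conjSymm t n) * φ (cell (h * t) (conjSymm t n))
  rw [cell_mul_leviEmb, hneg, symmChar_conjSymm ψ₀₀ ht]

end Modulus

/-! ### The twisted Jacquet module as functions on the projective line modulo constants -/

section Jacquet
open ValuativeRel MeasureTheory

variable (k : Type*) [Field k] [TopologicalSpace k]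

/-- The constant functions on the projective line. -/
def rowConst : Submodule ℂ (rowFunctions k) where
  carrier := {y | ∃ c, ∀ h, y.1 h = c}
  zero_mem' := ⟨0, fun _ => rfl⟩
  add_mem' := by
    rintro a b ⟨c, hc⟩ ⟨d, hd⟩
    exact ⟨c + d, fun h => congrArg₂ (· + ·) (hc h) (hd h)⟩
  smul_mem' := by
    rintro z a ⟨c, hc⟩
    exact ⟨z • c, fun h => congrArg (z • ·) (hc h)⟩

variable {k}

theorem mem_rowConst {y : rowFunctions k} : y ∈ rowConst k ↔ ∃ c, ∀ h, y.1 h = c := Iff.rfl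

theorem twistedJacquetKer_mkQ_unipEmb {k V : Type*} [Field k] [AddCommGroup V] [Module ℂ V]
    (π : Representation ℂ (GSp4 k) V) (ψ₀₀ : AddChar k ℂ) (s : Matrix (Fin 2) (Fin 2) k)
    (n : {n : Matrix (Fin 2) (Fin 2) k // n.IsSymm}) (v : V) :
    (twistedJacquetKer π ψ₀₀ s).mkQ (π (unipEmb n) v) =
      unipChar ψ₀₀ s n • (twistedJacquetKer π ψ₀₀ s).mkQ v := by
  rw [← sub_eq_zero, ← map_smul, ← map_sub]
  exact (Submodule.Quotient.mk_eq_zero _).2 (Submodule.subset_span ⟨n, v, rfl⟩)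

/-- Taking `x = 1` shows that a Bessel functional factors through the twisted Jacquet module; taking
`n = 0` gives its equivariance there. -/
theorem hasBesselModel_iff {k V : Type*} [Field k] [AddCommGroup V] [Module ℂ V]
    {K : Type*} [CommRing K] [Algebra k K] (π : Representation ℂ (GSp4 k) V) (ψ₀₀ : AddChar k ℂ)
    (s : Matrix (Fin 2) (Fin 2) k) (ι : K →ₐ[k] Matrix (Fin 2) (Fin 2) k)
    (hT : ∀ x : Kˣ, unitsEmb ι x ∈ besselTorus s) (χ : Kˣ →* ℂˣ) :
    HasBesselModel π ψ₀₀ s ι χ ↔ ∃ l : (V ⧸ twistedJacquetKer π ψ₀₀ s) →ₗ[ℂ] ℂ, l ≠ 0 ∧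
      ∀ x v, l (twistedJacquet π ψ₀₀ s ⟨_, hT x⟩ v) = χ x * l v := by
  have hun : unipEmb (⟨0, Matrix.isSymm_zero⟩ : {n : Matrix (Fin 2) (Fin 2) k // n.IsSymm}) = 1 :=
    unip_zero
  have hch : unipChar ψ₀₀ s ⟨0, Matrix.isSymm_zero⟩ = 1 := by
    simp [unipChar]
  have hJ : ∀ (x : Kˣ) v, (twistedJacquet π ψ₀₀ s ⟨_, hT x⟩)
      ((twistedJacquetKer π ψ₀₀ s).mkQ v) =
      (twistedJacquetKer π ψ₀₀ s).mkQ (π (leviEmb (unitsEmb ι x)) v) :=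
    fun x v => rfl
  rw [HasBesselModel, Submodule.ne_bot_iff]
  constructor
  · rintro ⟨l, hl, hl0⟩
    have hl' : ∀ (x : Kˣ) (n : {n : Matrix (Fin 2) (Fin 2) k // n.IsSymm}) (v : V),
      l (π (leviEmb (unitsEmb ι x) * unipEmb n) v) = (χ x : ℂ) * unipChar ψ₀₀ s n * l v := hl
    have hker : twistedJacquetKer π ψ₀₀ s ≤ LinearMap.ker l := by
      refine Submodule.span_le.2 ?_
      rintro _ ⟨n, v, rfl⟩
      have := hl' 1 n v
      rw [map_one, map_one, one_mul, map_one, Units.val_one, one_mul] at this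
      change l _ = 0
      rw [map_sub, this, map_smul, smul_eq_mul, sub_self]
    refine ⟨(twistedJacquetKer π ψ₀₀ s).liftQ l hker, fun h0 => hl0 ?_, fun x v => ?_⟩
    · exact LinearMap.ext fun v => LinearMap.congr_fun h0 ((twistedJacquetKer π ψ₀₀ s).mkQ v)
    · obtain ⟨v, rfl⟩ := Submodule.mkQ_surjective _ v
      have := hl' x ⟨0, Matrix.isSymm_zero⟩ v
      rw [hun, hch, mul_one, mul_one] at this
      rw [hJ]
      exact this
  · rintro ⟨l, hl0, hl⟩
    refine ⟨l ∘ₗ (twistedJacquetKer π ψ₀₀ s).mkQ, fun x n v => ?_, fun h0 => hl0 ?_⟩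
    · rw [LinearMap.comp_apply, map_mul, Module.End.mul_apply, ← hJ, hl, mul_assoc,
        twistedJacquetKer_mkQ_unipEmb, map_smul, smul_eq_mul, LinearMap.comp_apply]
    · refine LinearMap.ext fun v => ?_
      obtain ⟨v, rfl⟩ := Submodule.mkQ_surjective _ v
      exact LinearMap.congr_fun h0 v

/-- The composite quotient map onto the twisted Jacquet module of the Steinberg representation. -/
def jacquetMk [IsTopologicalRing k] (ψ₀₀ : AddChar k ℂ) (s : Matrix (Fin 2) (Fin 2) k) :
    smoothFunctions (borel k) →ₗ[ℂ]
      SteinbergSpace k ⧸ twistedJacquetKer (steinberg k) ψ₀₀ s :=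
  (twistedJacquetKer (steinberg k) ψ₀₀ s).mkQ ∘ₗ (steinbergKer k).mkQ

theorem jacquetMk_surjective [IsTopologicalRing k] (ψ₀₀ : AddChar k ℂ)
    (s : Matrix (Fin 2) (Fin 2) k) : Function.Surjective (jacquetMk ψ₀₀ s) :=
  (Submodule.mkQ_surjective _).comp (Submodule.mkQ_surjective _)

theorem steinberg_mk [IsTopologicalRing k] (g : GSp4 k) (f : smoothFunctions (borel k)) :
    steinberg k g ((steinbergKer k).mkQ f) =
      (steinbergKer k).mkQ ⟨fun x => f.1 (x * g), smoothFunctions_translate f.2 g⟩ := rfl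

variable [ValuativeRel k] [IsNonarchimedeanLocalField k]

/-- The two successive quotients amount to one quotient by the sum, since the generators of the
kernel on the Steinberg space lift to generators of `twistSpan`. -/
theorem jacquetMk_eq_zero_iff (ψ₀₀ : AddChar k ℂ)
    (s : Matrix (Fin 2) (Fin 2) k) (f : smoothFunctions (borel k)) :
    jacquetMk ψ₀₀ s f = 0 ↔ f.1 ∈ twistSpan (symmChar ψ₀₀ s) ⊔
      (smoothFunctions (siegelParabolic k) ⊔ smoothFunctions (klingenParabolic k)) := by
  change Submodule.Quotient.mk _ = _ ↔ _
  rw [Submodule.Quotient.mk_eq_zero]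
  constructor
  · intro h
    have key : ∀ v ∈ twistedJacquetKer (steinberg k) ψ₀₀ s, ∀ f : smoothFunctions (borel k),
        (steinbergKer k).mkQ f = v → f.1 ∈ twistSpan (symmChar ψ₀₀ s) ⊔
          (smoothFunctions (siegelParabolic k) ⊔ smoothFunctions (klingenParabolic k)) := by
      intro v hv
      induction hv using Submodule.span_induction with
      | mem v hv =>
        obtain ⟨n, w, rfl⟩ := hv
        obtain ⟨f', rfl⟩ := Submodule.mkQ_surjective _ w
        intro f hf
        rw [steinberg_mk, ← map_smul, ← map_sub] at hf
        have h1 := (Submodule.Quotient.eq _).1 hf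
        have h2 : f.1 - ((fun x => f'.1 (x * unip ⟨n.1, n.2⟩)) - symmChar ψ₀₀ s ⟨n.1, n.2⟩ • f'.1) ∈
            smoothFunctions (siegelParabolic k) ⊔ smoothFunctions (klingenParabolic k) := h1
        rw [← sub_add_cancel f.1
          ((fun x => f'.1 (x * unip ⟨n.1, n.2⟩)) - symmChar ψ₀₀ s ⟨n.1, n.2⟩ • f'.1)]
        exact Submodule.add_mem _ (Submodule.mem_sup_right h2)
          (Submodule.mem_sup_left (Submodule.subset_span ⟨_, _, f'.2, rfl⟩))
      | zero =>
        intro f hf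
        exact Submodule.mem_sup_right ((Submodule.Quotient.mk_eq_zero (steinbergKer k)).1 hf)
      | add v w _ _ hv hw =>
        intro f hf
        obtain ⟨v', rfl⟩ := Submodule.mkQ_surjective _ v
        have := Submodule.add_mem _ (hv v' rfl) (hw (f - v') (by rw [map_sub, hf, add_sub_cancel_left]))
        rwa [show v'.1 + (f - v').1 = f.1 from add_sub_cancel _ _] at this
      | smul c v _ hv =>
        intro f hf
        by_cases hc : c = 0
        · rw [hc, zero_smul] at hf
          exact Submodule.mem_sup_right ((Submodule.Quotient.mk_eq_zero (steinbergKer k)).1 hf)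
        · have := Submodule.smul_mem _ c (hv (c⁻¹ • f) (by rw [map_smul, hf, inv_smul_smul₀ hc]))
          rwa [show c • (c⁻¹ • f).1 = f.1 from smul_inv_smul₀ hc f.1] at this
    exact key _ h f rfl
  · intro h
    obtain ⟨j, hj, r, hr, hjr⟩ := Submodule.mem_sup.1 h
    have key : ∀ (j : GSp4 k → ℂ) (hj : j ∈ twistSpan (symmChar ψ₀₀ s)),
        (steinbergKer k).mkQ ⟨j, twistSpan_le _ hj⟩ ∈ twistedJacquetKer (steinberg k) ψ₀₀ s := by
      intro j hj
      induction hj using Submodule.span_induction with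
      | mem j hj =>
        obtain ⟨n, f', hf', rfl⟩ := hj
        refine Submodule.subset_span ⟨⟨n.1, n.2⟩, (steinbergKer k).mkQ ⟨f', hf'⟩, ?_⟩
        rw [steinberg_mk, ← map_smul, ← map_sub]
        rfl
      | zero => exact Submodule.zero_mem _
      | add v w hv hw h1 h2 => exact Submodule.add_mem _ h1 h2
      | smul c v hv h1 => exact Submodule.smul_mem _ c h1
    have h3 : (steinbergKer k).mkQ f = (steinbergKer k).mkQ ⟨j, twistSpan_le _ hj⟩ := by
      refine (Submodule.Quotient.eq _).2 ?_
      change f.1 - j ∈ smoothFunctions (siegelParabolic k) ⊔ smoothFunctions (klingenParabolic k)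
      rwa [← hjr, add_sub_cancel_left]
    exact h3 ▸ key j hj

theorem exists_linearEquiv_of_ker_eq {M V W : Type*} [AddCommGroup M] [Module ℂ M] [AddCommGroup V]
    [Module ℂ V] [AddCommGroup W] [Module ℂ W] {A : M →ₗ[ℂ] V} {B : M →ₗ[ℂ] W}
    (hA : Function.Surjective A) (hB : Function.Surjective B)
    (h : LinearMap.ker A = LinearMap.ker B) : ∃ E : V ≃ₗ[ℂ] W, ∀ m, E (A m) = B m := by
  refine ⟨(A.quotKerEquivOfSurjective hA).symm ≪≫ₗ Submodule.quotEquivOfEq _ _ h ≪≫ₗ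
    B.quotKerEquivOfSurjective hB, fun m => ?_⟩
  have h1 : (A.quotKerEquivOfSurjective hA).symm (A m) = Submodule.Quotient.mk m := by
    rw [LinearEquiv.symm_apply_eq]; rfl
  rw [LinearEquiv.trans_apply, LinearEquiv.trans_apply, h1]
  rfl

set_option maxHeartbeats 1000000 in
/-- The twisted Jacquet module of the Steinberg representation is the space of locally constant
functions on the projective line modulo constants. -/
theorem exists_twistedJacquet_equiv (h2 : (2 : k) ≠ 0) {ψ₀₀ : AddChar k ℂ}
    (hψ : Continuous ψ₀₀) (hψ_ne : ψ₀₀ ≠ 1) {s : Matrix (Fin 2) (Fin 2) k} (hs : s.IsSymm)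
    (hs_det : s.det ≠ 0) :
    ∃ E : (SteinbergSpace k ⧸ twistedJacquetKer (steinberg k) ψ₀₀ s) ≃ₗ[ℂ]
        (rowFunctions k ⧸ rowConst k),
      ∀ (t : besselTorus s) (v) (y y' : rowFunctions k), E v = (rowConst k).mkQ y →
        (∀ h, y'.1 h = y.1 (h * t)) →
        E (twistedJacquet (steinberg k) ψ₀₀ s t v) = (rowConst k).mkQ y' := by
  have hψc := continuous_symmChar hψ s
  let A : cellFunctions k →ₗ[ℂ] SteinbergSpace k ⧸ twistedJacquetKer (steinberg k) ψ₀₀ s :=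
    jacquetMk ψ₀₀ s ∘ₗ Submodule.inclusion cellFunctions_le
  let I : cellFunctions k →ₗ[ℂ] rowFunctions k :=
    { toFun φ := ⟨cellIntegral (symmChar ψ₀₀ s) φ.1, cellIntegral_mem φ.2⟩
      map_add' φ φ' := Subtype.ext (funext fun h => cellIntegral_add hψc φ.2 φ'.2 h)
      map_smul' c φ := Subtype.ext (funext fun h => cellIntegral_smul _ c φ.1 h) }
  -- Functions from `Q \ G` and elements of `twistSpan` die in the quotient, so the open cell
  -- already maps onto it.
  have hA : Function.Surjective A := by
    intro v
    obtain ⟨f, rfl⟩ := jacquetMk_surjective ψ₀₀ s v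
    obtain ⟨φ, hφ, q, hq, hmem⟩ := exists_cellFunctions_decomposition h2 hψ hψ_ne hs hs_det f.2
    refine ⟨⟨φ, hφ⟩, ?_⟩
    rw [eq_comm, ← sub_eq_zero]
    change jacquetMk ψ₀₀ s f - jacquetMk ψ₀₀ s ⟨φ, hφ.1⟩ = 0
    rw [← map_sub, jacquetMk_eq_zero_iff]
    change f.1 - φ ∈ _
    rw [← sub_add_cancel (f.1 - φ) q]
    exact Submodule.add_mem _ (Submodule.mem_sup_left hmem)
      (Submodule.mem_sup_right (Submodule.mem_sup_right hq))
  have hI : Function.Surjective I := by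
    intro y
    obtain ⟨γ, hγ⟩ := exists_lattice_symmChar_eq_one hψ s
    refine ⟨((Measure.addHaar : Measure (symmMat k)).real (lattice k γ) : ℂ)⁻¹ •
      ⟨cellExtend γ y.1, cellExtend_mem γ y.2⟩, ?_⟩
    rw [map_smul]
    apply Subtype.ext
    funext h
    change (_ : ℂ) * cellIntegral (symmChar ψ₀₀ s) (cellExtend γ y.1) h = _
    rw [cellIntegral_cellExtend hγ]
    have := measureReal_lattice_ne_zero (k := k) γ
    rw [inv_mul_cancel_left₀ (by exact_mod_cast this)]
  have hQ : Function.Surjective ((rowConst k).mkQ ∘ₗ I) := (Submodule.mkQ_surjective _).comp hI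
  have hker : LinearMap.ker A = LinearMap.ker ((rowConst k).mkQ ∘ₗ I) := by
    ext φ
    rw [LinearMap.mem_ker, LinearMap.mem_ker]
    change jacquetMk ψ₀₀ s ⟨φ.1, φ.2.1⟩ = 0 ↔ Submodule.Quotient.mk (I φ) = 0
    rw [jacquetMk_eq_zero_iff, Submodule.Quotient.mk_eq_zero, mem_rowConst]
    exact mem_sup_twistSpan_iff h2 hψ hψ_ne hs hs_det φ.2
  obtain ⟨E, hE⟩ := exists_linearEquiv_of_ker_eq hA hQ hker
  have hE : ∀ φ, E (A φ) = (rowConst k).mkQ (I φ) := hE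
  refine ⟨E, fun t v y y' hv hy' => ?_⟩
  obtain ⟨φ, rfl⟩ := hA v
  rw [hE] at hv
  obtain ⟨c, hc⟩ := (Submodule.Quotient.eq _).1 hv
  have hφt : (fun g => φ.1 (g * leviEmb t.1)) ∈ cellFunctions k :=
    ⟨smoothFunctions_translate φ.2.1 _, fun g hg => φ.2.2 _ (by
      rw [lowL_mul_leviEmb, Matrix.det_mul, hg, zero_mul])⟩
  have h3 : twistedJacquet (steinberg k) ψ₀₀ s t (A φ) = A ⟨_, hφt⟩ := rfl
  rw [h3, hE]
  refine (Submodule.Quotient.eq _).2 ⟨c, fun h => ?_⟩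
  have h4 : (I ⟨_, hφt⟩).1 h = (I φ).1 (h * t) := cellIntegral_translate ψ₀₀ t.2 φ.1 h
  exact (congrArg₂ (· - ·) h4 (hy' h)).trans (hc (h * t))

variable {K : Type*} [CommRing K] [Algebra k K]

set_option maxHeartbeats 1000000 in
/-- A Bessel model of the Steinberg representation is an equivariant functional on the functions
on the projective line that kills the constants. -/
theorem hasBesselModel_steinberg_iff (h2 : (2 : k) ≠ 0) {ψ₀₀ : AddChar k ℂ}
    (hψ : Continuous ψ₀₀) (hψ_ne : ψ₀₀ ≠ 1) {s : Matrix (Fin 2) (Fin 2) k} (hs : s.IsSymm)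
    (hs_det : s.det ≠ 0) (ι : K →ₐ[k] Matrix (Fin 2) (Fin 2) k)
    (hT : ∀ x : Kˣ, unitsEmb ι x ∈ besselTorus s) (χ : Kˣ →* ℂˣ) :
    HasBesselModel (steinberg k) ψ₀₀ s ι χ ↔
      ∃ l : rowFunctions k →ₗ[ℂ] ℂ, l ≠ 0 ∧ (∀ y ∈ rowConst k, l y = 0) ∧
        ∀ (x : Kˣ) (y y' : rowFunctions k), (∀ h, y'.1 h = y.1 (h * unitsEmb ι x)) →
          l y' = χ x * l y := by
  obtain ⟨E, hE⟩ := exists_twistedJacquet_equiv h2 hψ hψ_ne hs hs_det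
  rw [hasBesselModel_iff _ _ _ _ hT]
  constructor
  · rintro ⟨l, hl0, hl⟩
    refine ⟨l ∘ₗ E.symm.toLinearMap ∘ₗ (rowConst k).mkQ, fun h0 => hl0 ?_, fun y hy => ?_,
      fun x y y' hyy' => ?_⟩
    · refine LinearMap.ext fun v => ?_
      obtain ⟨y, hy⟩ := Submodule.mkQ_surjective _ (E v)
      have := LinearMap.congr_fun h0 y
      change l (E.symm ((rowConst k).mkQ y)) = 0 at this
      rwa [hy, E.symm_apply_apply] at this
    · change l (E.symm (Submodule.Quotient.mk y)) = 0
      rw [(Submodule.Quotient.mk_eq_zero _).2 hy, map_zero, map_zero]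
    · change l (E.symm ((rowConst k).mkQ y')) = χ x * l (E.symm ((rowConst k).mkQ y))
      rw [← hl, ← hE ⟨_, hT x⟩ (E.symm ((rowConst k).mkQ y)) y y' (E.apply_symm_apply _) hyy',
        E.symm_apply_apply]
  · rintro ⟨l, hl0, hlc, hl⟩
    obtain ⟨l₂, hl₂⟩ : ∃ l₂ : (SteinbergSpace k ⧸ twistedJacquetKer (steinberg k) ψ₀₀ s) →ₗ[ℂ] ℂ,
        ∀ v y, E v = (rowConst k).mkQ y → l₂ v = l y := by
      refine ⟨(rowConst k).liftQ l hlc ∘ₗ E.toLinearMap, fun v y h => ?_⟩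
      rw [LinearMap.comp_apply]
      exact (congrArg _ h).trans rfl
    refine ⟨l₂, fun h0 => hl0 ?_, fun x v => ?_⟩
    · refine LinearMap.ext fun y => ?_
      rw [← hl₂ _ y (E.apply_symm_apply _), h0]
      rfl
    · obtain ⟨y, hy⟩ := Submodule.mkQ_surjective _ (E v)
      rw [hl₂ v y hy.symm, hl₂ _ _ (hE ⟨_, hT x⟩ v y
        ⟨fun h => y.1 (h * unitsEmb ι x), smoothFunctions_translate y.2 _⟩ hy.symm fun _ => rfl)]
      exact hl x y _ fun _ => rfl

end Jacquet

/-! ### Gluing functions on the projective line from two charts -/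

section ProjectiveLine
open ValuativeRel

variable {k : Type*} [Field k]

theorem apply_zero_ne_zero_or (h : GL (Fin 2) k) : h.1 0 0 ≠ 0 ∨ h.1 0 1 ≠ 0 := by
  by_contra! H
  exact det_ne_zero_GL h (by rw [Matrix.det_fin_two, H.1, H.2]; ring)

theorem lowerTriangular_mul_row {t : GL (Fin 2) k} (ht : t ∈ lowerTriangular k) (h : GL (Fin 2) k) :
    (t * h).1 0 = t.1 0 0 • h.1 0 := by
  have ht : t.1 0 1 = 0 := ht
  ext j
  simp [Matrix.mul_apply, ht]

theorem lowerTriangular_apply_ne_zero {t : GL (Fin 2) k} (ht : t ∈ lowerTriangular k) :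
    t.1 0 0 ≠ 0 :=
  (apply_zero_ne_zero_or t).resolve_right fun h => h ht

variable [TopologicalSpace k]

theorem continuous_coe_GL (i j : Fin 2) : Continuous fun h : GL (Fin 2) k => h.1 i j :=
  Units.continuous_val.matrix_elem i j

/-- The function on the projective line with given restrictions to two affine charts. -/
def rowGlue (F F' : k → ℂ) (h : GL (Fin 2) k) : ℂ :=
  open scoped Classical in if h.1 0 1 = 0 then F' 0 else F (h.1 0 0 / h.1 0 1)

theorem rowGlue_mem [IsTopologicalDivisionRing k] [T1Space k] {F F' : k → ℂ}
    (hF : IsLocallyConstant F) (hF' : IsLocallyConstant F') (h : ∀ x, x ≠ 0 → F' x⁻¹ = F x) :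
    rowGlue F F' ∈ rowFunctions k := by
  have key : ∀ g : GL (Fin 2) k, g.1 0 0 ≠ 0 → rowGlue F F' g = F' (g.1 0 1 / g.1 0 0) := by
    intro g hg
    unfold rowGlue
    split_ifs with h1
    · rw [h1, zero_div]
    · rw [← h _ (div_ne_zero hg h1), inv_div]
  constructor
  · rw [IsLocallyConstant.iff_eventually_eq]
    intro g
    rcases apply_zero_ne_zero_or g with hg | hg
    · have h1 : ContinuousAt (fun g : GL (Fin 2) k => g.1 0 1 / g.1 0 0) g :=
        (continuous_coe_GL 0 1).continuousAt.div (continuous_coe_GL 0 0).continuousAt hg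
      filter_upwards [h1 (hF'.eventually_eq _),
        (continuous_coe_GL 0 0).continuousAt.eventually_ne hg] with g' h2 h3
      rw [key g hg, key g' h3]
      exact h2
    · have h1 : ContinuousAt (fun g : GL (Fin 2) k => g.1 0 0 / g.1 0 1) g :=
        (continuous_coe_GL 0 0).continuousAt.div (continuous_coe_GL 0 1).continuousAt hg
      filter_upwards [h1 (hF.eventually_eq _),
        (continuous_coe_GL 0 1).continuousAt.eventually_ne hg] with g' h2 h3
      rw [rowGlue, rowGlue, if_neg hg, if_neg h3]
      exact h2
  · intro t ht g
    have ht0 := lowerTriangular_apply_ne_zero ht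
    have hr := lowerTriangular_mul_row ht g
    have hr0 : (t * g).1 0 0 = t.1 0 0 * g.1 0 0 := congrFun hr 0
    have hr1 : (t * g).1 0 1 = t.1 0 0 * g.1 0 1 := congrFun hr 1
    unfold rowGlue
    rw [hr0, hr1, mul_div_mul_left _ _ ht0]
    by_cases hg : g.1 0 1 = 0
    · rw [if_pos (by rw [hg, mul_zero]), if_pos hg]
    · rw [if_neg (mul_ne_zero ht0 hg), if_neg hg]

variable [ValuativeRel k] [IsNonarchimedeanLocalField k]

theorem exists_isCompact_lowerTriangular_mul : ∃ C : Set (GL (Fin 2) k), IsCompact C ∧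
    ∀ g : GL (Fin 2) k, ∃ h ∈ lowerTriangular k, ∃ c ∈ C, g = h * c := by
  refine ⟨(fun t => (t * swapGL k)⁻¹) '' compactGL k,
    isCompact_compactGL.image (continuous_id.mul continuous_const).inv, fun g => ?_⟩
  obtain ⟨t, ht, h0⟩ := exists_compactGL_row (g.1 0 0) (g.1 0 1)
  refine ⟨g * (t * swapGL k), ?_, _, ⟨t, ht, rfl⟩, by group⟩
  rw [mem_lowerTriangular]
  simpa [Matrix.mul_apply, swapGL] using h0

end ProjectiveLine

/-! ### The action of `K^*` on the projective line when `K` is a field -/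

section FieldTorus
open ValuativeRel MeasureTheory

variable {k : Type*} [Field k] [ValuativeRel k] [TopologicalSpace k] [IsNonarchimedeanLocalField k]
  {K : Type*} [CommRing K] [Algebra k K] [TopologicalSpace K] [IsModuleTopology k K]

theorem continuous_unitsEmb (ι : K →ₐ[k] Matrix (Fin 2) (Fin 2) k) : Continuous (unitsEmb ι) :=
  Continuous.units_map _ (IsModuleTopology.continuous_of_linearMap ι.toLinearMap)

theorem isTopologicalRing_quadratic (k K : Type*) [Field k] [TopologicalSpace k]
    [IsTopologicalRing k] [CommRing K] [Algebra k K] [TopologicalSpace K] [IsModuleTopology k K]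
    [Algebra.IsQuadraticExtension k K] : IsTopologicalRing K := by
  have : Module.Finite k K := Module.finite_of_finrank_pos (by
    rw [Algebra.IsQuadraticExtension.finrank_eq_two]; exact two_pos)
  exact IsModuleTopology.isTopologicalRing k K

variable [Algebra.IsQuadraticExtension k K]

/-- If `K` is a field, then `K^*` acts simply transitively on nonzero rows. -/
theorem exists_rowUnit (hK : IsField K) (ι : K →ₐ[k] Matrix (Fin 2) (Fin 2) k) :
    ∃ γ : GL (Fin 2) k → Kˣ, Continuous γ ∧ (∀ h, (unitsEmb ι (γ h)).1 0 = h.1 0) ∧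
      ∀ (x : Kˣ) (h : GL (Fin 2) k) (a : kˣ), (unitsEmb ι x).1 0 = (a : k) • h.1 0 →
        x = Units.map (algebraMap k K : k →* K) a * γ h := by
  have hr : Module.finrank k K = 2 := Algebra.IsQuadraticExtension.finrank_eq_two k K
  have : Module.Finite k K := Module.finite_of_finrank_pos (by rw [hr]; exact two_pos)
  let β : K →ₗ[k] (Fin 2 → k) := LinearMap.proj 0 ∘ₗ ι.toLinearMap
  have hβ : ∀ x, β x = ι x 0 := fun _ => rfl
  -- A nonzero `x` is invertible, and an invertible matrix has no zero row. Equality of dimensions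
  -- then makes `β` bijective.
  have hinj : Function.Injective β := by
    rw [injective_iff_map_eq_zero]
    intro x hx
    by_contra hx0
    obtain ⟨y, hy⟩ := hK.mul_inv_cancel hx0
    have h1 : ι x * ι y = 1 := by rw [← map_mul, hy, map_one]
    have h2 : (ι x * ι y) 0 0 = 1 := by rw [h1]; rfl
    rw [hβ] at hx
    have h3 : ∀ j, ι x 0 j = 0 := fun j => congrFun hx j
    simp [Matrix.mul_apply, h3] at h2
  let e : K ≃ₗ[k] (Fin 2 → k) := LinearEquiv.ofInjectiveOfFinrankEq β hinj (by rw [hr]; simp)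
  have he : ∀ x, e x = ι x 0 := fun _ => rfl
  have hec : Continuous e.symm := by
    have := IsModuleTopology.toContinuousAdd k K
    exact IsModuleTopology.continuous_of_linearMap e.symm.toLinearMap
  have hne : ∀ h : GL (Fin 2) k, e.symm (h.1 0) ≠ 0 := by
    intro h h0
    have h1 := (LinearEquiv.symm_apply_eq _).1 h0
    rw [map_zero] at h1
    rcases apply_zero_ne_zero_or h with h2 | h2
    · exact h2 (congrFun h1 0)
    · exact h2 (congrFun h1 1)
  choose inv hinv using fun h => hK.mul_inv_cancel (hne h)
  let γ : GL (Fin 2) k → Kˣ := fun h => ⟨e.symm (h.1 0), inv h, hinv h, by rw [mul_comm, hinv]⟩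
  have hγ : ∀ h, (unitsEmb ι (γ h)).1 0 = h.1 0 := fun h => by
    change ι (e.symm (h.1 0)) 0 = _
    rw [← he, LinearEquiv.apply_symm_apply]
  refine ⟨γ, ?_, hγ, ?_⟩
  · have h1 : Continuous fun h : GL (Fin 2) k => e.symm (h.1 0) :=
      hec.comp (continuous_pi fun j => continuous_coe_GL 0 j)
    refine Units.continuous_iff.2 ⟨h1, ?_⟩
    -- Continuity of `h ↦ (γ h)⁻¹` is obtained by inverting in `GL₂` and reading off the first row.
    have h2 : Continuous fun h : GL (Fin 2) k => unitsEmb ι (γ h) := by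
      have hι : Continuous ι := IsModuleTopology.continuous_of_linearMap ι.toLinearMap
      have h3 : Continuous fun h : GL (Fin 2) k => (⟨ι (e.symm (h.1 0)),
          det_ne_zero_GL (unitsEmb ι (γ h))⟩ : {M : Matrix (Fin 2) (Fin 2) k // M.det ≠ 0}) :=
        (hι.comp h1).subtype_mk _
      convert continuous_toGL.comp h3 using 2 with h
      exact Units.ext rfl
    have h3 : ∀ h, ((γ h)⁻¹ : Kˣ).1 = e.symm ((unitsEmb ι (γ h))⁻¹.1 0) := fun h => by
      rw [LinearEquiv.eq_symm_apply, he, ← map_inv]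
      rfl
    change Continuous fun h => ((γ h)⁻¹ : Kˣ).1
    simp_rw [h3]
    exact hec.comp (continuous_pi fun j => (continuous_coe_GL 0 j).comp h2.inv)
  · intro x h a hx
    apply Units.ext
    apply e.injective
    rw [he]
    refine hx.trans ?_
    rw [← hγ]
    have : ((Units.map (algebraMap k K : k →* K) a * γ h : Kˣ) : K) = (a : k) • (γ h : K) := by
      rw [Algebra.smul_def]; rfl
    rw [this, map_smul, he]
    rfl

/-- `K^* / k^*` is compact, being the projective line. -/
theorem exists_isCompact_units_mul (hK : IsField K) (ι : K →ₐ[k] Matrix (Fin 2) (Fin 2) k) :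
    ∃ C : Set Kˣ, IsCompact C ∧
      ∀ x : Kˣ, ∃ a : kˣ, ∃ c ∈ C, x = Units.map (algebraMap k K : k →* K) a * c := by
  obtain ⟨γ, hγc, -, hγ⟩ := exists_rowUnit hK ι
  obtain ⟨C, hC, hCL⟩ := exists_isCompact_lowerTriangular_mul (k := k)
  refine ⟨γ '' C, hC.image hγc, fun x => ?_⟩
  obtain ⟨t, ht, c, hc, hx⟩ := hCL (unitsEmb ι x)
  exact ⟨Units.mk0 _ (lowerTriangular_apply_ne_zero ht), γ c, ⟨c, hc, rfl⟩, hγ _ _ _ (by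
    rw [hx, lowerTriangular_mul_row ht]; rfl)⟩

end FieldTorus

/-! ### Bessel functionals when `K` is a field -/

section FieldBessel
open ValuativeRel MeasureTheory

variable {k : Type*} [Field k] [ValuativeRel k] [TopologicalSpace k] [IsNonarchimedeanLocalField k]
  {K : Type*} [CommRing K] [Algebra k K]

/-- Right translation by `K^*` on functions on the projective line. -/
def rowTranslate (ι : K →ₐ[k] Matrix (Fin 2) (Fin 2) k) (x : Kˣ) (y : rowFunctions k) :
    rowFunctions k :=
  ⟨fun h => y.1 (h * unitsEmb ι x), smoothFunctions_translate y.2 _⟩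

theorem rowTranslate_mul (ι : K →ₐ[k] Matrix (Fin 2) (Fin 2) k) (x x' : Kˣ) (y : rowFunctions k) :
    rowTranslate ι (x * x') y = rowTranslate ι x (rowTranslate ι x' y) := by
  apply Subtype.ext
  funext h
  change y.1 (h * unitsEmb ι (x * x')) = y.1 (h * unitsEmb ι x * unitsEmb ι x')
  rw [map_mul, mul_assoc]

theorem rowFunctions_apply_mul_algebraMap (ι : K →ₐ[k] Matrix (Fin 2) (Fin 2) k)
    (y : rowFunctions k) (a : kˣ) (h : GL (Fin 2) k) :
    y.1 (h * unitsEmb ι (Units.map (algebraMap k K : k →* K) a)) = y.1 h := by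
  refine rowFunctions_apply_eq y.2 (a := a) ?_
  have h1 : (unitsEmb ι (Units.map (algebraMap k K : k →* K) a)).1 =
      (a : k) • (1 : Matrix (Fin 2) (Fin 2) k) :=
    (ι.commutes a).trans (Algebra.algebraMap_eq_smul_one _)
  rw [Units.val_mul, h1, Matrix.mul_smul, Matrix.mul_one]
  rfl

variable [TopologicalSpace K] [IsModuleTopology k K] [Algebra.IsQuadraticExtension k K]

/-- By smoothness and compactness of `K^* / k^*`, the orbit of `y` is finite. The sum over the orbit
is constant by transitivity, so `l` kills it; by invariance `l` takes there a positive multiple of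
`l y`. -/
theorem eq_zero_of_invariant (hK : IsField K) (ι : K →ₐ[k] Matrix (Fin 2) (Fin 2) k)
    {l : rowFunctions k →ₗ[ℂ] ℂ} (hlc : ∀ y ∈ rowConst k, l y = 0)
    (hl : ∀ (x : Kˣ) y, l (rowTranslate ι x y) = l y) : l = 0 := by
  have := isTopologicalRing_quadratic k K
  refine LinearMap.ext fun y => ?_
  obtain ⟨γ, hγc, hγrow, -⟩ := exists_rowUnit hK ι
  obtain ⟨C, hC, hCL⟩ := exists_isCompact_lowerTriangular_mul (k := k)
  obtain ⟨C', hC', hCK⟩ := exists_isCompact_units_mul hK ι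
  have hinv := eventually_forall_apply_mul_eq hC hCL y.2
  let H : Subgroup Kˣ :=
    { carrier := {x | rowTranslate ι x y = y}
      one_mem' := Subtype.ext (funext fun h => by
        change y.1 (h * unitsEmb ι 1) = y.1 h
        rw [map_one, mul_one])
      mul_mem' := fun {a b} ha hb => by
        change rowTranslate ι (a * b) y = y
        rw [rowTranslate_mul, show rowTranslate ι b y = y from hb, show rowTranslate ι a y = y from ha]
      inv_mem' := fun {a} ha => by
        change rowTranslate ι a⁻¹ y = y
        conv_lhs => rw [← show rowTranslate ι a y = y from ha]
        rw [← rowTranslate_mul, inv_mul_cancel]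
        exact Subtype.ext (funext fun h => by
          change y.1 (h * unitsEmb ι 1) = y.1 h
          rw [map_one, mul_one]) }
  have hH : ∀ x, x ∈ H ↔ rowTranslate ι x y = y := fun _ => Iff.rfl
  have hHo : IsOpen (H : Set Kˣ) := by
    refine Subgroup.isOpen_of_mem_nhds H (g := 1) ?_
    have h1 : Filter.Tendsto (unitsEmb ι) (nhds 1) (nhds 1) := by
      have := (continuous_unitsEmb ι).tendsto 1
      rwa [map_one] at this
    filter_upwards [h1 hinv] with x hx
    exact Subtype.ext (funext hx)
  have hd : DiscreteTopology (Kˣ ⧸ H) := QuotientGroup.discreteTopology hHo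
  have hfin : Finite (Kˣ ⧸ H) := by
    have hc : IsCompact (Set.univ : Set (Kˣ ⧸ H)) := by
      convert hC'.image (QuotientGroup.continuous_mk (N := H))
      refine (Set.eq_univ_of_forall fun q => ?_).symm
      obtain ⟨x, rfl⟩ := QuotientGroup.mk_surjective q
      obtain ⟨a, c, hc, rfl⟩ := hCK x
      refine ⟨c, hc, QuotientGroup.eq.2 ?_⟩
      rw [mul_comm, mul_inv_cancel_right, hH]
      exact Subtype.ext (funext fun h => rowFunctions_apply_mul_algebraMap ι y a h)
    have := isCompact_univ_iff.1 hc
    exact finite_of_compact_of_discrete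
  have := Fintype.ofFinite (Kˣ ⧸ H)
  let T : Kˣ ⧸ H → rowFunctions k := fun q => rowTranslate ι q.out y
  have hT : ∀ x : Kˣ, T x = rowTranslate ι x y := by
    intro x
    have h1 : ((x : Kˣ ⧸ H).out : Kˣ)⁻¹ * x ∈ H := QuotientGroup.eq.1 (Quotient.out_eq' _)
    have h2 := (hH _).1 h1
    change rowTranslate ι _ y = _
    conv_lhs => rw [← h2]
    rw [← rowTranslate_mul, mul_inv_cancel_left]
  -- Since `h` and `unitsEmb ι (γ h)` have the same first row, evaluating at `h` instead of `1`
  -- permutes the cosets by translation by `γ h`.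
  have hconst : ∑ q, T q ∈ rowConst k := by
    refine ⟨(∑ q, T q).1 1, fun h => ?_⟩
    have h1 : ∀ g, (∑ q, T q).1 g = ∑ q, (T q).1 g := fun g => by
      rw [Submodule.coe_sum, Finset.sum_apply]
    rw [h1, h1]
    refine Fintype.sum_equiv (Equiv.mulLeft ((γ h : Kˣ) : Kˣ ⧸ H)) _ _ fun q => ?_
    obtain ⟨x, rfl⟩ := QuotientGroup.mk_surjective q
    change (T x).1 h = (T ((γ h * x : Kˣ) : Kˣ ⧸ H)).1 1
    rw [hT, hT]
    change y.1 (h * unitsEmb ι x) = y.1 (1 * unitsEmb ι (γ h * x))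
    refine rowFunctions_apply_eq y.2 (a := 1) ?_
    rw [one_mul, one_smul, map_mul, Units.val_mul, Units.val_mul, Matrix.mul_apply_eq_vecMul,
      Matrix.mul_apply_eq_vecMul, hγrow]
  have h3 := hlc _ hconst
  rw [map_sum, Finset.sum_congr rfl fun q _ => hl q.out y, Finset.sum_const, nsmul_eq_mul,
    mul_eq_zero] at h3
  refine h3.resolve_left ?_
  have : Nonempty (Kˣ ⧸ H) := ⟨(1 : Kˣ)⟩
  exact_mod_cast Fintype.card_ne_zero

theorem eventually_inv_notMem_ball (γ : (ValueGroupWithZero k)ˣ) :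
    ∀ᶠ x : k in nhds 0, x ≠ 0 → x⁻¹ ∉ ball k γ := by
  obtain ⟨ϖ, hϖ, hϖ1⟩ := exists_valuation_lt_one (k := k)
  let δ := γ⁻¹ * Units.mk0 _ ((Valuation.ne_zero_iff (valuation k)).2 hϖ)
  filter_upwards [(isOpen_ball δ).mem_nhds (ball k δ).zero_mem] with x hx hx0 hxi
  have h1 : valuation k x ≤ (γ : ValueGroupWithZero k)⁻¹ * valuation k ϖ := by
    simpa [δ] using mem_ball.1 hx
  have h2 := mem_ball.1 hxi
  have hv : valuation k x ≠ 0 := (Valuation.ne_zero_iff _).2 hx0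
  have h3 : valuation k x * valuation k x⁻¹ ≤ (γ : ValueGroupWithZero k)⁻¹ * valuation k ϖ * γ :=
    mul_le_mul' h1 h2
  rw [map_inv₀, mul_inv_cancel₀ hv, mul_right_comm, inv_mul_cancel₀ γ.ne_zero, one_mul] at h3
  exact absurd hϖ1 (not_lt.2 h3)

theorem isLocallyConstant_indicator_one {X : Type*} [TopologicalSpace X] {s : Set X}
    (hs : IsClopen s) : IsLocallyConstant (s.indicator (1 : X → ℂ)) := by
  rw [IsLocallyConstant.iff_eventually_eq]
  intro x
  by_cases hx : x ∈ s
  · filter_upwards [hs.isOpen.mem_nhds hx] with z hz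
    rw [Set.indicator_of_mem hx, Set.indicator_of_mem hz]
    rfl
  · filter_upwards [hs.compl.isOpen.mem_nhds hx] with z hz
    rw [Set.indicator_of_notMem hx, Set.indicator_of_notMem hz]

theorem isClopen_ball (γ : (ValueGroupWithZero k)ˣ) : IsClopen (ball k γ : Set k) :=
  ⟨AddSubgroup.isClosed_of_isOpen _ (isOpen_ball γ), isOpen_ball γ⟩

/-- The indicator function of a neighbourhood of the line `⟨(1, 0)⟩` in the projective line. -/
theorem exists_rowFunctions_indicator (γ : (ValueGroupWithZero k)ˣ) :
    ∃ y ∈ rowFunctions k, y 1 = 1 ∧ ∀ h : GL (Fin 2) k,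
      (h.1 0 0 ≠ 0 ∧ h.1 0 1 / h.1 0 0 ∈ ball k γ ∧ y h = 1) ∨ y h = 0 := by
  classical
  let F' : k → ℂ := (ball k γ : Set k).indicator 1
  have hF' : IsLocallyConstant F' := isLocallyConstant_indicator_one (isClopen_ball γ)
  -- In the opposite chart the function vanishes near `0`, because `x⁻¹` leaves the ball; so `0` is
  -- the right value at `0`.
  let F : k → ℂ := fun x => if x = 0 then 0 else F' x⁻¹
  have hF : IsLocallyConstant F := by
    rw [IsLocallyConstant.iff_eventually_eq]
    intro x
    by_cases hx : x = 0
    · subst hx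
      filter_upwards [eventually_inv_notMem_ball γ] with z hz
      by_cases hz0 : z = 0
      · rw [hz0]
      · simp [F, F', hz0, hz hz0]
    · filter_upwards [(continuousAt_inv₀ hx) (hF'.eventually_eq _), eventually_ne_nhds hx] with z hz hz0
      simp only [F, if_neg hx, if_neg hz0]
      exact hz
  refine ⟨rowGlue F F', rowGlue_mem hF hF' fun x hx => by simp [F, hx], ?_, fun h => ?_⟩
  · simp [rowGlue, F', (ball k γ).zero_mem]
  · unfold rowGlue
    split_ifs with h1
    · refine Or.inl ⟨(apply_zero_ne_zero_or h).resolve_right (fun h2 => h2 h1), ?_, ?_⟩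
      · rw [h1, zero_div]; exact (ball k γ).zero_mem
      · simp [F', (ball k γ).zero_mem]
    · by_cases h0 : h.1 0 0 = 0
      · right
        simp [F, h0]
      · by_cases hb : h.1 0 1 / h.1 0 0 ∈ ball k γ
        · exact Or.inl ⟨h0, hb, by simp [F, F', h0, h1, hb]⟩
        · right
          simp [F, F', h0, h1, hb]

/-- The functional is the integral of `y χ⁻¹` over the compact group `K^* / k^*`. Invariance of Haar
measure gives equivariance, which forces the value `0` on constants as soon as `χ ≠ 1`. -/
theorem exists_equivariant_functional (hK : IsField K) (ι : K →ₐ[k] Matrix (Fin 2) (Fin 2) k)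
    {χ : Kˣ →* ℂˣ} (hχ : Continuous χ)
    (hχk : ∀ a : kˣ, χ (Units.map (algebraMap k K : k →* K) a) = 1) (hχ1 : χ ≠ 1) :
    ∃ l : rowFunctions k →ₗ[ℂ] ℂ, l ≠ 0 ∧ (∀ y ∈ rowConst k, l y = 0) ∧
      ∀ (x : Kˣ) y, l (rowTranslate ι x y) = χ x * l y := by
  have := isTopologicalRing_quadratic k K
  obtain ⟨γ, hγc, hγrow, hγ⟩ := exists_rowUnit hK ι
  obtain ⟨C, hC, hCK⟩ := exists_isCompact_units_mul hK ι
  let N : Subgroup Kˣ := (Units.map (algebraMap k K : k →* K)).range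
  have hcpt : CompactSpace (Kˣ ⧸ N) := by
    refine isCompact_univ_iff.1 ?_
    convert hC.image (QuotientGroup.continuous_mk (N := N))
    refine (Set.eq_univ_of_forall fun q => ?_).symm
    obtain ⟨x, rfl⟩ := QuotientGroup.mk_surjective q
    obtain ⟨a, c, hc, rfl⟩ := hCK x
    refine ⟨c, hc, QuotientGroup.eq.2 ⟨a, ?_⟩⟩
    rw [mul_comm, mul_inv_cancel_right]
  let _ : MeasurableSpace (Kˣ ⧸ N) := _root_.borel _
  have : BorelSpace (Kˣ ⧸ N) := ⟨rfl⟩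
  have hF : ∀ y : rowFunctions k, ∃ F : Kˣ ⧸ N → ℂ, Continuous F ∧
      ∀ x : Kˣ, F x = y.1 (unitsEmb ι x) * ((χ x)⁻¹ : ℂˣ) := by
    intro y
    have hF : ∀ x : Kˣ, y.1 (unitsEmb ι (x : Kˣ ⧸ N).out) * ((χ (x : Kˣ ⧸ N).out)⁻¹ : ℂˣ) =
        y.1 (unitsEmb ι x) * ((χ x)⁻¹ : ℂˣ) := by
      intro x
      have h1 : ((x : Kˣ ⧸ N).out : Kˣ)⁻¹ * x ∈ N := QuotientGroup.eq.1 (Quotient.out_eq' _)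
      obtain ⟨a, ha⟩ := h1
      rw [eq_inv_mul_iff_mul_eq] at ha
      conv_rhs => rw [← ha, map_mul, map_mul, hχk, mul_one, rowFunctions_apply_mul_algebraMap]
    refine ⟨fun q => y.1 (unitsEmb ι q.out) * ((χ q.out)⁻¹ : ℂˣ), ?_, hF⟩
    rw [(QuotientGroup.isQuotientMap_mk (N := N)).continuous_iff]
    have h2 : Continuous fun x : Kˣ => y.1 (unitsEmb ι x) * ((χ x)⁻¹ : ℂˣ) :=
      (y.2.1.continuous.comp (continuous_unitsEmb ι)).mul (Units.continuous_val.comp hχ.inv)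
    exact h2.congr fun x => (hF x).symm
  choose F hFc hFx using hF
  have hint : ∀ y, Integrable (F y) (Measure.haar : Measure (Kˣ ⧸ N)) := fun y =>
    (hFc y).integrable_of_hasCompactSupport (HasCompactSupport.of_compactSpace _)
  let l : rowFunctions k →ₗ[ℂ] ℂ :=
    { toFun y := ∫ q, F y q ∂Measure.haar
      map_add' y y' := by
        rw [← integral_add (hint y) (hint y')]
        congr 1
        funext q
        obtain ⟨x, rfl⟩ := QuotientGroup.mk_surjective q
        rw [hFx, hFx, hFx]
        exact add_mul _ _ _
      map_smul' c y := by
        rw [← integral_smul]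
        congr 1
        funext q
        obtain ⟨x, rfl⟩ := QuotientGroup.mk_surjective q
        change _ = c * F y _
        rw [hFx, hFx]
        exact mul_assoc _ _ _ }
  have hl : ∀ (x : Kˣ) y, l (rowTranslate ι x y) = χ x * l y := by
    intro x y
    change ∫ q, F _ q ∂Measure.haar = χ x * ∫ q, F y q ∂Measure.haar
    rw [← integral_const_mul, ← integral_mul_left_eq_self (fun q => χ x * F y q) (x : Kˣ ⧸ N)]
    congr 1
    funext q
    obtain ⟨z, rfl⟩ := QuotientGroup.mk_surjective q
    rw [← QuotientGroup.mk_mul, hFx, hFx, mul_comm x z]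
    change y.1 (unitsEmb ι z * unitsEmb ι x) * _ = _
    have h1 : (χ x : ℂ) * ((χ (z * x))⁻¹ : ℂˣ) = ((χ z)⁻¹ : ℂˣ) := by
      rw [← Units.val_mul, map_mul, mul_inv_rev, mul_inv_cancel_left]
    rw [mul_left_comm, h1, map_mul]
  refine ⟨l, ?_, ?_, hl⟩
  -- For nonvanishing, the test function is the indicator of a neighbourhood of the line of `(1,
  -- 0)`, so small that `χ⁻¹` has positive real part on it.
  · let u : k → GL (Fin 2) k := fun b => toGL ⟨!![1, b; 0, 1], by simp [Matrix.det_fin_two]⟩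
    have hu : Continuous u := by
      refine continuous_toGL.comp (Continuous.subtype_mk (continuous_matrix fun i j => ?_) _)
      fin_cases i <;> fin_cases j
      · exact continuous_const
      · exact continuous_id
      · exact continuous_const
      · exact continuous_const
    have hu0 : u 0 = 1 := Units.ext (by simp [u, Matrix.one_fin_two])
    have hγ1 : γ 1 = 1 := by
      have := hγ 1 1 1 (by rw [map_one]; exact (one_smul k _).symm)
      rw [map_one, one_mul] at this
      exact this.symm
    have hre : Continuous fun b => (((χ (γ (u b)))⁻¹ : ℂˣ) : ℂ).re :=
      Complex.continuous_re.comp (Units.continuous_val.comp (hχ.comp (hγc.comp hu)).inv)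
    obtain ⟨δ, hδ⟩ := exists_ball_subset ((isOpen_lt continuous_const hre).mem_nhds
      (show (0 : ℝ) < (((χ (γ (u 0)))⁻¹ : ℂˣ) : ℂ).re by simp [hu0, hγ1]))
    obtain ⟨y, hy, hy1, hyh⟩ := exists_rowFunctions_indicator (k := k) δ
    have hnn : ∀ x : Kˣ, 0 ≤ (F ⟨y, hy⟩ x).re := by
      intro x
      rw [hFx]
      rcases hyh (unitsEmb ι x) with ⟨h0, hb, hone⟩ | h0
      · have hx := hγ x (u ((unitsEmb ι x).1 0 1 / (unitsEmb ι x).1 0 0)) (Units.mk0 _ h0) (by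
          ext j
          fin_cases j
          · simp [u]
          · simp [u]
            field_simp)
        change 0 ≤ (y _ * _).re
        rw [hone, one_mul, hx, map_mul, hχk, one_mul]
        exact (hδ hb).le
      · change 0 ≤ (y _ * _).re
        rw [h0, zero_mul, Complex.zero_re]
    have hpos : 0 < ∫ q, (F ⟨y, hy⟩ q).re ∂(Measure.haar : Measure (Kˣ ⧸ N)) := by
      refine (Complex.continuous_re.comp (hFc _)).integral_pos_of_hasCompactSupport_nonneg_nonzero
        (HasCompactSupport.of_compactSpace _) (fun q => ?_) (x := ((1 : Kˣ) : Kˣ ⧸ N)) ?_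
      · obtain ⟨x, rfl⟩ := QuotientGroup.mk_surjective q
        exact hnn x
      · rw [hFx]
        change (y _ * _).re ≠ 0
        rw [map_one, map_one, hy1]
        simp
    intro h0
    have h1 : l ⟨y, hy⟩ = 0 := by rw [h0]; rfl
    have h2 : (∫ q, F ⟨y, hy⟩ q ∂(Measure.haar : Measure (Kˣ ⧸ N))).re = 0 := by
      rw [show ∫ q, F ⟨y, hy⟩ q ∂(Measure.haar : Measure (Kˣ ⧸ N)) = 0 from h1, Complex.zero_re]
    rw [← Complex.reCLM_apply, ← Complex.reCLM.integral_comp_comm (hint _)] at h2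
    exact hpos.ne' h2
  · rintro y ⟨c, hc⟩
    obtain ⟨x, hx⟩ : ∃ x, χ x ≠ 1 := by
      by_contra! H
      exact hχ1 (MonoidHom.ext H)
    have h1 := hl x y
    rw [show rowTranslate ι x y = y from Subtype.ext (funext fun h => (hc _).trans (hc _).symm)] at h1
    by_contra h0
    apply hx
    apply Units.ext
    exact mul_right_cancel₀ h0 (h1.symm.trans (one_mul _).symm)

end FieldBessel

/-! ### The logarithmic absolute value on `k^*` and averages over its fibres -/

section Order
open ValuativeRel MeasureTheory

variable {k : Type*} [Field k] [ValuativeRel k] [TopologicalSpace k] [IsNonarchimedeanLocalField k]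

/-- The normalized logarithmic absolute value on `k^*`. -/
def ord (x : kˣ) : ℤ :=
  WithZero.log (IsNonarchimedeanLocalField.valueGroupWithZeroIsoInt k (valuation k (x : k)))

theorem valueGroupIso_ne_zero (γ : (ValueGroupWithZero k)ˣ) :
    IsNonarchimedeanLocalField.valueGroupWithZeroIsoInt k γ ≠ 0 := by
  rw [Ne, map_eq_zero]
  exact γ.ne_zero

theorem valuation_unit_ne_zero (x : kˣ) : valuation k (x : k) ≠ 0 :=
  (Valuation.ne_zero_iff _).2 x.ne_zero

theorem valueGroupIso_valuation_ne_zero (x : kˣ) :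
    IsNonarchimedeanLocalField.valueGroupWithZeroIsoInt k (valuation k (x : k)) ≠ 0 := by
  rw [Ne, map_eq_zero]
  exact valuation_unit_ne_zero x

theorem ord_mul (x y : kˣ) : ord (x * y) = ord x + ord y := by
  unfold ord
  rw [Units.val_mul, map_mul, map_mul, WithZero.log_mul (valueGroupIso_valuation_ne_zero x)
    (valueGroupIso_valuation_ne_zero y)]

theorem ord_one : ord (1 : kˣ) = 0 := by
  simp [ord]

theorem ord_inv (x : kˣ) : ord x⁻¹ = -ord x := by
  have := ord_mul x x⁻¹
  rw [mul_inv_cancel, ord_one] at this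
  lia

theorem ord_surjective : Function.Surjective (ord : kˣ → ℤ) := by
  intro n
  obtain ⟨γ, hγ⟩ : ∃ γ, IsNonarchimedeanLocalField.valueGroupWithZeroIsoInt k γ = WithZero.exp n :=
    (IsNonarchimedeanLocalField.valueGroupWithZeroIsoInt k).surjective _
  obtain ⟨x, rfl⟩ := ValuativeRel.valuation_surjective γ
  have hx : x ≠ 0 := by
    rintro rfl
    rw [map_zero, map_zero] at hγ
    exact WithZero.exp_ne_zero hγ.symm
  exact ⟨Units.mk0 x hx, by rw [ord, Units.val_mk0, hγ, WithZero.log_exp]⟩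

theorem mem_ball_iff_ord_le (γ : (ValueGroupWithZero k)ˣ) (x : kˣ) :
    (x : k) ∈ ball k γ ↔
      ord x ≤ WithZero.log (IsNonarchimedeanLocalField.valueGroupWithZeroIsoInt k γ) := by
  rw [mem_ball, ord, WithZero.log_le_log (valueGroupIso_valuation_ne_zero x) (valueGroupIso_ne_zero γ)]
  exact (map_le_map_iff (IsNonarchimedeanLocalField.valueGroupWithZeroIsoInt k)).symm

theorem exists_forall_mem_ball_iff_ord_le (n : ℤ) :
    ∃ γ, ∀ x : kˣ, (x : k) ∈ ball k γ ↔ ord x ≤ n := by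
  obtain ⟨z, rfl⟩ := ord_surjective (k := k) n
  exact ⟨Units.mk0 _ (valuation_unit_ne_zero z), fun x => mem_ball_iff_ord_le _ x⟩

theorem isClopen_ord_le (n : ℤ) : IsClopen {x : kˣ | ord x ≤ n} := by
  obtain ⟨γ, hγ⟩ := exists_forall_mem_ball_iff_ord_le (k := k) n
  convert (isClopen_ball γ).preimage (Units.continuous_val (M := k)) using 1
  ext x
  exact (hγ x).symm

theorem continuous_ord : Continuous (ord : kˣ → ℤ) := by
  refine continuous_discrete_rng.2 fun n => ?_
  convert (isClopen_ord_le (k := k) n).isOpen.inter (isClopen_ord_le (n - 1)).compl.isOpen using 1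
  ext x
  change ord x = n ↔ ord x ≤ n ∧ ¬ ord x ≤ n - 1
  lia

/-- Through `x ↦ (x, x⁻¹)` the units are closed in a product of two copies of `k`, and the bounds
place both coordinates in compact balls. -/
theorem isCompact_ord_Icc (m n : ℤ) : IsCompact {x : kˣ | m ≤ ord x ∧ ord x ≤ n} := by
  obtain ⟨γ, hγ⟩ := exists_forall_mem_ball_iff_ord_le (k := k) n
  obtain ⟨δ, hδ⟩ := exists_forall_mem_ball_iff_ord_le (k := k) (-m)
  have hc : IsCompact ((ball k γ : Set k) ×ˢ (MulOpposite.unop ⁻¹' (ball k δ : Set k))) := by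
    refine (isCompact_ball γ).prod ?_
    convert (isCompact_ball δ).image MulOpposite.continuous_op
    exact MulOpposite.opEquiv.symm.image_symm_eq_preimage _ |>.symm
  convert Units.isClosedEmbedding_embedProduct.isCompact_preimage hc using 1
  ext x
  change m ≤ ord x ∧ ord x ≤ n ↔ (x : k) ∈ ball k γ ∧ ((x⁻¹ : kˣ) : k) ∈ ball k δ
  rw [hγ, hδ, ord_inv]
  lia

/-- Averages over the fibres of `ord`, that is, over the cosets of the units of the ring of
integers. -/
theorem exists_ord_average : ∃ a : (kˣ → ℂ) → ℤ → ℂ,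
    (∀ F F', Continuous F → Continuous F' → a (F + F') = a F + a F') ∧
    (∀ (c : ℂ) F, a (c • F) = c • a F) ∧
    (∀ F (c : kˣ) n, a (fun x => F (x * c)) n = a F (n + ord c)) ∧
    ∀ F n z, (∀ x, ord x = n → F x = z) → a F n = z := by
  let _ : MeasurableSpace kˣ := _root_.borel kˣ
  have : BorelSpace kˣ := ⟨rfl⟩
  let μ : Measure kˣ := Measure.haar
  let S : ℤ → Set kˣ := fun n => {x | ord x = n}
  have hSo : ∀ n, IsOpen (S n) := fun n => (isOpen_discrete {n}).preimage continuous_ord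
  have hSc : ∀ n, IsCompact (S n) := fun n => by
    convert isCompact_ord_Icc (k := k) n n using 1
    ext x
    change ord x = n ↔ n ≤ ord x ∧ ord x ≤ n
    lia
  have hSm : ∀ n, MeasurableSet (S n) := fun n => (hSo n).measurableSet
  -- The fibres of `ord` are translates of each other, so one normalization serves for all `n`.
  have hS : ∀ n, μ.real (S n) = μ.real (S 0) := by
    intro n
    obtain ⟨z, hz⟩ := ord_surjective (k := k) n
    have h1 : (fun x => z * x) ⁻¹' S n = S 0 := by
      ext x
      change ord (z * x) = n ↔ ord x = 0
      rw [ord_mul]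
      lia
    rw [← h1, Measure.real, Measure.real, measure_preimage_mul]
  have hS0 : (μ.real (S 0) : ℂ) ≠ 0 := by
    have h1 : μ (S 0) ≠ 0 := ((hSo 0).measure_pos μ ⟨1, ord_one⟩).ne'
    exact_mod_cast (ENNReal.toReal_ne_zero.2 ⟨h1, (hSc 0).measure_lt_top.ne⟩)
  refine ⟨fun F n => (μ.real (S 0) : ℂ)⁻¹ * ∫ x in S n, F x ∂μ, fun F F' hF hF' => ?_,
    fun c F => ?_, fun F c n => ?_, fun F n z h => ?_⟩
  · funext n
    simp only [Pi.add_apply]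
    rw [integral_add (hF.continuousOn.integrableOn_compact (hSc n))
      (hF'.continuousOn.integrableOn_compact (hSc n)), mul_add]
  · funext n
    simp only [Pi.smul_apply]
    rw [integral_smul, smul_eq_mul, smul_eq_mul, mul_left_comm]
  · simp only
    rw [← integral_indicator (hSm _), ← integral_indicator (hSm _),
      ← integral_mul_left_eq_self (fun x => (S (n + ord c)).indicator F x) c]
    congr 2
    funext x
    have h1 : x ∈ S n ↔ c * x ∈ S (n + ord c) := by
      change ord x = n ↔ ord (c * x) = n + ord c
      rw [ord_mul]
      lia
    by_cases hx : x ∈ S n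
    · rw [Set.indicator_of_mem hx, Set.indicator_of_mem (h1.1 hx), mul_comm]
    · rw [Set.indicator_of_notMem hx, Set.indicator_of_notMem fun h2 => hx (h1.2 h2)]
  · simp only
    rw [setIntegral_congr_fun (hSm n) (g := fun _ => z) fun x hx => h x hx, setIntegral_const, hS n,
      Complex.real_smul, inv_mul_cancel_left₀ hS0]

end Order

/-! ### Functions on the projective line modulo constants and `𝒮(k^*)` -/

section Split
open ValuativeRel MeasureTheory

variable {k : Type*} [Field k]

/-- The matrices with first row `(t, 1)`. -/
def chartZero (t : k) : GL (Fin 2) k := toGL ⟨!![t, 1; -1, 0], by simp [Matrix.det_fin_two]⟩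

/-- The matrices with first row `(1, t)`. -/
def chartInfty (t : k) : GL (Fin 2) k := toGL ⟨!![1, t; 0, 1], by simp [Matrix.det_fin_two]⟩

variable [ValuativeRel k] [TopologicalSpace k] [IsNonarchimedeanLocalField k]

theorem continuous_chartZero : Continuous (chartZero : k → GL (Fin 2) k) := by
  refine continuous_toGL.comp (Continuous.subtype_mk (continuous_matrix fun i j => ?_) _)
  fin_cases i <;> fin_cases j
  · exact continuous_id
  · exact continuous_const
  · exact continuous_const
  · exact continuous_const

theorem continuous_chartInfty : Continuous (chartInfty : k → GL (Fin 2) k) := by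
  refine continuous_toGL.comp (Continuous.subtype_mk (continuous_matrix fun i j => ?_) _)
  fin_cases i <;> fin_cases j
  · exact continuous_const
  · exact continuous_id
  · exact continuous_const
  · exact continuous_const

theorem apply_chartInfty_inv {y : GL (Fin 2) k → ℂ} (hy : y ∈ rowFunctions k) {t : k} (ht : t ≠ 0) :
    y (chartInfty t⁻¹) = y (chartZero t) := by
  refine rowFunctions_apply_eq hy (a := t⁻¹) ?_
  ext j
  fin_cases j <;> simp [chartZero, chartInfty, ht]

theorem eq_rowGlue {y : GL (Fin 2) k → ℂ} (hy : y ∈ rowFunctions k) :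
    y = rowGlue (fun t => y (chartZero t)) (fun t => y (chartInfty t)) := by
  funext h
  unfold rowGlue
  split_ifs with h1
  · refine rowFunctions_apply_eq hy (a := h.1 0 0) ?_
    ext j
    fin_cases j <;> simp [chartInfty, h1]
  · refine rowFunctions_apply_eq hy (a := h.1 0 1) ?_
    ext j
    fin_cases j <;> simp [chartZero]
    field_simp

/-- A locally constant function on `k^*` that is constant near `0` and near `∞` extends to the
projective line. -/
theorem exists_rowFunctions_chartZero {F : kˣ → ℂ} (hF : IsLocallyConstant F) {N : ℤ} {c₀ c₁ : ℂ}
    (h0 : ∀ x, ord x ≤ -N → F x = c₀) (h1 : ∀ x, N ≤ ord x → F x = c₁) :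
    ∃ y ∈ rowFunctions k, ∀ t : kˣ, y (chartZero (t : k)) = F t := by
  -- `ord` is small near `0` and large near `∞`. The chart at `∞` is the chart at `0` for `x ↦ F
  -- x⁻¹`, so one extension statement covers both.
  have key : ∀ (F : kˣ → ℂ) (N : ℤ) (c : ℂ), IsLocallyConstant F → (∀ x, ord x ≤ N → F x = c) →
      ∃ F' : k → ℂ, IsLocallyConstant F' ∧ ∀ t : kˣ, F' t = F t := by
    intro F N c hF h
    classical
    refine ⟨fun t => if ht : t = 0 then c else F (Units.mk0 t ht), ?_, fun t => by simp⟩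
    rw [IsLocallyConstant.iff_eventually_eq]
    intro t
    by_cases ht : t = 0
    · subst ht
      obtain ⟨γ, hγ⟩ := exists_forall_mem_ball_iff_ord_le (k := k) N
      filter_upwards [(isOpen_ball γ).mem_nhds (ball k γ).zero_mem] with x hx
      by_cases hx0 : x = 0
      · rw [hx0]
      · rw [dif_neg hx0, dif_pos rfl]
        exact h _ ((hγ (Units.mk0 x hx0)).1 hx)
    · have h2 := (IsOpenUnits.isOpenEmbedding_unitsVal (M := k)).map_nhds_eq (Units.mk0 t ht)
      rw [Units.val_mk0] at h2
      rw [← h2, Filter.eventually_map]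
      filter_upwards [hF.eventually_eq (Units.mk0 t ht)] with x hx
      simpa [ht] using hx
  obtain ⟨F₀, hF₀, hF₀'⟩ := key F (-N) c₀ hF h0
  obtain ⟨F₁, hF₁, hF₁'⟩ := key (fun x => F x⁻¹) (-N) c₁ (hF.comp_continuous continuous_inv)
    (fun x hx => h1 _ (by rw [ord_inv]; lia))
  refine ⟨rowGlue F₀ F₁, rowGlue_mem hF₀ hF₁ fun x hx => ?_, fun t => ?_⟩
  · have h2 := hF₁' (Units.mk0 x hx)⁻¹
    have h3 := hF₀' (Units.mk0 x hx)
    rw [Units.val_inv_eq_inv_val, Units.val_mk0, inv_inv] at h2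
    exact h2.trans h3.symm
  · rw [← hF₀']
    simp [rowGlue, chartZero]

/-- Local constancy at the two points `0` and `∞`, read in the coordinate `t` on `k^*`. -/
theorem exists_forall_chartZero_eq {y : GL (Fin 2) k → ℂ} (hy : y ∈ rowFunctions k) :
    ∃ N : ℤ, (∀ t : kˣ, ord t ≤ -N → y (chartZero (t : k)) = y (chartZero 0)) ∧
      ∀ t : kˣ, N ≤ ord t → y (chartZero (t : k)) = y (chartInfty 0) := by
  have key : ∀ F : k → ℂ, IsLocallyConstant F → ∃ N : ℤ, ∀ t : kˣ, ord t ≤ N → F t = F 0 := by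
    intro F hF
    obtain ⟨γ, hγ⟩ := exists_ball_subset (hF.eventually_eq 0)
    exact ⟨_, fun t ht => hγ ((mem_ball_iff_ord_le γ t).2 ht)⟩
  obtain ⟨N₀, h0⟩ := key _ (hy.1.comp_continuous continuous_chartZero)
  obtain ⟨N₁, h1⟩ := key _ (hy.1.comp_continuous continuous_chartInfty)
  refine ⟨max (-N₀) (-N₁), fun t ht => h0 t (by lia), fun t ht => ?_⟩
  rw [← apply_chartInfty_inv hy t.ne_zero, ← Units.val_inv_eq_inv_val]
  exact h1 t⁻¹ (by rw [ord_inv]; lia)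

theorem exists_of_mem_schwartz {G : kˣ → ℂ} (hG : G ∈ schwartz k) :
    ∃ N : ℤ, ∀ x, ord x ≤ -N ∨ N ≤ ord x → G x = 0 := by
  obtain ⟨B, hB⟩ := (hG.2.isCompact.image continuous_ord).isBounded.exists_norm_le
  refine ⟨⌊B⌋ + 1, fun x hx => ?_⟩
  by_contra h0
  have h1 := hB (ord x) ⟨x, subset_tsupport _ h0, rfl⟩
  rw [Int.norm_eq_abs, ← Int.cast_abs, ← Int.le_floor, abs_le] at h1
  lia

theorem mem_schwartz_of {G : kˣ → ℂ} (hG : IsLocallyConstant G) {N : ℤ}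
    (h : ∀ x, ord x ≤ -N ∨ N ≤ ord x → G x = 0) : G ∈ schwartz k :=
  ⟨hG, HasCompactSupport.intro (isCompact_ord_Icc (-N) N) fun x hx => h x (by
    by_contra! H
    exact hx ⟨H.1.le, H.2.le⟩)⟩

/-- The values at `0` and `∞` are attained on `k^*` near these points. -/
theorem mem_rowConst_of_chartZero {y : rowFunctions k} {c : ℂ}
    (h : ∀ t : kˣ, y.1 (chartZero (t : k)) = c) : y ∈ rowConst k := by
  obtain ⟨N, h0, h1⟩ := exists_forall_chartZero_eq y.2
  obtain ⟨x, hx⟩ := ord_surjective (k := k) N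
  have hz : y.1 (chartZero 0) = c := by
    rw [← h0 x⁻¹ (by rw [ord_inv, hx]), h]
  have hi : y.1 (chartInfty 0) = c := by
    rw [← h1 x hx.ge, h]
  refine ⟨c, fun g => ?_⟩
  rw [eq_rowGlue y.2]
  unfold rowGlue
  split_ifs with hg
  · exact hi
  · by_cases h2 : g.1 0 0 / g.1 0 1 = 0
    · simp only [h2, hz]
    · exact h (Units.mk0 _ h2)

/-- Locally constant functions on the projective line modulo constants are identified with
`𝒮(k^*)`, equivariantly for the diagonal torus. -/
theorem exists_rowFunctions_to_schwartz :
    ∃ D : rowFunctions k →ₗ[ℂ] schwartz k, Function.Surjective D ∧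
      (∀ y, D y = 0 ↔ y ∈ rowConst k) ∧
      ∀ (a b : kˣ) (d : GL (Fin 2) k) (y y' : rowFunctions k), d.1 = !![(a : k), 0; 0, (b : k)] →
        (∀ h, y'.1 h = y.1 (h * d)) → D y' = schwartzRep k (a / b) (D y) := by
  obtain ⟨A, hadd, hsmul, htr, hconst⟩ := exists_ord_average (k := k)
  let res : rowFunctions k → kˣ → ℂ := fun y t => y.1 (chartZero (t : k))
  have hres : ∀ y, IsLocallyConstant (res y) := fun y =>
    y.2.1.comp_continuous (continuous_chartZero.comp Units.continuous_val)
  have hord : ∀ f : ℤ → ℂ, IsLocallyConstant fun x : kˣ => f (ord x) := fun f =>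
    (IsLocallyConstant.of_discrete f).comp_continuous continuous_ord
  -- `F - A F` vanishes near `0` and `∞`, where `F` is constant. The averaged part is a sequence on
  -- `ℤ` constant near both ends; its difference has finite support and forgets exactly the
  -- constants. Everything commutes with translation.
  let δ : (kˣ → ℂ) → kˣ → ℂ := fun F x =>
    F x - A F (ord x) + (A F (ord x + 1) - A F (ord x))
  have hδmem : ∀ y, δ (res y) ∈ schwartz k := by
    intro y
    obtain ⟨N, h0, h1⟩ := exists_forall_chartZero_eq y.2
    have hA0 : ∀ n ≤ -N, A (res y) n = y.1 (chartZero 0) := fun n hn =>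
      hconst _ _ _ fun x hx => h0 x (by lia)
    have hA1 : ∀ n, N ≤ n → A (res y) n = y.1 (chartInfty 0) := fun n hn =>
      hconst _ _ _ fun x hx => h1 x (by lia)
    refine mem_schwartz_of (N := N + 1) (((hres y).sub (hord _)).add
      (hord fun n => A (res y) (n + 1) - A (res y) n)) fun x hx => ?_
    rcases hx with hx | hx
    · change y.1 (chartZero (x : k)) - _ + (_ - _) = 0
      rw [h0 x (by lia), hA0 _ (by lia), hA0 _ (by lia)]
      ring
    · change y.1 (chartZero (x : k)) - _ + (_ - _) = 0
      rw [h1 x (by lia), hA1 _ (by lia), hA1 _ (by lia)]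
      ring
  let D : rowFunctions k →ₗ[ℂ] schwartz k :=
    { toFun y := ⟨δ (res y), hδmem y⟩
      map_add' y y' := by
        apply Subtype.ext
        funext x
        have h := hadd _ _ (hres y).continuous (hres y').continuous
        change δ (res y + res y') x = δ (res y) x + δ (res y') x
        simp only [δ, h, Pi.add_apply]
        ring
      map_smul' c y := by
        apply Subtype.ext
        funext x
        change δ (c • res y) x = c * δ (res y) x
        simp only [δ, hsmul, Pi.smul_apply, smul_eq_mul]
        ring }
  have hD : ∀ y x, (D y).1 x = res y x - A (res y) (ord x) +
      (A (res y) (ord x + 1) - A (res y) (ord x)) := fun _ _ => rfl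
  refine ⟨D, ?_, fun y => ⟨fun h => ?_, ?_⟩, ?_⟩
  · intro G
    obtain ⟨N, hN⟩ := exists_of_mem_schwartz G.2
    have hAN : ∀ n, n ≤ -N ∨ N ≤ n → A G.1 n = 0 := fun n hn => hconst _ _ _ fun x hx => hN x (by lia)
    -- `s` is the sequence with difference `A G` that vanishes for large `n`. The preimage of `G` is
    -- then `G - A G + s`, whose average is `s`.
    let s : ℤ → ℂ := fun n => -∑ m ∈ Finset.Ico n N, A G.1 m
    have hs1 : ∀ n, N ≤ n → s n = 0 := fun n hn => by simp [s, Finset.Ico_eq_empty_of_le hn]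
    have hs : ∀ n, s (n + 1) - s n = A G.1 n := by
      intro n
      by_cases hn : n < N
      · simp only [s]
        have hI : Finset.Ico n N = insert n (Finset.Ico (n + 1) N) := by
          ext m
          simp only [Finset.mem_insert, Finset.mem_Ico]
          lia
        rw [hI, Finset.sum_insert (by simp)]
        ring
      · rw [hs1 _ (by lia), hs1 _ (by lia), hAN n (by lia), sub_zero]
    have hs0 : ∀ n ≤ -N, s n = s (-N) := by
      intro n hn
      simp only [s]
      rw [← Finset.sum_subset (Finset.Ico_subset_Ico_left hn)]
      intro m hm hm'
      rw [Finset.mem_Ico] at hm hm'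
      exact hAN m (by lia)
    let H : kˣ → ℂ := fun x => s (ord x) - A G.1 (ord x)
    have hH : IsLocallyConstant H := hord fun n => s n - A G.1 n
    obtain ⟨y, hy, hyF⟩ := exists_rowFunctions_chartZero (F := G.1 + H) (N := N) (c₀ := s (-N))
      (c₁ := 0) (G.2.1.add hH) (fun x hx => by
        simp only [Pi.add_apply, H]
        rw [hN x (Or.inl hx), hAN _ (Or.inl hx), hs0 _ hx]
        ring) (fun x hx => by
        simp only [Pi.add_apply, H]
        rw [hN x (Or.inr hx), hAN _ (Or.inr hx), hs1 _ hx]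
        ring)
    have hr : res ⟨y, hy⟩ = G.1 + H := funext hyF
    have hA : ∀ n, A (res ⟨y, hy⟩) n = s n := by
      intro n
      rw [hr, hadd _ _ G.2.1.continuous hH.continuous, Pi.add_apply,
        hconst H n (s n - A G.1 n) fun x hx => by simp only [H, hx]]
      ring
    refine ⟨⟨y, hy⟩, Subtype.ext (funext fun x => ?_)⟩
    rw [hD, hA, hA, hs, hr]
    simp only [Pi.add_apply, H]
    ring
  -- If `D y = 0`, then `res y` depends only on `ord`, so it equals its own average, and the
  -- difference of that average vanishes.
  · have h1 : ∀ x, res y x = A (res y) (ord x) - (A (res y) (ord x + 1) - A (res y) (ord x)) := by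
      intro x
      have := congrFun (congrArg Subtype.val h) x
      rw [hD] at this
      have h2 : ((0 : schwartz k) : kˣ → ℂ) x = 0 := rfl
      rw [h2] at this
      linear_combination this
    have h2 : ∀ n, A (res y) (n + 1) = A (res y) n := by
      intro n
      have := hconst (res y) n _ fun x hx => by rw [h1 x, hx]
      linear_combination this
    have h3 : ∀ n, A (res y) n = A (res y) 0 := by
      intro n
      induction n using Int.induction_on with
      | zero => rfl
      | succ n ih => rw [h2, ih]
      | pred n ih => rw [← ih, ← h2 (-(n : ℤ) - 1), sub_add_cancel]
    refine mem_rowConst_of_chartZero (c := A (res y) 0) fun t => ?_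
    refine (h1 t).trans ?_
    rw [h3, h3 (ord t + 1)]
    ring
  · rintro ⟨c, hc⟩
    have h1 : ∀ n, A (res y) n = c := fun n => hconst _ _ _ fun x _ => hc _
    refine Subtype.ext (funext fun x => ?_)
    rw [hD, h1, h1, show res y x = c from hc _]
    change c - c + (c - c) = 0
    ring
  · intro a b d y y' hd hy'
    -- The row `(x, 1)` is sent to `(x * a, b)`, on the same line as `(x * (a / b), 1)`.
    have h1 : res y' = fun x => res y (x * (a / b)) := by
      funext x
      refine (hy' _).trans (rowFunctions_apply_eq y.2 (a := (b : k)) ?_)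
      rw [Units.val_mul, hd]
      ext j
      fin_cases j
      · simp [chartZero, Matrix.mul_apply]
        field_simp
      · simp [chartZero, Matrix.mul_apply]
    refine Subtype.ext (funext fun x => ?_)
    change (D y').1 x = (D y).1 (x * (a / b))
    rw [hD, hD, h1, htr, htr, ord_mul, add_right_comm]

end Split

/-! ### Bessel functionals and the twisted Jacquet module when `K` is split -/

section SplitBessel
open ValuativeRel MeasureTheory

variable {k : Type*} [Field k] {K : Type*} [CommRing K] [Algebra k K]

/-- The idempotents `(1, 0)` and `(0, 1)` cut out nonzero row vectors on which `K` acts through its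
two coordinates; these are the rows of `R`, and the idempotents also prove their independence. -/
theorem exists_diagonalization (e : K ≃ₐ[k] k × k) {ι : K →ₐ[k] Matrix (Fin 2) (Fin 2) k}
    (hι : Function.Injective ι) :
    ∃ R : GL (Fin 2) k, ∀ x : Kˣ,
      (R * unitsEmb ι x * R⁻¹).1 = !![(e x).1, 0; 0, (e x).2] := by
  have hrow : ∀ p : K, p ≠ 0 → ∃ v : Fin 2 → k, v ᵥ* ι p ≠ 0 := by
    intro p hp
    by_contra! H
    apply hp
    apply hι
    rw [map_zero]
    ext i j
    have := congrFun (H (Pi.single i 1)) j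
    rwa [Matrix.single_one_vecMul] at this
  have hp0 : e.symm (1, 0) ≠ 0 := fun h => by
    rw [map_eq_zero_iff _ e.symm.injective] at h
    exact one_ne_zero (congrArg Prod.fst h)
  have hq0 : e.symm (0, 1) ≠ 0 := fun h => by
    rw [map_eq_zero_iff _ e.symm.injective] at h
    exact one_ne_zero (congrArg Prod.snd h)
  obtain ⟨v, hv⟩ := hrow _ hp0
  obtain ⟨w, hw⟩ := hrow _ hq0
  have hpx : ∀ x, e.symm (1, 0) * x = (e x).1 • e.symm (1, 0) := fun x => by
    apply e.injective
    rw [map_mul, map_smul, AlgEquiv.apply_symm_apply]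
    ext <;> simp
  have hqx : ∀ x, e.symm (0, 1) * x = (e x).2 • e.symm (0, 1) := fun x => by
    apply e.injective
    rw [map_mul, map_smul, AlgEquiv.apply_symm_apply]
    ext <;> simp
  have hv' : ∀ x, (v ᵥ* ι (e.symm (1, 0))) ᵥ* ι x = (e x).1 • (v ᵥ* ι (e.symm (1, 0))) := fun x => by
    rw [Matrix.vecMul_vecMul, ← map_mul, hpx, map_smul, Matrix.vecMul_smul]
  have hw' : ∀ x, (w ᵥ* ι (e.symm (0, 1))) ᵥ* ι x = (e x).2 • (w ᵥ* ι (e.symm (0, 1))) := fun x => by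
    rw [Matrix.vecMul_vecMul, ← map_mul, hqx, map_smul, Matrix.vecMul_smul]
  generalize v ᵥ* ι (e.symm (1, 0)) = ρ at hv hv'
  generalize w ᵥ* ι (e.symm (0, 1)) = σ at hw hw'
  have hdet : (Matrix.of ![ρ, σ]).det ≠ 0 := by
    intro h
    obtain ⟨u, hu, hu0⟩ := Matrix.exists_vecMul_eq_zero_iff.2 h
    have h1 : u 0 • ρ + u 1 • σ = 0 := by
      rw [← hu0]
      ext j
      simp [Matrix.vecMul, dotProduct, Fin.sum_univ_two]
    have h2 := congrArg (fun z => z ᵥ* ι (e.symm (1, 0))) h1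
    have h3 := congrArg (fun z => z ᵥ* ι (e.symm (0, 1))) h1
    simp only [Matrix.add_vecMul, Matrix.smul_vecMul, hv', hw', AlgEquiv.apply_symm_apply, one_smul,
      zero_smul, smul_zero, add_zero, zero_add, Matrix.zero_vecMul] at h2 h3
    apply hu
    ext j
    fin_cases j
    · exact (smul_eq_zero.1 h2).resolve_right hv
    · exact (smul_eq_zero.1 h3).resolve_right hw
  refine ⟨toGL ⟨_, hdet⟩, fun x => ?_⟩
  have key : (toGL ⟨_, hdet⟩).1 * (unitsEmb ι x).1 =
      !![(e x).1, 0; 0, (e x).2] * (toGL ⟨_, hdet⟩).1 := by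
    have h1 : ∀ i, (Matrix.of ![ρ, σ] * ι x) i = (Matrix.of ![ρ, σ]) i ᵥ* ι x := fun i => rfl
    change Matrix.of ![ρ, σ] * ι x = _ * Matrix.of ![ρ, σ]
    ext i j
    rw [h1]
    fin_cases i
    · change (ρ ᵥ* ι x) j = _
      rw [hv']
      simp [Matrix.mul_apply]
    · change (σ ᵥ* ι x) j = _
      rw [hw']
      simp [Matrix.mul_apply]
  rw [Units.val_mul, Units.val_mul, key, Matrix.mul_assoc, Units.mul_inv, Matrix.mul_one]

variable [ValuativeRel k] [TopologicalSpace k] [IsNonarchimedeanLocalField k]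

/-- Right translation by the diagonalizing matrix `R` carries the action of `K^*` to that of the
diagonal torus. -/
theorem exists_rowFunctions_to_schwartz_of_split (e : K ≃ₐ[k] k × k)
    {ι : K →ₐ[k] Matrix (Fin 2) (Fin 2) k} (hι : Function.Injective ι) :
    ∃ D : rowFunctions k →ₗ[ℂ] schwartz k, Function.Surjective D ∧
      (∀ y, D y = 0 ↔ y ∈ rowConst k) ∧
      ∀ (x : Kˣ) y, D (rowTranslate ι x y) = schwartzRep k (splitRatio e x) (D y) := by
  obtain ⟨R, hR⟩ := exists_diagonalization e hι
  obtain ⟨D, hsurj, hker, hD⟩ := exists_rowFunctions_to_schwartz (k := k)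
  let τ : GL (Fin 2) k → rowFunctions k →ₗ[ℂ] rowFunctions k := fun g =>
    { toFun y := ⟨fun h => y.1 (h * g), smoothFunctions_translate y.2 _⟩
      map_add' _ _ := rfl
      map_smul' _ _ := rfl }
  have hτ : ∀ g y h, (τ g y).1 h = y.1 (h * g) := fun _ _ _ => rfl
  refine ⟨D ∘ₗ τ R, hsurj.comp fun y => ⟨τ R⁻¹ y, Subtype.ext (funext fun h => ?_)⟩, fun y => ?_,
    fun x y => ?_⟩
  · rw [hτ, hτ, mul_inv_cancel_right]
  · rw [LinearMap.comp_apply, hker]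
    refine ⟨fun ⟨c, hc⟩ => ⟨c, fun h => ?_⟩, fun ⟨c, hc⟩ => ⟨c, fun h => hc _⟩⟩
    have := hc (h * R⁻¹)
    rwa [hτ, inv_mul_cancel_right] at this
  · refine hD (Units.map ((MonoidHom.fst k k).comp (e : K →* k × k)) x)
      (Units.map ((MonoidHom.snd k k).comp (e : K →* k × k)) x) _ (τ R y) _ (hR x) fun h => ?_
    change y.1 (h * R * unitsEmb ι x) = y.1 (h * (R * unitsEmb ι x * R⁻¹) * R)
    group

/-- The functional integrates `D y` against `χ⁻¹` on `k^*`. Constants are already killed by `D`, so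
the trivial `χ` is not an exception. -/
theorem exists_split_functional [TopologicalSpace K] [IsModuleTopology k K] (e : K ≃ₐ[k] k × k)
    {ι : K →ₐ[k] Matrix (Fin 2) (Fin 2) k} (hι : Function.Injective ι)
    {χ : Kˣ →* ℂˣ} (hχ : Continuous χ)
    (hχk : ∀ a : kˣ, χ (Units.map (algebraMap k K : k →* K) a) = 1) :
    ∃ l : rowFunctions k →ₗ[ℂ] ℂ, l ≠ 0 ∧ (∀ y ∈ rowConst k, l y = 0) ∧
      ∀ (x : Kˣ) y, l (rowTranslate ι x y) = χ x * l y := by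
  obtain ⟨D, hsurj, hker, hD⟩ := exists_rowFunctions_to_schwartz_of_split e hι
  have hadd := IsModuleTopology.toContinuousAdd k K
  -- On units this is the section `c ↦ (c, 1)` of `splitRatio e`; since `χ` is trivial on `k^*`, it
  -- is determined by its restriction to the image.
  let j₀ : k →* K := (e.symm : k × k →* K).comp (MonoidHom.inl k k)
  have hj₀ : Continuous j₀ := by
    have h1 : ∀ c : k, j₀ c = c • e.symm (1, 0) + e.symm (0, 1) := fun c => by
      rw [← map_smul, ← map_add]
      change e.symm (c, 1) = _
      simp
    have h2 : Continuous fun c : k => c • e.symm (1, 0) + e.symm (0, 1) :=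
      (continuous_id.smul continuous_const).add continuous_const
    exact h2.congr fun c => (h1 c).symm
  let j : kˣ →* Kˣ := Units.map j₀
  have hj : Continuous j := hj₀.units_map j₀
  have hχj : ∀ x, χ x = χ (j (splitRatio e x)) := by
    intro x
    let a := Units.map ((MonoidHom.fst k k).comp (e : K →* k × k)) x
    let b := Units.map ((MonoidHom.snd k k).comp (e : K →* k × k)) x
    have h1 : x = j (a / b) * Units.map (algebraMap k K : k →* K) b := by
      apply Units.ext
      apply e.injective
      have h2 : e (j (a / b) : K) = (((a / b : kˣ) : k), 1) := e.apply_symm_apply _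
      have h3 : e (Units.map (algebraMap k K : k →* K) b : K) = ((b : k), (b : k)) :=
        e.commutes (b : k)
      rw [Units.val_mul, map_mul, h2, h3, Prod.mk_mul_mk, ← Units.val_mul, div_mul_cancel, one_mul]
      rfl
    conv_lhs => rw [h1, map_mul, hχk, mul_one]
    rfl
  let _ : MeasurableSpace kˣ := _root_.borel kˣ
  have : BorelSpace kˣ := ⟨rfl⟩
  let θ : kˣ → ℂ := fun t => ((χ (j t))⁻¹ : ℂˣ)
  have hθ : Continuous θ := Units.continuous_val.comp (hχ.comp hj).inv
  have hint : ∀ G : schwartz k, Integrable (fun t => G.1 t * θ t) (Measure.haar : Measure kˣ) :=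
    fun G => (G.2.1.continuous.mul hθ).integrable_of_hasCompactSupport G.2.2.mul_right
  let l₀ : schwartz k →ₗ[ℂ] ℂ :=
    { toFun G := ∫ t, G.1 t * θ t ∂Measure.haar
      map_add' G G' := by
        rw [← integral_add (hint G) (hint G')]
        congr 1
        funext t
        exact add_mul _ _ _
      map_smul' c G := by
        rw [RingHom.id_apply, ← integral_smul]
        congr 1
        funext t
        exact mul_assoc _ _ _ }
  have hl₀ : ∀ (c : kˣ) G, l₀ (schwartzRep k c G) = χ (j c) * l₀ G := by
    intro c G
    change ∫ t, G.1 (t * c) * θ t ∂Measure.haar = χ (j c) * ∫ t, G.1 t * θ t ∂Measure.haar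
    rw [← integral_const_mul, ← integral_mul_left_eq_self (fun t => χ (j c) * (G.1 t * θ t)) c]
    congr 1
    funext t
    have h1 : (χ (j c) : ℂ) * θ (t * c) = θ t := by
      simp only [θ]
      rw [← Units.val_mul, map_mul, map_mul, mul_inv_rev, mul_inv_cancel_left]
    rw [mul_comm c t, mul_left_comm, h1]
  refine ⟨l₀ ∘ₗ D, fun h0 => ?_, fun y hy => ?_, fun x y => ?_⟩
  -- For nonvanishing, `G` is the indicator of a neighbourhood of `1` on which `χ⁻¹` has positive
  -- real part; the condition `ord t = 0` makes its support compact.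
  · obtain ⟨G, hG1, hG⟩ : ∃ G : schwartz k, G.1 1 = 1 ∧ ∀ t, G.1 t = 0 ∨ G.1 t = 1 ∧ 0 < (θ t).re := by
      have hU : {t : kˣ | 0 < (θ t).re} ∈ nhds (1 : kˣ) :=
        (isOpen_lt continuous_const (Complex.continuous_re.comp hθ)).mem_nhds (by simp [θ])
      rw [Units.isEmbedding_val₀.nhds_eq_comap, Filter.mem_comap] at hU
      obtain ⟨V, hV, hVU⟩ := hU
      have hV' : (fun z : k => 1 + z) ⁻¹' V ∈ nhds (0 : k) := by
        refine (continuous_const.add continuous_id).continuousAt ?_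
        simpa using hV
      obtain ⟨γ, hγ⟩ := exists_ball_subset hV'
      have hS : IsClopen ({t : kˣ | (t : k) - 1 ∈ ball k γ} ∩ {t : kˣ | ord t = 0}) :=
        ((isClopen_ball γ).preimage (Units.continuous_val.sub continuous_const)).inter
          ((isClopen_discrete {0}).preimage continuous_ord)
      have hmem : _ ∈ schwartz k := mem_schwartz_of (isLocallyConstant_indicator_one hS) (N := 1)
        fun t ht => Set.indicator_of_notMem (fun h => by
          have h1 : ord t = 0 := h.2
          lia) _
      refine ⟨⟨_, hmem⟩, ?_, fun t => ?_⟩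
      · have h1 : (1 : kˣ) ∈ {t : kˣ | (t : k) - 1 ∈ ball k γ} ∩ {t : kˣ | ord t = 0} :=
          ⟨by simp [(ball k γ).zero_mem], ord_one⟩
        exact Set.indicator_of_mem h1 _
      · by_cases ht : t ∈ {t : kˣ | (t : k) - 1 ∈ ball k γ} ∩ {t : kˣ | ord t = 0}
        · refine Or.inr ⟨Set.indicator_of_mem ht _, hVU ?_⟩
          have := hγ ht.1
          simpa using this
        · exact Or.inl (Set.indicator_of_notMem ht _)
    obtain ⟨y, rfl⟩ := hsurj G
    have h1 : (∫ t, (D y).1 t * θ t ∂(Measure.haar : Measure kˣ)).re = 0 := by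
      rw [show ∫ t, (D y).1 t * θ t ∂(Measure.haar : Measure kˣ) = 0 from
        LinearMap.congr_fun h0 y, Complex.zero_re]
    rw [← Complex.reCLM_apply, ← Complex.reCLM.integral_comp_comm (hint _)] at h1
    refine absurd h1 (ne_of_gt ?_)
    refine (Complex.continuous_re.comp
      ((D y).2.1.continuous.mul hθ)).integral_pos_of_hasCompactSupport_nonneg_nonzero (x := 1)
      ((D y).2.2.mul_right.comp_left Complex.zero_re) (fun t => ?_) ?_
    · change 0 ≤ ((D y).1 t * θ t).re
      rcases hG t with h | ⟨h, h'⟩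
      · rw [h, zero_mul, Complex.zero_re]
      · rw [h, one_mul]
        exact h'.le
    · change ((D y).1 1 * θ 1).re ≠ 0
      rw [hG1]
      simp [θ]
  · rw [LinearMap.comp_apply, (hker y).2 hy, map_zero]
  · rw [LinearMap.comp_apply, LinearMap.comp_apply, hD, hl₀, ← hχj]

set_option maxHeartbeats 1000000 in
/-- In the split case the twisted Jacquet module of the Steinberg representation is `𝒮(k^*)`. -/
theorem nonempty_twistedJacquet_equiv_schwartz (h2 : (2 : k) ≠ 0) {ψ₀₀ : AddChar k ℂ}
    (hψ : Continuous ψ₀₀) (hψ_ne : ψ₀₀ ≠ 1) {s : Matrix (Fin 2) (Fin 2) k} (hs : s.IsSymm)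
    (hs_det : s.det ≠ 0) {ι : K →ₐ[k] Matrix (Fin 2) (Fin 2) k} (hι : Function.Injective ι)
    (hT : ∀ x : Kˣ, unitsEmb ι x ∈ besselTorus s) (e : K ≃ₐ[k] k × k) :
    Nonempty (Representation.Equiv
      ((twistedJacquet (steinberg k) ψ₀₀ s).comp ((unitsEmb ι).codRestrict (besselTorus s) hT))
      ((schwartzRep k).comp (splitRatio e))) := by
  obtain ⟨E, hE⟩ := exists_twistedJacquet_equiv h2 hψ hψ_ne hs hs_det
  obtain ⟨D, hsurj, hker, hD⟩ := exists_rowFunctions_to_schwartz_of_split e hι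
  obtain ⟨E', hE'⟩ := exists_linearEquiv_of_ker_eq
    (Submodule.mkQ_surjective (rowConst k)) hsurj (by
      ext y
      rw [Submodule.ker_mkQ, LinearMap.mem_ker, hker])
  refine ⟨Representation.Equiv.mk (E.trans E') fun x => LinearMap.ext fun v => ?_⟩
  obtain ⟨y, hy⟩ := Submodule.mkQ_surjective (rowConst k) (E v)
  have h1 := hE ⟨_, hT x⟩ v y (rowTranslate ι x y) hy.symm fun _ => rfl
  have h3 : E' (E v) = D y := by rw [← hy, hE']
  change E' (E (twistedJacquet (steinberg k) ψ₀₀ s ⟨_, hT x⟩ v)) =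
    schwartzRep k (splitRatio e x) (E' (E v))
  rw [h1, h3, hE', hD]

end SplitBessel
end
end GSpFour

/-! ### The proposition -/

theorem mainTheorem12
    {k : Type*} [Field k] [ValuativeRel k] [TopologicalSpace k] [IsNonarchimedeanLocalField k]
    (h2 : (2 : k) ≠ 0)
    {K : Type*} [CommRing K] [Algebra k K] [Algebra.IsQuadraticExtension k K]
    [TopologicalSpace K] [IsModuleTopology k K]
    (ψ₀₀ : AddChar k ℂ) (hψ_cont : Continuous ψ₀₀) (hψ_ne : ψ₀₀ ≠ 1)
    (s : Matrix (Fin 2) (Fin 2) k) (hs : s.IsSymm) (hs_det : s.det ≠ 0)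
    (ι : K →ₐ[k] Matrix (Fin 2) (Fin 2) k) (hι : Function.Injective ι)
    (hT : ∀ x : Kˣ, GSpFour.unitsEmb ι x ∈ GSpFour.besselTorus s) :
    (∀ χ : Kˣ →* ℂˣ, Continuous χ →
      (∀ a : kˣ, χ (Units.map (algebraMap k K : k →* K) a) = 1) →
        (IsField K →
          (GSpFour.HasBesselModel (GSpFour.steinberg k) ψ₀₀ s ι χ ↔ χ ≠ 1)) ∧
        (Nonempty (K ≃ₐ[k] k × k) →
          GSpFour.HasBesselModel (GSpFour.steinberg k) ψ₀₀ s ι χ)) ∧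
    (∀ e : K ≃ₐ[k] k × k,
      Nonempty (Representation.Equiv
        ((GSpFour.twistedJacquet (GSpFour.steinberg k) ψ₀₀ s).comp
          ((GSpFour.unitsEmb ι).codRestrict (GSpFour.besselTorus s) hT))
        ((GSpFour.schwartzRep k).comp (GSpFour.splitRatio e)))) := by
  refine ⟨fun χ hχ hχk => ⟨fun hK => ?_, fun ⟨e⟩ => ?_⟩, fun e => ?_⟩
  · rw [GSpFour.hasBesselModel_steinberg_iff h2 hψ_cont hψ_ne hs hs_det ι hT]
    constructor
    · rintro ⟨l, hl0, hlc, hl⟩ rfl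
      exact hl0 (GSpFour.eq_zero_of_invariant hK ι hlc fun x y =>
        (hl x y (GSpFour.rowTranslate ι x y) fun _ => rfl).trans (one_mul _))
    · intro hχ1
      obtain ⟨l, hl0, hlc, hl⟩ := GSpFour.exists_equivariant_functional hK ι hχ hχk hχ1
      exact ⟨l, hl0, hlc, fun x y y' hy => by
        rw [← hl, show y' = GSpFour.rowTranslate ι x y from Subtype.ext (funext hy)]⟩
  · rw [GSpFour.hasBesselModel_steinberg_iff h2 hψ_cont hψ_ne hs hs_det ι hT]
    obtain ⟨l, hl0, hlc, hl⟩ := GSpFour.exists_split_functional e hι hχ hχk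
    exact ⟨l, hl0, hlc, fun x y y' hy => by
      rw [← hl, show y' = GSpFour.rowTranslate ι x y from Subtype.ext (funext hy)]⟩
  · exact GSpFour.nonempty_twistedJacquet_equiv_schwartz h2 hψ_cont hψ_ne hs hs_det hι hT e
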